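/- **Background.** Let $a^*=3/(2(26+15\sqrt3))^{1/3}$, let $0<a<a^*$ and $\ell\in\mathbb N$, and put $$S(z)=(1+az)^{2/3},\qquad q(z)=\frac{a^2}{6\pi(3+4az+a^2z^2)}\qquad (z>-1/a).$$ A dot denotes $d/dz$. Let $z_c$ be the largest root in $(-1/a,\infty)$ of $z+S-z\dot S=0$ (the Cauchy horizon; $z_c<0$). Let $\tilde A(z)=\mathrm{diag}\big(0,0,-\tfrac1z,-(z-S+z\dot S)^{-1},-(z+S-z\dot S)^{-1}\big)$ and $$\tilde C=\begin{pmatrix}c_{11}&c_{12}&c_{13}&c_{14}&c_{15}\\ c_{21}&c_{22}&0&c_{24}&c_{25}\\ c_{31}&c_{32}&c_{33}&c_{34}&c_{35}\\ c_{41}&0&c_{43}&c_{44}&c_{45}\\ c_{51}&0&c_{53}&c_{54}&c_{55}\end{pmatrix},$$ where - $c_{11}=\dfrac{-3z(-1+\dot S)\dot S^2-S^2\ddot S+S(3\dot S^2-z\ddot S+\dot S(-3+2z\ddot S))}{S(-1+\dot S)(S-z\dot S)}$, $\;c_{13}=c_{14}=c_{15}=-c_{12}=\dfrac{-1+\dot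 S}{2S}$; - $c_{21}=-\dfrac{8\pi qS}{-1+\dot S}$, $c_{22}=-\dfrac{\dot q}{q}$, $c_{24}=-\dfrac{4\pi qS}{1+\dot S}$, $c_{25}=-\dfrac{4\pi qS}{-1+\dot S}$; - $c_{31}=\dfrac{2\big(2z^3\dot S^4-2z^2S\dot S^2(3\dot S+z\ddot S)+S^3(-2\dot S+z^2S^{(3)})+zS^2(6\dot S^2+z^2\ddot S^2+z\dot S(2\ddot S-zS^{(3)}))\big)}{zS(-1+\dot S)(S-z\dot S)^2}$, $c_{32}=-\dfrac2z-\dfrac{\dot q}{q}$, $c_{33}=\dfrac1z+\dfrac{2\dot S}{S}$; - $c_{34}=\dfrac{z\dot S(2-\ell-\ell^2+2\dot S+2\dot S^2)-4S^2\ddot S+S(-2+\ell+\ell^2-2\dot S^2-2z\ddot S+\dot S(-2+4z\ddot S))}{2zS(1+\dot S)}$; - $c_{35}=\dfrac{z\dot S(-2+\ell+\ell^2+2\dot S-2\dot S^2)+4S^2\ddot S-S(-2+\ell+\ell^2-2\dot S^2+2z\ddot S+\dot S(2+4z\ddot S))}{2zS(-1+\dot S)}$; - $c_{41}=\dfrac{4(1+\dot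 S)(-z\dot S^2+S(\dot S+z\ddot S))}{S(-1+\dot S)(z-S+z\dot S)}$, $c_{43}=c_{45}=\dfrac{(1+\dot S)(S-z\dot S)}{S(z-S+z\dot S)}$, $c_{44}=\dfrac{3+(z+S)\ddot S+\dot S(3+z\ddot S)}{(1+\dot S)(z-S+z\dot S)}$; - $c_{51}=-\dfrac{4(-z\dot S^2+S(\dot S+z\ddot S))}{S(z+S-z\dot S)}$, $c_{53}=c_{54}=-\dfrac{(-1+\dot S)(S-z\dot S)}{S(z+S-z\dot S)}$, $c_{55}=-\dfrac{3+(-z+S)\ddot S+\dot S(-3+z\ddot S)}{(-1+\dot S)(z+S-z\dot S)}$. Let also $$\tilde f=\Big(0,\,0,\,-\frac{16\pi q(-S+z\dot S)}{zS},\,-\frac{8\pi q(1+\dot S)(S-z\dot S)}{S(z-S+z\dot S)},\,\frac{8\pi q(-1+\dot S)(S-z\dot S)}{S(z+S-z\dot S)}\Big)^T .$$ With $t=z-z_c$ put $A(t)=t\tilde A(z_c+t)$, $C(t)=t\tilde C(z_c+t)$, $\vec h(t)=t\tilde f(z_c+t)$. Fix $t_1$ with $0<t_1<-z_c$ and $g\in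 C_0^\infty(\mathbb R,\mathbb R)$, and consider $$t\,\partial_t\vec u+A(t)\,\partial_p\vec u+C(t)\,\vec u=\vec h(t)\,g(p),\qquad 0<t\le t_1,\ p\in\mathbb R,\qquad \vec u(t_1,\cdot)=\vec u^{(0)}. \tag{1}$$ For $\vec u^{(0)}\in\mathcal S:=L^1(\mathbb R,\mathbb R^5)$ a solution of (1) is a $\vec u\in C((0,t_1],L^1(\mathbb R,\mathbb R^5))$ with $\vec u(t_1)=\vec u^{(0)}$ that satisfies the equation weakly in $p$: for every test function $\psi\in C_0^\infty(\mathbb R)$ the vector $\int\vec u\,\psi\,dp$ is differentiable in $t$ on $(0,t_1]$ and $t\frac{d}{dt}\int\vec u\,\psi\,dp=A(t)\int\vec u\,\psi'\,dp-C(t)\int\vec u\,\psi\,dp+\vec h(t)\int g\,\psi\,dp$. The average $\bar u(t)=\int_{\mathbb R}\vec u(t,p)\,dp$ obeys $$t\,\frac{d\bar u}{dt}=-C(t)\bar u+\vec h(t)\int_{\mathbb R} g\,dp,\qquad 0<t\le t_1. \tag{2}$$ Let $c=\lim_{t\to0^+}C_{55}(t)$. Let $\bar\phi_1,\dots,\bar\phi_5$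 be a basis of solutions of the homogeneous equation associated with (2), and $\bar\chi$ a solution of (2), such that $\bar\phi_1,\dots,\bar\phi_4,\bar\chi$ have finite limits as $t\to0^+$ and $t^{c}\bar\phi_5(t)\to e_5=(0,0,0,0,1)^T$. Every $\vec u^{(0)}\in\mathcal S$ has unique coefficients $d_i=d_i(\vec u^{(0)})$ with $\int\vec u^{(0)}dp=\bar\chi(t_1)+\sum_{i=1}^5d_i\bar\phi_i(t_1)$. Put $\mathcal S'=\{\vec u^{(0)}\in\mathcal S: d_5(\vec u^{(0)})=0\}$ (for some such system $\bar\phi_i,\bar\chi$) and $\mathcal S''=\mathcal S\setminus\mathcal S'$. **Theorem.** If $\vec u^{(0)}\in\mathcal S''$ and $\vec u$ is a solution of (1) with this data, then for every $1\le r\le\infty$ $$\lim_{t\to0^+}\|\vec u(t,\cdot)\|_{L^r(\mathbb R,\mathbb R^5)}=\infty,$$ where the norm is taken to be $+\infty$ if $\vec u(t,\cdot)\notin L^r$. -/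

import Mathlib

open MeasureTheory Filter Topology Set
open scoped ContDiff

noncomputable section

namespace LTB

/-- State space `ℝ⁵` of the perturbation vector. -/
abbrev V : Type := EuclideanSpace ℝ (Fin 5)

/-- Radial function `S(z) = (1 + a z)^(2/3)` of the self-similar LTB spacetime. -/
def S (a z : ℝ) : ℝ := (1 + a * z) ^ (2 / 3 : ℝ)

/-- First, second and third derivatives of the radial function in `z`. -/
def S1 (a z : ℝ) : ℝ := deriv (S a) z

def S2 (a z : ℝ) : ℝ := iteratedDeriv 2 (S a) z

def S3 (a z : ℝ) : ℝ := iteratedDeriv 3 (S a) z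

/-- Density function; `dq` is its derivative. -/
def q (a z : ℝ) : ℝ := a ^ 2 / (6 * Real.pi * (3 + 4 * a * z + a ^ 2 * z ^ 2))

def dq (a z : ℝ) : ℝ := deriv (q a) z

/-- Largest value of `a` for which the singularity is naked. -/
def aStar : ℝ := 3 / (2 * (26 + 15 * Real.sqrt 3)) ^ (1 / 3 : ℝ)

/-- `zc` is the Cauchy horizon: the first root, in the direction of decreasing `z` and before the
shell-focusing singularity `z = -1/a`, of `z + S - z S' = 0`. -/
def IsCauchyHorizon (a zc : ℝ) : Prop :=
  IsGreatest {z : ℝ | -1 / a < z ∧ z + S a z - z * S1 a z = 0} zc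

/-- Coefficient of `∂u/∂p` in `∂u/∂z + Ã ∂u/∂p + C̃ u = f g`. -/
def Atilde (a z : ℝ) : Matrix (Fin 5) (Fin 5) ℝ :=
  let s := S a z
  let d := S1 a z
  Matrix.diagonal ![0, 0, -(1 / z), -(z - s + z * d)⁻¹, -(z + s - z * d)⁻¹]

/-- Coefficient of `u`, for the multipole number `l`. -/
def Ctilde (a : ℝ) (l : ℕ) (z : ℝ) : Matrix (Fin 5) (Fin 5) ℝ :=
  let s := S a z
  let d := S1 a z
  let e := S2 a z
  let k := S3 a z
  let r := q a z
  let L : ℝ := l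
  let c11 := (-3 * z * (-1 + d) * d ^ 2 - s ^ 2 * e
    + s * (3 * d ^ 2 - z * e + d * (-3 + 2 * z * e))) / (s * (-1 + d) * (s - z * d))
  let c12 := -((-1 + d) / (2 * s))
  let c13 := (-1 + d) / (2 * s)
  let c14 := (-1 + d) / (2 * s)
  let c15 := (-1 + d) / (2 * s)
  let c21 := -(8 * Real.pi * r * s / (-1 + d))
  let c22 := -(dq a z / r)
  let c24 := -(4 * Real.pi * r * s / (1 + d))
  let c25 := -(4 * Real.pi * r * s / (-1 + d))
  let n1 := 2 * (2 * z ^ 3 * d ^ 4 - 2 * z ^ 2 * s * d ^ 2 * (3 * d + z * e)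
    + s ^ 3 * (-2 * d + z ^ 2 * k)
    + z * s ^ 2 * (6 * d ^ 2 + z ^ 2 * e ^ 2 + z * d * (2 * e - z * k)))
  let c31 := n1 / (z * s * (-1 + d) * (s - z * d) ^ 2)
  let c32 := -(2 / z) - dq a z / r
  let c33 := 1 / z + 2 * d / s
  let n2 := z * d * (2 - L - L ^ 2 + 2 * d + 2 * d ^ 2) - 4 * s ^ 2 * e
    + s * (-2 + L + L ^ 2 - 2 * d ^ 2 - 2 * z * e + d * (-2 + 4 * z * e))
  let c34 := n2 / (2 * z * s * (1 + d))
  let n3 := z * d * (-2 + L + L ^ 2 + 2 * d - 2 * d ^ 2) + 4 * s ^ 2 * e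
    - s * (-2 + L + L ^ 2 - 2 * d ^ 2 + 2 * z * e + d * (2 + 4 * z * e))
  let c35 := n3 / (2 * z * s * (-1 + d))
  let c41 := 4 * (1 + d) * (-(z * d ^ 2) + s * (d + z * e)) / (s * (-1 + d) * (z - s + z * d))
  let c43 := (1 + d) * (s - z * d) / (s * (z - s + z * d))
  let c44 := (3 + (z + s) * e + d * (3 + z * e)) / ((1 + d) * (z - s + z * d))
  let c45 := (1 + d) * (s - z * d) / (s * (z - s + z * d))
  let c51 := -(4 * (-(z * d ^ 2) + s * (d + z * e)) / (s * (z + s - z * d)))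
  let c53 := -((-1 + d) * (s - z * d) / (s * (z + s - z * d)))
  let c54 := -((-1 + d) * (s - z * d) / (s * (z + s - z * d)))
  let c55 := -((3 + (-z + s) * e + d * (-3 + z * e)) / ((-1 + d) * (z + s - z * d)))
  !![c11, c12, c13, c14, c15;
     c21, c22, 0, c24, c25;
     c31, c32, c33, c34, c35;
     c41, 0, c43, c44, c45;
     c51, 0, c53, c54, c55]

/-- The `z`-dependent factor of the source. -/
def ftilde (a z : ℝ) : Fin 5 → ℝ :=
  let s := S a z
  let d := S1 a z
  let r := q a z
  ![0, 0,
    -(16 * Real.pi * r * (-s + z * d) / (z * s)),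
    -(8 * Real.pi * r * (1 + d) * (s - z * d) / (s * (z - s + z * d))),
    8 * Real.pi * r * (-1 + d) * (s - z * d) / (s * (z + s - z * d))]

/-- Coefficients of `t ∂u/∂t + A(t) ∂u/∂p + C(t) u = h(t) g(p)`, where `t = z - zc`. -/
def A (a zc t : ℝ) : Matrix (Fin 5) (Fin 5) ℝ := t • Atilde a (zc + t)

def C (a : ℝ) (l : ℕ) (zc t : ℝ) : Matrix (Fin 5) (Fin 5) ℝ := t • Ctilde a l (zc + t)

def h (a zc t : ℝ) : Fin 5 → ℝ := t • ftilde a (zc + t)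

/-- The exponent `c`: the limit of the `(5,5)` entry of `C(t)` as `t → 0⁺`. -/
def cExp (a : ℝ) (l : ℕ) (zc : ℝ) : ℝ := limUnder (𝓝[>] (0 : ℝ)) fun t => C a l zc t 4 4

/-- `u ∈ C((0,t₁], L¹(ℝ,ℝ⁵))` is a solution of
`t ∂u/∂t + A(t) ∂u/∂p + C(t) u = h(t) g(p)` with `u(t₁) = u₀`; the equation is understood weakly
in `p`, against smooth compactly supported test functions. -/
structure IsSolution (a : ℝ) (l : ℕ) (zc : ℝ) (g : ℝ → ℝ) (t₁ : ℝ)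
    (u₀ : Lp V 1 (volume : Measure ℝ)) (u : ℝ → Lp V 1 (volume : Measure ℝ)) : Prop where
  continuousOn : ContinuousOn u (Ioc 0 t₁)
  initial : u t₁ = u₀
  weak : ∀ (i : Fin 5) (ψ : ℝ → ℝ), ContDiff ℝ ∞ ψ → HasCompactSupport ψ →
    ∀ t ∈ Ioc 0 t₁,
      HasDerivWithinAt (fun s => ∫ p, (u s) p i * ψ p)
        (t⁻¹ * ((∑ j, A a zc t i j * ∫ p, (u t) p j * deriv ψ p)
          - (∑ j, C a l zc t i j * ∫ p, (u t) p j * ψ p)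
          + h a zc t i * ∫ p, g p * ψ p))
        (Ioc 0 t₁) t

/-- `x` solves the averaged equation `t x' = -C(t) x + G h(t)` on `(0,t₁]`; for `G = ∫ g` this is
the equation obeyed by `∫ u(t,p) dp`, and for `G = 0` it is the homogeneous equation. -/
def SolvesAveraged (a : ℝ) (l : ℕ) (zc t₁ G : ℝ) (x : ℝ → V) : Prop :=
  ∀ i : Fin 5, ∀ t ∈ Ioc 0 t₁,
    HasDerivWithinAt (fun s => x s i)
      (t⁻¹ * (-(∑ j, C a l zc t i j * x t j) + G * h a zc t i)) (Ioc 0 t₁) t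

/-- A basis `φ₁,…,φ₅` of solutions of the homogeneous averaged equation together with a particular
solution `χ` of the full one, such that `φ₁,…,φ₄` and `χ` are finite as `t → 0⁺`, while
`φ₅ ∼ t^(-c) e₅`. -/
structure IsFundamentalSystem (a : ℝ) (l : ℕ) (zc t₁ G : ℝ) (φ : Fin 5 → ℝ → V) (χ : ℝ → V) :
    Prop where
  solves : ∀ i, SolvesAveraged a l zc t₁ 0 (φ i)
  solves_particular : SolvesAveraged a l zc t₁ G χ
  linearIndependent : LinearIndependent ℝ fun i => φ i t₁
  finite : ∀ i, i ≠ 4 → ∃ v, Tendsto (φ i) (𝓝[>] 0) (𝓝 v)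
  finite_particular : ∃ v, Tendsto χ (𝓝[>] 0) (𝓝 v)
  divergent : Tendsto (fun t : ℝ => t ^ cExp a l zc • φ 4 t) (𝓝[>] 0)
    (𝓝 (EuclideanSpace.single 4 1))

/-- Data whose averaged solution `χ + d₁ φ₁ + ⋯ + d₅ φ₅` has `d₅ = 0`. -/
def SPrime (a : ℝ) (l : ℕ) (zc : ℝ) (g : ℝ → ℝ) (t₁ : ℝ) : Set (Lp V 1 (volume : Measure ℝ)) :=
  {u₀ | ∃ (φ : Fin 5 → ℝ → V) (χ : ℝ → V) (d : Fin 5 → ℝ),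
    IsFundamentalSystem a l zc t₁ (∫ p, g p) φ χ ∧
    ∫ p, u₀ p = χ t₁ + ∑ i, d i • φ i t₁ ∧ d 4 = 0}

/-- The complement of `SPrime` in `L¹(ℝ,ℝ⁵)`. -/
def SDoublePrime (a : ℝ) (l : ℕ) (zc : ℝ) (g : ℝ → ℝ) (t₁ : ℝ) :
    Set (Lp V 1 (volume : Measure ℝ)) :=
  (SPrime a l zc g t₁)ᶜ

end LTB

end

/-!
Below `aStar` the Cauchy horizon is a simple root of `z + S - z S'`: at a double root
`1 + a z = 3√3 - 5`, which forces `a = aStar`. In `t = z - zc` the system therefore has a regular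
singular point at `t = 0`, where only the last row of `C(t)` survives; its diagonal entry tends to
`c > 1`. Hence averaged solutions satisfy `t ^ c x(t) → d₅ e₅`, and `‖u(t)‖₁` is at most of order
`t ^ (-c)`.

The difference between `∫ u₅ ψ` and the full average `x₅` solves the same averaged system up to a
transport error of order `sup |ψ'| t ^ (-c)`. For a cutoff `ψ` equal to `1` on the length scale
`1 / t` this error is negligible after multiplication by `t ^ c`, so `t ^ c ∫ u₅ ψ → d₅ ≠ 0`. The
support of `ψ` has length of order `1 / t`, so by Hölder's inequality every `Lʳ` norm of `u` is at
least of order `t ^ (1 - c)`, which tends to infinity.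
-/

noncomputable section

namespace LTB

/-! ### Calculus on half-open intervals -/

theorem continuousOn_rpow_Ioc (γ T : ℝ) : ContinuousOn (fun s : ℝ => s ^ γ) (Ioc 0 T) :=
  fun s hs => (Real.continuousAt_rpow_const s γ (Or.inl hs.1.ne')).continuousWithinAt

theorem continuousOn_inv_Ioc (T : ℝ) : ContinuousOn (fun s : ℝ => s⁻¹) (Ioc 0 T) :=
  fun _ hs => (continuousAt_inv₀ hs.1.ne').continuousWithinAt

theorem intervalIntegrable_of_continuousOn_Ioc {f : ℝ → ℝ} {T t t' : ℝ}
    (hf : ContinuousOn f (Ioc 0 T)) (ht : 0 < t) (htt' : t ≤ t') (ht' : t' ≤ T) :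
    IntervalIntegrable f volume t t' :=
  (hf.mono fun _ hs => ⟨ht.trans_le hs.1, hs.2.trans ht'⟩).intervalIntegrable_of_Icc htt'

theorem tendsto_rpow_nhdsGT_zero {γ : ℝ} (hγ : 0 < γ) :
    Tendsto (fun t : ℝ => t ^ γ) (𝓝[>] 0) (𝓝 0) := by
  have h := (Real.continuousAt_rpow_const 0 γ (Or.inr hγ.le)).tendsto
  rw [Real.zero_rpow hγ.ne'] at h
  exact h.mono_left nhdsWithin_le_nhds

theorem abs_sub_le_integral_of_hasDerivWithinAt {f f' B : ℝ → ℝ} {T t t' : ℝ}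
    (hf : ∀ s ∈ Ioc 0 T, HasDerivWithinAt f (f' s) (Ioc 0 T) s)
    (hB : ContinuousOn B (Ioc 0 T)) (hfB : ∀ s ∈ Ioc 0 T, |f' s| ≤ B s)
    (ht : 0 < t) (htt' : t ≤ t') (ht' : t' ≤ T) :
    |f t' - f t| ≤ ∫ s in t..t', B s := by
  have hsub : Icc t t' ⊆ Ioc 0 T := fun s hs => ⟨ht.trans_le hs.1, hs.2.trans ht'⟩
  have hd : ∀ s ∈ Ioo t t', HasDerivAt f (f' s) s := fun s hs =>
    (hf s (hsub (Ioo_subset_Icc_self hs))).hasDerivAt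
      (mem_of_superset (isOpen_Ioo.mem_nhds hs) (Ioo_subset_Icc_self.trans hsub))
  refine norm_sub_le_integral_of_norm_deriv_le_of_le htt'
    (fun s hs => (hf s (hsub hs)).continuousWithinAt.mono hsub)
    (fun s hs => (hd s hs).differentiableAt.differentiableWithinAt)
    (Eventually.of_forall fun s hs => ?_) (intervalIntegrable_of_continuousOn_Ioc hB ht htt' ht')
  rw [(hd s hs).deriv]
  exact hfB s (hsub (Ioo_subset_Icc_self hs))

theorem abs_sub_le_rpow_sub_rpow_of_abs_deriv_le {f f' : ℝ → ℝ} {T B γ : ℝ} (hγ : 0 < γ)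
    (hf : ∀ s ∈ Ioc 0 T, HasDerivWithinAt f (f' s) (Ioc 0 T) s)
    (hfB : ∀ s ∈ Ioc 0 T, |f' s| ≤ B * s ^ (γ - 1)) {t t' : ℝ}
    (ht : 0 < t) (htt' : t ≤ t') (ht' : t' ≤ T) :
    |f t' - f t| ≤ B / γ * t' ^ γ - B / γ * t ^ γ := by
  have h := abs_sub_le_integral_of_hasDerivWithinAt (B := fun s => B * s ^ (γ - 1)) hf
    (continuousOn_const.mul (continuousOn_rpow_Ioc (γ - 1) T)) hfB ht htt' ht'
  rw [intervalIntegral.integral_const_mul, integral_rpow (Or.inl (by linarith)),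
    sub_add_cancel] at h
  exact h.trans_eq (by ring)

theorem exists_tendsto_of_abs_deriv_le_rpow {f f' : ℝ → ℝ} {T B γ : ℝ} (hT : 0 < T) (hγ : 0 < γ)
    (hf : ∀ s ∈ Ioc 0 T, HasDerivWithinAt f (f' s) (Ioc 0 T) s)
    (hfB : ∀ s ∈ Ioc 0 T, |f' s| ≤ B * s ^ (γ - 1)) :
    ∃ L, Tendsto f (𝓝[>] 0) (𝓝 L) ∧ ∀ t ∈ Ioc 0 T, |f t - L| ≤ B / γ * t ^ γ := by
  have key : ∀ {t t'}, 0 < t → t ≤ t' → t' ≤ T → |f t' - f t| ≤ B / γ * t' ^ γ - B / γ * t ^ γ :=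
    abs_sub_le_rpow_sub_rpow_of_abs_deriv_le hγ hf hfB
  have hB : 0 ≤ B := nonneg_of_mul_nonneg_left ((abs_nonneg _).trans (hfB T ⟨hT, le_rfl⟩))
    (Real.rpow_pos_of_pos hT _)
  have hp0 : Tendsto (fun t : ℝ => B / γ * t ^ γ) (𝓝[>] 0) (𝓝 0) := by
    simpa using (tendsto_rpow_nhdsGT_zero hγ).const_mul (B / γ)
  have hmono : MonotoneOn (fun t => f t + B / γ * t ^ γ) (Ioo 0 T) := fun t ht t' ht' htt' => by
    linarith [(abs_le.1 (key ht.1 htt' ht'.2.le)).1]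
  have hbdd : BddBelow ((fun t => f t + B / γ * t ^ γ) '' Ioo 0 T) := by
    refine ⟨f T - B / γ * T ^ γ, ?_⟩
    rintro _ ⟨t, ht, rfl⟩
    have hpt : 0 ≤ B / γ * t ^ γ := mul_nonneg (by positivity) (Real.rpow_nonneg ht.1.le γ)
    linarith [(abs_le.1 (key ht.1 ht.2.le le_rfl)).2]
  have hL := (hmono.tendsto_nhdsWithin_Ioo_right (nonempty_Ioo.2 hT) hbdd).sub hp0
  simp only [add_sub_cancel_right, sub_zero] at hL
  refine ⟨_, hL, fun t ht => ?_⟩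
  have hlim := (tendsto_const_nhds (x := B / γ * t ^ γ)).sub hp0
  rw [sub_zero] at hlim
  refine le_of_tendsto_of_tendsto (tendsto_const_nhds.sub hL).abs hlim ?_
  filter_upwards [Ioc_mem_nhdsGT ht.1] with s hs
  exact key hs.1 hs.2 ht.2

theorem hasDerivAt_integral_left_of_continuousOn {F : ℝ → ℝ} {t T s : ℝ}
    (hF : ContinuousOn F (Icc t T)) (hs : s ∈ Ioo t T) :
    HasDerivAt (fun s => ∫ r in s..T, F r) (-F s) s := by
  have hnhds : Icc t T ∈ 𝓝 s := Icc_mem_nhds hs.1 hs.2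
  have hmeas := hF.stronglyMeasurableAtFilter_nhdsWithin (μ := volume) measurableSet_Icc s
  rw [nhdsWithin_eq_nhds.2 hnhds] at hmeas
  exact intervalIntegral.integral_hasDerivAt_left
    ((hF.mono (Icc_subset_Icc_left hs.1.le)).intervalIntegrable_of_Icc hs.2.le) hmeas
    (hF.continuousAt hnhds)

theorem continuousOn_integral_left {F : ℝ → ℝ} {t T : ℝ} (htT : t ≤ T)
    (hF : ContinuousOn F (Icc t T)) : ContinuousOn (fun s => ∫ r in s..T, F r) (Icc t T) := by
  have h := intervalIntegral.continuousOn_primitive_interval_left (f := F) (a := t) (b := T)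
    (μ := volume) (by rw [uIcc_of_le htT]; exact hF.integrableOn_Icc)
  rwa [uIcc_of_le htT] at h

/-! ### Grönwall's inequality and linear equations -/

theorem le_mul_exp_integral_of_le_add_integral {Z k : ℝ → ℝ} {b t T : ℝ} (htT : t ≤ T)
    (hk : ContinuousOn k (Icc t T)) (hk0 : ∀ s ∈ Icc t T, 0 ≤ k s) (hZ : ContinuousOn Z (Icc t T))
    (h : ∀ s ∈ Icc t T, Z s ≤ b + ∫ r in s..T, k r * Z r) :
    Z t ≤ b * Real.exp (∫ r in t..T, k r) := by
  let R : ℝ → ℝ := fun s => b + ∫ r in s..T, k r * Z r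
  let w : ℝ → ℝ := fun s => Real.exp (-∫ r in s..T, k r)
  have hder : ∀ s ∈ Ioo t T,
      HasDerivAt (fun s => R s * w s) (-(k s * Z s) * w s + R s * (w s * - -k s)) s := fun s hs =>
    ((hasDerivAt_integral_left_of_continuousOn (hk.mul hZ) hs).const_add b).mul
      (hasDerivAt_integral_left_of_continuousOn hk hs).neg.exp
  have hcont : ContinuousOn (fun s => R s * w s) (Icc t T) :=
    (continuousOn_const.add (continuousOn_integral_left htT (hk.mul hZ))).mul
      (continuousOn_integral_left htT hk).neg.rexp
  have hmono : MonotoneOn (fun s => R s * w s) (Icc t T) := by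
    refine monotoneOn_of_deriv_nonneg (convex_Icc t T) hcont ?_ ?_ <;> rw [interior_Icc] <;>
      intro s hs
    · exact (hder s hs).differentiableAt.differentiableWithinAt
    · have hs' := Ioo_subset_Icc_self hs
      rw [(hder s hs).deriv]
      calc 0 ≤ k s * w s * (R s - Z s) :=
            mul_nonneg (mul_nonneg (hk0 s hs') (Real.exp_pos _).le) (sub_nonneg.2 (h s hs'))
        _ = _ := by ring
  have hRb : R t * w t ≤ b := by
    simpa [R, w] using hmono (left_mem_Icc.2 htT) (right_mem_Icc.2 htT) htT
  calc Z t ≤ R t := h t (left_mem_Icc.2 htT)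
    _ = R t * w t * Real.exp (∫ r in t..T, k r) := by
        rw [mul_assoc, ← Real.exp_add, neg_add_cancel, Real.exp_zero, mul_one]
    _ ≤ _ := mul_le_mul_of_nonneg_right hRb (Real.exp_pos _).le

/-- The weight `cosh (∫ k)` for which Picard iteration is a contraction on the whole line. -/
def coshWeight (k : ℝ → ℝ) (τ₀ τ : ℝ) : ℝ := Real.cosh (∫ s in τ₀..τ, k s)

section GlobalODE

variable {E : Type*} [NormedAddCommGroup E] {k : ℝ → ℝ} {τ₀ : ℝ}

theorem coshWeight_pos (k : ℝ → ℝ) (τ₀ τ : ℝ) : 0 < coshWeight k τ₀ τ := Real.cosh_pos _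

theorem one_le_coshWeight (k : ℝ → ℝ) (τ₀ τ : ℝ) : 1 ≤ coshWeight k τ₀ τ := Real.one_le_cosh _

theorem continuous_coshWeight (hk : Continuous k) : Continuous (coshWeight k τ₀) :=
  Real.continuous_cosh.comp
    (intervalIntegral.continuous_primitive (fun _ _ => hk.intervalIntegrable _ _) τ₀)

theorem abs_integral_coshWeight_mul_le (hk : Continuous k) (τ : ℝ) :
    |∫ s in τ₀..τ, coshWeight k τ₀ s * k s| ≤ coshWeight k τ₀ τ := by
  have hder (s) :
      HasDerivAt (fun τ => Real.sinh (∫ r in τ₀..τ, k r)) (coshWeight k τ₀ s * k s) s :=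
    (hk.integral_hasStrictDerivAt τ₀ s).hasDerivAt.sinh
  rw [intervalIntegral.integral_eq_sub_of_hasDerivAt (fun s _ => hder s)
    (((continuous_coshWeight hk).mul hk).intervalIntegrable _ _), intervalIntegral.integral_same,
    Real.sinh_zero, sub_zero, Real.abs_sinh]
  exact (Real.sinh_lt_cosh _).le.trans_eq (Real.cosh_abs _)

variable [NormedSpace ℝ E]

theorem norm_integral_le_mul_coshWeight (hk : Continuous k) {f : ℝ → E} {r : ℝ} (hr : 0 ≤ r)
    (hf : ∀ s, ‖f s‖ ≤ r * (coshWeight k τ₀ s * k s)) (τ : ℝ) :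
    ‖∫ s in τ₀..τ, f s‖ ≤ r * coshWeight k τ₀ τ := by
  have h := intervalIntegral.norm_integral_le_abs_of_norm_le (μ := volume) (a := τ₀)
    (b := τ) (Eventually.of_forall hf)
    ((continuous_const.mul ((continuous_coshWeight hk).mul hk)).intervalIntegrable _ _)
  rw [intervalIntegral.integral_const_mul, abs_mul, abs_of_nonneg hr] at h
  exact h.trans (mul_le_mul_of_nonneg_left (abs_integral_coshWeight_mul_le hk τ) hr)

theorem norm_inv_coshWeight_smul_le {τ r : ℝ} {x : E} (h : ‖x‖ ≤ r * coshWeight k τ₀ τ) :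
    ‖(coshWeight k τ₀ τ)⁻¹ • x‖ ≤ r := by
  have hw := coshWeight_pos k τ₀ τ
  rwa [norm_smul, norm_inv, Real.norm_of_nonneg hw.le, inv_mul_le_iff₀' hw]

variable {F : ℝ → E → E} {L : ℝ → ℝ}

theorem norm_apply_coshWeight_smul_le (hFL : ∀ s x y, ‖F s x - F s y‖ ≤ L s * ‖x - y‖)
    (hkL : ∀ s, L s ≤ k s) (hk0 : ∀ s, ‖F s 0‖ ≤ k s) {s r : ℝ} {x : E} (hx : ‖x‖ ≤ r) :
    ‖F s (coshWeight k τ₀ s • x)‖ ≤ (r + 1) * (coshWeight k τ₀ s * k s) := by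
  have hw := coshWeight_pos k τ₀ s
  have hk : 0 ≤ k s := (norm_nonneg _).trans (hk0 s)
  calc ‖F s (coshWeight k τ₀ s • x)‖
      ≤ ‖F s (coshWeight k τ₀ s • x) - F s 0‖ + ‖F s 0‖ := norm_le_norm_sub_add _ _
    _ ≤ k s * (coshWeight k τ₀ s * r) + coshWeight k τ₀ s * k s := by
        refine add_le_add ((hFL s _ 0).trans ?_)
          ((hk0 s).trans (le_mul_of_one_le_left hk (one_le_coshWeight _ _ _)))
        rw [sub_zero, norm_smul, Real.norm_of_nonneg hw.le]
        gcongr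
        exact hkL s
    _ = _ := by ring

/-- The Picard operator in the unknown `x / coshWeight k τ₀`. -/
def weightedPicard (F : ℝ → E → E) (k : ℝ → ℝ) (τ₀ : ℝ) (v : E) (y : ℝ → E) (τ : ℝ) : E :=
  (coshWeight k τ₀ τ)⁻¹ • (v + ∫ s in τ₀..τ, F s (coshWeight k τ₀ s • y s))

theorem continuous_apply_coshWeight_smul (hF : Continuous (Function.uncurry F)) (hk : Continuous k)
    {y : ℝ → E} (hy : Continuous y) : Continuous fun s => F s (coshWeight k τ₀ s • y s) :=
  hF.comp (continuous_id.prodMk ((continuous_coshWeight hk).smul hy))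

theorem continuous_weightedPicard (hF : Continuous (Function.uncurry F)) (hk : Continuous k) (v : E)
    {y : ℝ → E} (hy : Continuous y) : Continuous (weightedPicard F k τ₀ v y) :=
  ((continuous_coshWeight hk).inv₀ fun τ => (coshWeight_pos k τ₀ τ).ne').smul
    (continuous_const.add (intervalIntegral.continuous_primitive (fun _ _ =>
      (continuous_apply_coshWeight_smul hF hk hy).intervalIntegrable _ _) τ₀))

theorem norm_weightedPicard_le (hFL : ∀ s x y, ‖F s x - F s y‖ ≤ L s * ‖x - y‖) (hk : Continuous k)
    (hkL : ∀ s, L s ≤ k s) (hk0 : ∀ s, ‖F s 0‖ ≤ k s) (v : E) {y : ℝ → E} {r : ℝ}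
    (hy : ∀ s, ‖y s‖ ≤ r) (τ : ℝ) : ‖weightedPicard F k τ₀ v y τ‖ ≤ ‖v‖ + (r + 1) := by
  have hr : 0 ≤ r + 1 := by linarith [(norm_nonneg _).trans (hy τ)]
  refine norm_inv_coshWeight_smul_le ((norm_add_le _ _).trans ?_)
  rw [add_mul]
  exact add_le_add (le_mul_of_one_le_right (norm_nonneg v) (one_le_coshWeight _ _ _))
    (norm_integral_le_mul_coshWeight hk hr
      (fun s => norm_apply_coshWeight_smul_le hFL hkL hk0 (hy s)) τ)

theorem norm_weightedPicard_sub_le (hF : Continuous (Function.uncurry F))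
    (hFL : ∀ s x y, ‖F s x - F s y‖ ≤ L s * ‖x - y‖) (hk : Continuous k) (hkL : ∀ s, 2 * L s ≤ k s)
    (v : E) {y z : ℝ → E} (hy : Continuous y) (hz : Continuous z) {r : ℝ}
    (hyz : ∀ s, ‖y s - z s‖ ≤ r) (hk0 : ∀ s, 0 ≤ k s) (τ : ℝ) :
    ‖weightedPicard F k τ₀ v y τ - weightedPicard F k τ₀ v z τ‖ ≤ 1 / 2 * r := by
  have hr : 0 ≤ r := (norm_nonneg _).trans (hyz τ)
  rw [weightedPicard, weightedPicard, ← smul_sub, add_sub_add_left_eq_sub,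
    ← intervalIntegral.integral_sub
      ((continuous_apply_coshWeight_smul hF hk hy).intervalIntegrable _ _)
      ((continuous_apply_coshWeight_smul hF hk hz).intervalIntegrable _ _)]
  refine norm_inv_coshWeight_smul_le (norm_integral_le_mul_coshWeight hk (by positivity) ?_ τ)
  intro s
  have hw := coshWeight_pos k τ₀ s
  calc _ ≤ L s * ‖coshWeight k τ₀ s • y s - coshWeight k τ₀ s • z s‖ := hFL s _ _
    _ = coshWeight k τ₀ s * L s * ‖y s - z s‖ := by
        rw [← smul_sub, norm_smul, Real.norm_of_nonneg hw.le]
        ring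
    _ ≤ coshWeight k τ₀ s * (k s / 2) * r := by
        gcongr
        · exact mul_nonneg hw.le (by linarith [hk0 s])
        · linarith [hkL s]
        · exact hyz s
    _ = _ := by ring

theorem exists_forall_hasDerivAt_of_lipschitz [CompleteSpace E]
    (hF : Continuous (Function.uncurry F)) (hL : Continuous L)
    (hFL : ∀ s x y, ‖F s x - F s y‖ ≤ L s * ‖x - y‖) (v : E) (τ₀ : ℝ) :
    ∃ x : ℝ → E, x τ₀ = v ∧ ∀ τ, HasDerivAt x (F τ (x τ)) τ := by
  let k : ℝ → ℝ := fun s => 2 * |L s| + ‖F s 0‖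
  have hk : Continuous k :=
    (continuous_const.mul hL.abs).add (hF.comp (continuous_id.prodMk continuous_const)).norm
  have hkL : ∀ s, 2 * L s ≤ k s := fun s => by
    linarith [le_abs_self (L s), norm_nonneg (F s 0), show k s = 2 * |L s| + ‖F s 0‖ from rfl]
  have hk0 : ∀ s, ‖F s 0‖ ≤ k s := fun s => le_add_of_nonneg_left (by positivity)
  have hkL' : ∀ s, L s ≤ k s := fun s => by
    linarith [hkL s, (norm_nonneg _).trans (hk0 s)]
  let Φ : BoundedContinuousFunction ℝ E → BoundedContinuousFunction ℝ E := fun y =>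
    BoundedContinuousFunction.ofNormedAddCommGroup (weightedPicard F k τ₀ v y)
      (continuous_weightedPicard hF hk v y.continuous) _
      (norm_weightedPicard_le hFL hk hkL' hk0 v y.norm_coe_le_norm)
  have hΦ : ContractingWith (1 / 2) Φ := by
    refine ⟨by rw [← NNReal.coe_lt_coe]; norm_num, LipschitzWith.of_dist_le_mul fun y z => ?_⟩
    refine (BoundedContinuousFunction.dist_le (by positivity)).2 fun τ => ?_
    rw [dist_eq_norm]
    exact norm_weightedPicard_sub_le hF hFL hk hkL v y.continuous z.continuous
      (fun s => dist_eq_norm (y s) (z s) ▸ BoundedContinuousFunction.dist_coe_le_dist s)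
      (fun s => (norm_nonneg _).trans (hk0 s)) τ
  let y := hΦ.fixedPoint Φ
  have hy : ∀ τ, coshWeight k τ₀ τ • y τ = v + ∫ s in τ₀..τ, F s (coshWeight k τ₀ s • y s) := by
    intro τ
    have hfix : weightedPicard F k τ₀ v y τ = y τ :=
      DFunLike.congr_fun hΦ.fixedPoint_isFixedPt τ
    rw [← hfix, weightedPicard, smul_inv_smul₀ (coshWeight_pos k τ₀ τ).ne']
  refine ⟨fun τ => coshWeight k τ₀ τ • y τ, by simpa using hy τ₀, fun τ => ?_⟩
  exact (((continuous_apply_coshWeight_smul hF hk y.continuous).integral_hasStrictDerivAt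
    τ₀ τ).hasDerivAt.const_add v).congr_of_eventuallyEq (Eventually.of_forall hy)

end GlobalODE

/-! ### Linear systems with a regular singular point -/

variable {n : ℕ}

/-- The coefficients of `t x' = -C(t) x + h(t)` on `(0,T]` degenerate at `t = 0` to a matrix and a
vector that vanish outside their last row, with diagonal entry `c`: this is the shape taken by the
averaged equation at the Cauchy horizon. All the bounds share the constant `K`. -/
structure RegularSingular (C : ℝ → Matrix (Fin (n + 1)) (Fin (n + 1)) ℝ)
    (h : ℝ → Fin (n + 1) → ℝ) (c T K : ℝ) : Prop where
  T_pos : 0 < T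
  K_nonneg : 0 ≤ K
  one_lt : 1 < c
  continuousOn_C : ∀ i j, ContinuousOn (fun t => C t i j) (Ioc 0 T)
  continuousOn_h : ∀ i, ContinuousOn (fun t => h t i) (Ioc 0 T)
  C_castSucc : ∀ (i : Fin n) (j : Fin (n + 1)), ∀ t ∈ Ioc 0 T, |C t i.castSucc j| ≤ K * t
  C_last : ∀ j : Fin n, ∀ t ∈ Ioc 0 T, |C t (Fin.last n) j.castSucc| ≤ K
  C_diag : ∀ t ∈ Ioc 0 T, |c - C t (Fin.last n) (Fin.last n)| ≤ K * t
  h_castSucc : ∀ i : Fin n, ∀ t ∈ Ioc 0 T, |h t i.castSucc| ≤ K * t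
  h_last : ∀ t ∈ Ioc 0 T, |h t (Fin.last n)| ≤ K
  C_tendsto : ∀ j : Fin n, ∃ L, Tendsto (fun t => C t (Fin.last n) j.castSucc) (𝓝[>] 0) (𝓝 L)
  h_tendsto : ∃ L, Tendsto (fun t => h t (Fin.last n)) (𝓝[>] 0) (𝓝 L)

/-- The functions `y j` satisfy the `i`-th equation of `t y' = -C(t) y + F` on `(0,T]`. Single rows
are needed because the components of the transport equation have different characteristics. -/
def SolvesRow (C : ℝ → Matrix (Fin (n + 1)) (Fin (n + 1)) ℝ) (T : ℝ) (i : Fin (n + 1))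
    (y : Fin (n + 1) → ℝ → ℝ) (F : ℝ → ℝ) : Prop :=
  ∀ t ∈ Ioc 0 T, HasDerivWithinAt (y i) (t⁻¹ * (-(∑ j, C t i j * y j t) + F t)) (Ioc 0 T) t

/-- `t ^ (c - 1)` times this is the derivative of `t ^ c * y (Fin.last n) t`, for a solution of the
last row with forcing `F`. -/
def lastForce (C : ℝ → Matrix (Fin (n + 1)) (Fin (n + 1)) ℝ) (c : ℝ) (y : Fin (n + 1) → ℝ → ℝ)
    (F : ℝ → ℝ) (t : ℝ) : ℝ :=
  (c - C t (Fin.last n) (Fin.last n)) * y (Fin.last n) t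
    - ∑ j : Fin n, C t (Fin.last n) j.castSucc * y j.castSucc t + F t

/-- Bound for the derivative of the components `i.castSucc` of a solution with forcing at most
`E`, in terms of bounds `U` for its components. -/
def castSuccRate (K : ℝ) (U : Fin (n + 1) → ℝ → ℝ) (E : ℝ → ℝ) (s : ℝ) : ℝ :=
  K * ∑ j, U j s + s⁻¹ * E s

/-- Bound for the derivative of `t ^ c` times the last component of a solution with forcing at most
`E`, in terms of bounds `U` for its components. -/
def lastRate (c K : ℝ) (U : Fin (n + 1) → ℝ → ℝ) (E : ℝ → ℝ) (s : ℝ) : ℝ :=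
  s ^ (c - 1) * (K * (∑ j : Fin n, U j.castSucc s + s * U (Fin.last n) s) + E s)

/-- The integral inequalities on `(0,T]` that a regular singular system with forcing at most `E`
imposes on bounds `U` for the components of its solutions. -/
structure IsMajorant (c T K : ℝ) (U : Fin (n + 1) → ℝ → ℝ) (E : ℝ → ℝ) : Prop where
  continuousOn : ∀ j, ContinuousOn (U j) (Ioc 0 T)
  continuousOn_force : ContinuousOn E (Ioc 0 T)
  nonneg : ∀ j, ∀ t ∈ Ioc 0 T, 0 ≤ U j t
  force_nonneg : ∀ t ∈ Ioc 0 T, 0 ≤ E t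
  castSucc_le : ∀ i : Fin n, ∀ t ∈ Ioc 0 T,
    U i.castSucc t ≤ U i.castSucc T + ∫ s in t..T, castSuccRate K U E s
  last_le : ∀ t ∈ Ioc 0 T, t ^ c * U (Fin.last n) t
    ≤ T ^ c * U (Fin.last n) T + ∫ s in t..T, lastRate c K U E s

section Majorants

variable {C : ℝ → Matrix (Fin (n + 1)) (Fin (n + 1)) ℝ} {h : ℝ → Fin (n + 1) → ℝ} {c T K : ℝ}
  {U y : Fin (n + 1) → ℝ → ℝ} {E F : ℝ → ℝ}

theorem continuousOn_castSuccRate (K : ℝ) (hU : ∀ j, ContinuousOn (U j) (Ioc 0 T))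
    (hE : ContinuousOn E (Ioc 0 T)) : ContinuousOn (castSuccRate K U E) (Ioc 0 T) :=
  (continuousOn_const.mul (continuousOn_finsetSum _ fun j _ => hU j)).add
    ((continuousOn_inv_Ioc T).mul hE)

theorem continuousOn_lastRate (c K : ℝ) (hU : ∀ j, ContinuousOn (U j) (Ioc 0 T))
    (hE : ContinuousOn E (Ioc 0 T)) : ContinuousOn (lastRate c K U E) (Ioc 0 T) :=
  (continuousOn_rpow_Ioc _ T).mul ((continuousOn_const.mul
    ((continuousOn_finsetSum _ fun _ _ => hU _).add (continuousOn_id.mul (hU _)))).add hE)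

namespace RegularSingular

theorem abs_sum_castSucc_le (H : RegularSingular C h c T K) (i : Fin n) {x : Fin (n + 1) → ℝ}
    {B : Fin (n + 1) → ℝ} {t : ℝ} (ht : t ∈ Ioc 0 T) (hx : ∀ j, |x j| ≤ B j) :
    |∑ j, C t i.castSucc j * x j| ≤ t * (K * ∑ j, B j) := by
  calc |∑ j, C t i.castSucc j * x j| ≤ ∑ j, K * t * B j := by
        refine (Finset.abs_sum_le_sum_abs _ _).trans (Finset.sum_le_sum fun j _ => ?_)
        rw [abs_mul]
        exact mul_le_mul (H.C_castSucc i j t ht) (hx j) (abs_nonneg _)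
          (mul_nonneg H.K_nonneg ht.1.le)
    _ = _ := by
        rw [← Finset.mul_sum]
        ring

theorem abs_deriv_castSucc_le (H : RegularSingular C h c T K) (i : Fin n) {t : ℝ}
    (ht : t ∈ Ioc 0 T) (hy : ∀ j, |y j t| ≤ U j t) (hF : |F t| ≤ E t) :
    |t⁻¹ * (-(∑ j, C t i.castSucc j * y j t) + F t)| ≤ castSuccRate K U E t := by
  rw [abs_mul, abs_of_pos (inv_pos.2 ht.1), inv_mul_le_iff₀ ht.1]
  calc |-(∑ j, C t i.castSucc j * y j t) + F t|
      ≤ t * (K * ∑ j, U j t) + E t := by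
        refine (abs_add_le _ _).trans (add_le_add ?_ hF)
        rw [abs_neg]
        exact H.abs_sum_castSucc_le i ht hy
    _ = t * castSuccRate K U E t := by
        rw [castSuccRate, mul_add, mul_inv_cancel_left₀ ht.1.ne']

theorem abs_rpow_mul_lastForce_le (H : RegularSingular C h c T K) {t : ℝ} (ht : t ∈ Ioc 0 T)
    (hy : ∀ j, |y j t| ≤ U j t) (hF : |F t| ≤ E t) :
    |t ^ (c - 1) * lastForce C c y F t| ≤ lastRate c K U E t := by
  have hp := Real.rpow_nonneg ht.1.le (c - 1)
  have hdiag : |(c - C t (Fin.last n) (Fin.last n)) * y (Fin.last n) t|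
      ≤ K * t * U (Fin.last n) t := by
    rw [abs_mul]
    exact mul_le_mul (H.C_diag t ht) (hy _) (abs_nonneg _) (mul_nonneg H.K_nonneg ht.1.le)
  have hsum : |∑ j : Fin n, C t (Fin.last n) j.castSucc * y j.castSucc t|
      ≤ K * ∑ j : Fin n, U j.castSucc t := by
    rw [Finset.mul_sum]
    refine (Finset.abs_sum_le_sum_abs _ _).trans (Finset.sum_le_sum fun j _ => ?_)
    rw [abs_mul]
    exact mul_le_mul (H.C_last j t ht) (hy _) (abs_nonneg _) H.K_nonneg
  rw [abs_mul, abs_of_nonneg hp]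
  refine mul_le_mul_of_nonneg_left ((abs_add_le _ _).trans ?_) hp
  linarith [abs_sub ((c - C t (Fin.last n) (Fin.last n)) * y (Fin.last n) t)
    (∑ j : Fin n, C t (Fin.last n) j.castSucc * y j.castSucc t)]

end RegularSingular

namespace SolvesRow

theorem continuousOn {i : Fin (n + 1)} (hy : SolvesRow C T i y F) :
    ContinuousOn (y i) (Ioc 0 T) := fun t ht => (hy t ht).continuousWithinAt

theorem hasDerivWithinAt_rpow_mul (hy : SolvesRow C T (Fin.last n) y F) (c : ℝ) {t : ℝ}
    (ht : t ∈ Ioc 0 T) :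
    HasDerivWithinAt (fun s => s ^ c * y (Fin.last n) s) (t ^ (c - 1) * lastForce C c y F t)
      (Ioc 0 T) t := by
  have hpow := (Real.hasDerivAt_rpow_const (p := c) (Or.inl ht.1.ne')).hasDerivWithinAt
    (s := Ioc 0 T)
  refine (hpow.mul (hy t ht)).congr_deriv ?_
  have := ht.1.ne'
  rw [lastForce, Fin.sum_univ_castSucc, Real.rpow_sub_one ht.1.ne']
  field_simp
  ring

variable (H : RegularSingular C h c T K) (hU : ∀ j, ContinuousOn (U j) (Ioc 0 T))
  (hE : ContinuousOn E (Ioc 0 T)) (hyU : ∀ j, ∀ t ∈ Ioc 0 T, |y j t| ≤ U j t)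
  (hFE : ∀ t ∈ Ioc 0 T, |F t| ≤ E t)

include H hU hE hyU hFE

theorem abs_castSucc_le {i : Fin n} (hy : SolvesRow C T i.castSucc y F) {t : ℝ}
    (ht : t ∈ Ioc 0 T) :
    |y i.castSucc t| ≤ |y i.castSucc T| + ∫ s in t..T, castSuccRate K U E s := by
  have hsub := abs_sub_le_integral_of_hasDerivWithinAt hy (continuousOn_castSuccRate K hU hE)
    (fun s hs => H.abs_deriv_castSucc_le i hs (fun j => hyU j s hs) (hFE s hs)) ht.1 ht.2 le_rfl
  rw [abs_sub_comm] at hsub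
  linarith [abs_sub_abs_le_abs_sub (y i.castSucc t) (y i.castSucc T)]

theorem rpow_mul_abs_last_le (hy : SolvesRow C T (Fin.last n) y F) {t : ℝ} (ht : t ∈ Ioc 0 T) :
    t ^ c * |y (Fin.last n) t|
      ≤ T ^ c * |y (Fin.last n) T| + ∫ s in t..T, lastRate c K U E s := by
  have hsub := abs_sub_le_integral_of_hasDerivWithinAt
    (fun s hs => hy.hasDerivWithinAt_rpow_mul c hs) (continuousOn_lastRate c K hU hE)
    (fun s hs => H.abs_rpow_mul_lastForce_le hs (fun j => hyU j s hs) (hFE s hs)) ht.1 ht.2 le_rfl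
  have habs := abs_sub_abs_le_abs_sub (t ^ c * y (Fin.last n) t) (T ^ c * y (Fin.last n) T)
  rw [abs_sub_comm, abs_mul, abs_mul, abs_of_nonneg (Real.rpow_nonneg ht.1.le c),
    abs_of_nonneg (Real.rpow_nonneg H.T_pos.le c)] at habs
  linarith

end SolvesRow

theorem RegularSingular.isMajorant_abs (H : RegularSingular C h c T K) {F : Fin (n + 1) → ℝ → ℝ}
    (hy : ∀ i, SolvesRow C T i y (F i)) (hE : ContinuousOn E (Ioc 0 T))
    (hFE : ∀ i, ∀ t ∈ Ioc 0 T, |F i t| ≤ E t) : IsMajorant c T K (fun j s => |y j s|) E where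
  continuousOn j := (hy j).continuousOn.abs
  continuousOn_force := hE
  nonneg _ _ _ := abs_nonneg _
  force_nonneg t ht := (abs_nonneg _).trans (hFE 0 t ht)
  castSucc_le i _ ht := (hy i.castSucc).abs_castSucc_le H (fun j => (hy j).continuousOn.abs) hE
    (fun _ _ _ => le_rfl) (hFE _) ht
  last_le _ ht := (hy (Fin.last n)).rpow_mul_abs_last_le H (fun j => (hy j).continuousOn.abs) hE
    (fun _ _ _ => le_rfl) (hFE _) ht

/-- The weighted size of a solution: the last component may grow like `t ^ (-c)`, the others gain a
factor `√t`. The gain makes the coupling of the last component to the others integrable. -/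
def weightedSize (c : ℝ) (U : Fin (n + 1) → ℝ → ℝ) (t : ℝ) : ℝ :=
  t ^ c * U (Fin.last n) t + t ^ (c - 1 / 2) * ∑ j : Fin n, U j.castSucc t

/-- The factor lost in comparing the rates of a majorant with its weighted size. -/
def rateFactor (n : ℕ) (T : ℝ) : ℝ := (n + 1) * (1 + √T)

/-- The Grönwall factor of the weighted size on `(0,T]`. -/
def growthFactor (n : ℕ) (T K : ℝ) : ℝ := Real.exp (2 * (K * rateFactor n T) * √T)

theorem rateFactor_pos (n : ℕ) (T : ℝ) : 0 < rateFactor n T := by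
  unfold rateFactor
  positivity

theorem growthFactor_pos (n : ℕ) (T K : ℝ) : 0 < growthFactor n T K := Real.exp_pos _

theorem weightedSize_nonneg {t : ℝ} (ht : 0 < t) (hU : ∀ j, 0 ≤ U j t) :
    0 ≤ weightedSize c U t :=
  add_nonneg (mul_nonneg (Real.rpow_nonneg ht.le _) (hU _))
    (mul_nonneg (Real.rpow_nonneg ht.le _) (Finset.sum_nonneg fun _ _ => hU _))

theorem continuousOn_weightedSize (c : ℝ) (hU : ∀ j, ContinuousOn (U j) (Ioc 0 T)) :
    ContinuousOn (weightedSize c U) (Ioc 0 T) :=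
  ((continuousOn_rpow_Ioc c T).mul (hU _)).add
    ((continuousOn_rpow_Ioc _ T).mul (continuousOn_finsetSum _ fun _ _ => hU _))

theorem rpow_sub_half {r : ℝ} (hr : 0 < r) (c : ℝ) : r ^ (c - 1 / 2) = r ^ c / √r := by
  rw [Real.rpow_sub hr, Real.sqrt_eq_rpow]

theorem lastRate_add_castSuccRate_le {s : ℝ} (hK : 0 ≤ K) (hs : s ∈ Ioc 0 T) (hU : ∀ j, 0 ≤ U j s)
    (hE : 0 ≤ E s) :
    lastRate c K U E s + s ^ (c - 1 / 2) * (n * castSuccRate K U E s)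
      ≤ K * rateFactor n T / √s * weightedSize c U s
        + rateFactor n T * (s ^ (c - 3 / 2) * E s) := by
  have hs0 := hs.1
  set w := √s with hw
  have hw0 : 0 < w := Real.sqrt_pos.2 hs0
  have hwT : 0 ≤ √T - w := sub_nonneg.2 (Real.sqrt_le_sqrt hs.2)
  have hsw : s = w ^ 2 := (Real.sq_sqrt hs0.le).symm
  have hhalf : s ^ (c - 1 / 2) = s ^ c / w := rpow_sub_half hs0 c
  have hone : s ^ (c - 1) = s ^ c / w ^ 2 := by rw [Real.rpow_sub_one hs0.ne', ← hsw]
  have hthree : s ^ (c - 3 / 2) = s ^ c / w ^ 3 := by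
    rw [show c - 3 / 2 = (c - 1) - 1 / 2 by ring, rpow_sub_half hs0, hone, ← hw]
    field_simp
  have hN : 0 ≤ ∑ j : Fin n, U j.castSucc s := Finset.sum_nonneg fun _ _ => hU _
  have hM := hU (Fin.last n)
  have hp : 0 ≤ s ^ c := Real.rpow_nonneg hs0.le _
  rw [weightedSize, lastRate, castSuccRate, rateFactor, Fin.sum_univ_castSucc, hhalf, hone, hthree]
  set N := ∑ j : Fin n, U j.castSucc s
  set M := U (Fin.last n) s
  set P := s ^ c
  set e := E s
  rw [← sub_nonneg]
  have hid : K * ((n + 1) * (1 + √T)) / w * (P * M + P / w * N)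
        + (n + 1) * (1 + √T) * (P / w ^ 3 * e)
        - (P / w ^ 2 * (K * (N + s * M) + e) + P / w * (n * (K * (N + M) + s⁻¹ * e)))
      = P * (K * N / w ^ 2 * ((n + 1) * (√T - w) + n + w)
        + K * M / w * ((n + 1) * (√T - w) + 1 + n * w)
        + e / w ^ 3 * ((n + 1) * (√T - w) + 1 + n * w)) := by
    rw [hsw]
    field_simp
    ring
  rw [hid]
  positivity

end Majorants

theorem integral_const_div_sqrt_le {b t T : ℝ} (hb : 0 ≤ b) (ht : t ∈ Ioc 0 T) :
    ∫ s in t..T, b / √s ≤ 2 * b * √T := by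
  have heq : EqOn (fun s => b / √s) (fun s => b * s ^ (-(1 / 2) : ℝ)) (uIcc t T) := by
    intro s hs
    rw [uIcc_of_le ht.2] at hs
    simp only [Real.rpow_neg (ht.1.le.trans hs.1), Real.sqrt_eq_rpow, div_eq_mul_inv]
  rw [intervalIntegral.integral_congr heq, intervalIntegral.integral_const_mul,
    integral_rpow (Or.inl (by norm_num)), show (-(1 / 2) + 1 : ℝ) = 1 / 2 by norm_num,
    ← Real.sqrt_eq_rpow, ← Real.sqrt_eq_rpow]
  nlinarith [mul_nonneg hb (Real.sqrt_nonneg t)]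

theorem integral_rpow_mul_const_le {c e t T : ℝ} (hc : 1 / 2 < c) (he : 0 ≤ e)
    (ht : t ∈ Ioc 0 T) :
    ∫ s in t..T, s ^ (c - 3 / 2) * e ≤ T ^ (c - 1 / 2) / (c - 1 / 2) * e := by
  rw [intervalIntegral.integral_mul_const, integral_rpow (Or.inl (by linarith)),
    show c - 3 / 2 + 1 = c - 1 / 2 by ring]
  refine mul_le_mul_of_nonneg_right (div_le_div_of_nonneg_right
    (sub_le_self _ (Real.rpow_nonneg ht.1.le _)) ?_) he
  linarith

namespace IsMajorant

variable {U : Fin (n + 1) → ℝ → ℝ} {E : ℝ → ℝ} {c T K : ℝ}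

theorem castSuccRate_nonneg (H : IsMajorant c T K U E) (hK : 0 ≤ K) {s : ℝ} (hs : s ∈ Ioc 0 T) :
    0 ≤ castSuccRate K U E s :=
  add_nonneg (mul_nonneg hK (Finset.sum_nonneg fun j _ => H.nonneg j s hs))
    (mul_nonneg (inv_nonneg.2 hs.1.le) (H.force_nonneg s hs))

theorem rpow_mul_sum_castSucc_le (H : IsMajorant c T K U E) (hK : 0 ≤ K) (hc : 1 / 2 ≤ c) {t : ℝ}
    (ht : t ∈ Ioc 0 T) :
    t ^ (c - 1 / 2) * ∑ j : Fin n, U j.castSucc t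
      ≤ T ^ (c - 1 / 2) * ∑ j : Fin n, U j.castSucc T
        + ∫ s in t..T, s ^ (c - 1 / 2) * (n * castSuccRate K U E s) := by
  have hγ : 0 ≤ c - 1 / 2 := sub_nonneg.2 hc
  have hT : T ∈ Ioc 0 T := ⟨ht.1.trans_le ht.2, le_rfl⟩
  have hrate : ContinuousOn (fun s => n * castSuccRate K U E s) (Ioc 0 T) :=
    continuousOn_const.mul (continuousOn_castSuccRate K H.continuousOn H.continuousOn_force)
  have hsum : ∑ j : Fin n, U j.castSucc t
      ≤ ∑ j : Fin n, U j.castSucc T + ∫ s in t..T, n * castSuccRate K U E s := by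
    refine (Finset.sum_le_sum fun j _ => H.castSucc_le j t ht).trans_eq ?_
    rw [Finset.sum_add_distrib, Finset.sum_const, Finset.card_fin, nsmul_eq_mul,
      intervalIntegral.integral_const_mul]
  calc _ ≤ t ^ (c - 1 / 2) * (∑ j : Fin n, U j.castSucc T
        + ∫ s in t..T, n * castSuccRate K U E s) :=
        mul_le_mul_of_nonneg_left hsum (Real.rpow_nonneg ht.1.le _)
    _ ≤ _ := by
        rw [mul_add, ← intervalIntegral.integral_const_mul]
        gcongr
        · exact Finset.sum_nonneg fun j _ => H.nonneg _ T hT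
        · exact ht.1.le
        · exact ht.2
        · refine intervalIntegral.integral_mono_on ht.2
            (intervalIntegrable_of_continuousOn_Ioc (continuousOn_const.mul hrate) ht.1 ht.2 le_rfl)
            (intervalIntegrable_of_continuousOn_Ioc ((continuousOn_rpow_Ioc _ T).mul hrate)
              ht.1 ht.2 le_rfl) fun s hs => ?_
          exact mul_le_mul_of_nonneg_right (Real.rpow_le_rpow ht.1.le hs.1 hγ)
            (mul_nonneg n.cast_nonneg
              (H.castSuccRate_nonneg hK ⟨ht.1.trans_le hs.1, hs.2⟩))

theorem weightedSize_le_add_integral (H : IsMajorant c T K U E) (hK : 0 ≤ K) (hc : 1 / 2 ≤ c)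
    {t : ℝ} (ht : t ∈ Ioc 0 T) :
    weightedSize c U t ≤ weightedSize c U T
      + ∫ s in t..T, (K * rateFactor n T / √s * weightedSize c U s
        + rateFactor n T * (s ^ (c - 3 / 2) * E s)) := by
  have hlast := continuousOn_lastRate c K H.continuousOn H.continuousOn_force
  have hcast : ContinuousOn (fun s => s ^ (c - 1 / 2) * (n * castSuccRate K U E s)) (Ioc 0 T) :=
    (continuousOn_rpow_Ioc _ T).mul (continuousOn_const.mul
      (continuousOn_castSuccRate K H.continuousOn H.continuousOn_force))
  have hcont : ContinuousOn (fun s => K * rateFactor n T / √s * weightedSize c U s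
      + rateFactor n T * (s ^ (c - 3 / 2) * E s)) (Ioc 0 T) :=
    ((continuousOn_const.div Real.continuous_sqrt.continuousOn fun s hs =>
      (Real.sqrt_pos.2 hs.1).ne').mul (continuousOn_weightedSize c H.continuousOn)).add
      (continuousOn_const.mul ((continuousOn_rpow_Ioc _ T).mul H.continuousOn_force))
  have hint {f : ℝ → ℝ} (hf : ContinuousOn f (Ioc 0 T)) : IntervalIntegrable f volume t T :=
    intervalIntegrable_of_continuousOn_Ioc hf ht.1 ht.2 le_rfl
  have hrates : (∫ s in t..T, lastRate c K U E s)
      + ∫ s in t..T, s ^ (c - 1 / 2) * (n * castSuccRate K U E s)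
      ≤ ∫ s in t..T, (K * rateFactor n T / √s * weightedSize c U s
        + rateFactor n T * (s ^ (c - 3 / 2) * E s)) := by
    rw [← intervalIntegral.integral_add (hint hlast) (hint hcast)]
    refine intervalIntegral.integral_mono_on ht.2 (hint (hlast.add hcast)) (hint hcont)
      fun s hs => ?_
    have hs' : s ∈ Ioc 0 T := ⟨ht.1.trans_le hs.1, hs.2⟩
    exact lastRate_add_castSuccRate_le hK hs' (fun j => H.nonneg j s hs') (H.force_nonneg s hs')
  unfold weightedSize at hrates ⊢
  linarith [H.last_le t ht, H.rpow_mul_sum_castSucc_le hK hc ht]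

theorem weightedSize_le (H : IsMajorant c T K U E) (hK : 0 ≤ K) (hc : 1 / 2 ≤ c) {t : ℝ}
    (ht : t ∈ Ioc 0 T) :
    weightedSize c U t ≤ (weightedSize c U T
      + rateFactor n T * ∫ s in t..T, s ^ (c - 3 / 2) * E s) * growthFactor n T K := by
  have hΛ := (rateFactor_pos n T).le
  have hsub : Icc t T ⊆ Ioc 0 T := fun s hs => ⟨ht.1.trans_le hs.1, hs.2⟩
  have hker : ContinuousOn (fun s => K * rateFactor n T / √s) (Ioc 0 T) :=
    continuousOn_const.div Real.continuous_sqrt.continuousOn fun s hs =>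
      (Real.sqrt_pos.2 hs.1).ne'
  have hZ := continuousOn_weightedSize c H.continuousOn
  have hkerZ : ContinuousOn (fun s => K * rateFactor n T / √s * weightedSize c U s) (Ioc 0 T) :=
    hker.mul hZ
  have hforce : ContinuousOn (fun s => s ^ (c - 3 / 2) * E s) (Ioc 0 T) :=
    (continuousOn_rpow_Ioc _ T).mul H.continuousOn_force
  have hΛforce : ContinuousOn (fun s => rateFactor n T * (s ^ (c - 3 / 2) * E s)) (Ioc 0 T) :=
    continuousOn_const.mul hforce
  have hint {f : ℝ → ℝ} {s : ℝ} (hf : ContinuousOn f (Ioc 0 T)) (hs : s ∈ Ioc 0 T) :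
      IntervalIntegrable f volume s T := intervalIntegrable_of_continuousOn_Ioc hf hs.1 hs.2 le_rfl
  have hforce0 : ∀ s ∈ Ioc 0 T, 0 ≤ s ^ (c - 3 / 2) * E s := fun s hs =>
    mul_nonneg (Real.rpow_nonneg hs.1.le _) (H.force_nonneg s hs)
  have hT : T ∈ Ioc 0 T := ⟨ht.1.trans_le ht.2, le_rfl⟩
  have hgronwall := le_mul_exp_integral_of_le_add_integral
    (b := weightedSize c U T + rateFactor n T * ∫ s in t..T, s ^ (c - 3 / 2) * E s) ht.2
    (hker.mono hsub) (fun s _ => by positivity) (hZ.mono hsub) fun s hs => by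
      have hmono : ∫ r in s..T, r ^ (c - 3 / 2) * E r ≤ ∫ r in t..T, r ^ (c - 3 / 2) * E r :=
        intervalIntegral.integral_mono_interval hs.1 hs.2 le_rfl
          ((ae_restrict_iff' measurableSet_Ioc).2 (Eventually.of_forall fun r hr =>
            hforce0 r ⟨ht.1.trans hr.1, hr.2⟩)) (hint hforce ht)
      have h := H.weightedSize_le_add_integral hK hc (hsub hs)
      rw [intervalIntegral.integral_add (hint hkerZ (hsub hs)) (hint hΛforce (hsub hs)),
        intervalIntegral.integral_const_mul] at h
      linarith [mul_le_mul_of_nonneg_left hmono hΛ]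
  refine hgronwall.trans (mul_le_mul_of_nonneg_left
    (Real.exp_le_exp.2 (integral_const_div_sqrt_le (mul_nonneg hK hΛ) ht)) (add_nonneg ?_ ?_))
  · exact weightedSize_nonneg hT.1 fun j => H.nonneg j T hT
  · exact mul_nonneg hΛ (intervalIntegral.integral_nonneg ht.2 fun s hs => hforce0 s (hsub hs))

theorem weightedSize_le_of_const {e : ℝ} (H : IsMajorant c T K U fun _ => e) (hK : 0 ≤ K)
    (hc : 1 / 2 < c) {t : ℝ} (ht : t ∈ Ioc 0 T) :
    weightedSize c U t ≤ (weightedSize c U T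
      + rateFactor n T * (T ^ (c - 1 / 2) / (c - 1 / 2) * e)) * growthFactor n T K := by
  refine (H.weightedSize_le hK hc.le ht).trans ?_
  have hint := integral_rpow_mul_const_le hc (H.force_nonneg t ht) ht
  have hΛ := rateFactor_pos n T
  have hgrowth := growthFactor_pos n T K
  gcongr

end IsMajorant

theorem rpow_mul_castSucc_le_sqrt_mul_weightedSize {U : Fin (n + 1) → ℝ → ℝ} {t : ℝ} (c : ℝ)
    (ht : 0 < t) (hU : ∀ j, 0 ≤ U j t) (i : Fin n) :
    t ^ c * U i.castSucc t ≤ √t * weightedSize c U t := by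
  have hw := Real.sqrt_pos.2 ht
  have hp := Real.rpow_pos_of_pos ht c
  have hle : U i.castSucc t ≤ ∑ j : Fin n, U j.castSucc t :=
    Finset.single_le_sum (f := fun j : Fin n => U j.castSucc t) (fun _ _ => hU _)
      (Finset.mem_univ i)
  calc t ^ c * U i.castSucc t ≤ t ^ c * ∑ j : Fin n, U j.castSucc t := by gcongr
    _ = √t * (t ^ (c - 1 / 2) * ∑ j : Fin n, U j.castSucc t) := by
        rw [rpow_sub_half ht]
        field_simp
    _ ≤ _ := by
        refine mul_le_mul_of_nonneg_left (le_add_of_nonneg_left ?_) hw.le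
        exact mul_nonneg hp.le (hU _)

theorem rpow_mul_le_weightedSize {U : Fin (n + 1) → ℝ → ℝ} {T t : ℝ} (c : ℝ) (ht : t ∈ Ioc 0 T)
    (hU : ∀ j, 0 ≤ U j t) (i : Fin (n + 1)) :
    t ^ c * U i t ≤ (1 + √T) * weightedSize c U t := by
  have hW := weightedSize_nonneg (c := c) ht.1 hU
  induction i using Fin.lastCases with
  | last =>
    have hsum : 0 ≤ t ^ (c - 1 / 2) * ∑ j : Fin n, U j.castSucc t :=
      mul_nonneg (Real.rpow_nonneg ht.1.le _) (Finset.sum_nonneg fun _ _ => hU _)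
    refine (le_add_of_nonneg_right hsum).trans (le_mul_of_one_le_left hW ?_)
    linarith [Real.sqrt_nonneg T]
  | cast i =>
    refine (rpow_mul_castSucc_le_sqrt_mul_weightedSize c ht.1 hU i).trans
      (mul_le_mul_of_nonneg_right ?_ hW)
    linarith [Real.sqrt_le_sqrt ht.2]

/-! ### Behaviour of the solutions at the singular point -/

theorem isBigO_rpow_rpow (T : ℝ) {p r : ℝ} (hpr : r ≤ p) :
    (fun s : ℝ => s ^ p) =O[𝓟 (Ioc 0 T)] fun s => s ^ r := by
  refine Asymptotics.isBigO_principal.2 ⟨T ^ (p - r), fun s hs => ?_⟩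
  rw [Real.norm_of_nonneg (Real.rpow_nonneg hs.1.le _),
    Real.norm_of_nonneg (Real.rpow_nonneg hs.1.le _)]
  calc s ^ p = s ^ (p - r) * s ^ r := by rw [← Real.rpow_add hs.1, sub_add_cancel]
    _ ≤ _ := mul_le_mul_of_nonneg_right (Real.rpow_le_rpow hs.1.le hs.2 (sub_nonneg.2 hpr))
      (Real.rpow_nonneg hs.1.le _)

theorem isBigO_one_rpow (T : ℝ) {r : ℝ} (hr : r ≤ 0) :
    (fun _ : ℝ => (1 : ℝ)) =O[𝓟 (Ioc 0 T)] fun s => s ^ r := by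
  simpa only [Real.rpow_zero] using isBigO_rpow_rpow T hr

theorem isBigO_rpow_mul (p : ℝ) {T r : ℝ} {f : ℝ → ℝ}
    (hf : f =O[𝓟 (Ioc 0 T)] fun s => s ^ r) :
    (fun s => s ^ p * f s) =O[𝓟 (Ioc 0 T)] fun s => s ^ (p + r) := by
  refine ((Asymptotics.isBigO_refl (fun s : ℝ => s ^ p) _).mul hf).congr' .rfl ?_
  filter_upwards [mem_principal_self _] with s hs
  rw [Real.rpow_add hs.1]

theorem isBigO_of_isBigO_deriv {f f' : ℝ → ℝ} {T α : ℝ} (hα : 0 ≤ α)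
    (hf : ∀ s ∈ Ioc 0 T, HasDerivWithinAt f (f' s) (Ioc 0 T) s)
    (hf' : f' =O[𝓟 (Ioc 0 T)] fun s => s ^ (-α - 1 / 2)) :
    f =O[𝓟 (Ioc 0 T)] fun s => s ^ (-α) := by
  obtain ⟨D, hD, hfD⟩ := hf'.exists_nonneg
  have hfD : ∀ s ∈ Ioc 0 T, |f' s| ≤ D * s ^ (-α - 1 / 2) := fun s hs => by
    simpa only [Real.norm_eq_abs, abs_of_pos (Real.rpow_pos_of_pos hs.1 _)] using
      Asymptotics.isBigOWith_principal.1 hfD s hs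
  have hcont (γ b : ℝ) : ContinuousOn (fun s : ℝ => b * s ^ γ) (Ioc 0 T) :=
    continuousOn_const.mul (continuousOn_rpow_Ioc _ T)
  have hsub : (fun t => f t - f T) =O[𝓟 (Ioc 0 T)] fun s => s ^ (-α) := by
    refine Asymptotics.isBigO_principal.2 ⟨2 * D * √T, fun t ht => ?_⟩
    have hp := Real.rpow_pos_of_pos ht.1 (-α)
    rw [Real.norm_eq_abs, abs_sub_comm, Real.norm_of_nonneg hp.le]
    calc |f T - f t| ≤ ∫ s in t..T, D * s ^ (-α - 1 / 2) :=
          abs_sub_le_integral_of_hasDerivWithinAt hf (hcont _ D) hfD ht.1 ht.2 le_rfl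
      _ ≤ ∫ s in t..T, t ^ (-α) * (D / √s) := by
          refine intervalIntegral.integral_mono_on ht.2
            (intervalIntegrable_of_continuousOn_Ioc (hcont _ D) ht.1 ht.2 le_rfl)
            (intervalIntegrable_of_continuousOn_Ioc (continuousOn_const.mul (continuousOn_const.div
              Real.continuous_sqrt.continuousOn fun s hs => (Real.sqrt_pos.2 hs.1).ne'))
              ht.1 ht.2 le_rfl) fun s hs => ?_
          rw [rpow_sub_half (ht.1.trans_le hs.1), mul_div_left_comm]
          exact mul_le_mul_of_nonneg_right
            (Real.rpow_le_rpow_of_nonpos ht.1 hs.1 (neg_nonpos.2 hα))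
            (div_nonneg hD (Real.sqrt_nonneg s))
      _ ≤ t ^ (-α) * (2 * D * √T) := by
          rw [intervalIntegral.integral_const_mul]
          exact mul_le_mul_of_nonneg_left (integral_const_div_sqrt_le hD ht) hp.le
      _ = _ := mul_comm _ _
  have hconst : (fun _ => f T) =O[𝓟 (Ioc 0 T)] fun s => s ^ (-α) :=
    (Asymptotics.isBigO_const_const (f T) one_ne_zero _).trans
      (isBigO_one_rpow T (neg_nonpos.2 hα))
  simpa only [sub_add_cancel] using hsub.add hconst

theorem exists_tendsto_of_isBigO_deriv {f f' : ℝ → ℝ} {T γ : ℝ} (hT : 0 < T) (hγ : 0 < γ)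
    (hf : ∀ s ∈ Ioc 0 T, HasDerivWithinAt f (f' s) (Ioc 0 T) s)
    (hf' : f' =O[𝓟 (Ioc 0 T)] fun s => s ^ (γ - 1)) :
    ∃ L, Tendsto f (𝓝[>] 0) (𝓝 L) ∧ (fun t => f t - L) =O[𝓟 (Ioc 0 T)] fun t => t ^ γ := by
  obtain ⟨B, hB⟩ := Asymptotics.isBigO_principal.1 hf'
  obtain ⟨L, hL, hfL⟩ := exists_tendsto_of_abs_deriv_le_rpow hT hγ hf fun s hs => by
    simpa only [Real.norm_eq_abs, abs_of_pos (Real.rpow_pos_of_pos hs.1 _)] using hB s hs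
  refine ⟨L, hL, Asymptotics.isBigO_principal.2 ⟨B / γ, fun t ht => ?_⟩⟩
  rw [Real.norm_of_nonneg (Real.rpow_nonneg ht.1.le _)]
  exact hfL t ht

section RowAsymptotics

variable {C : ℝ → Matrix (Fin (n + 1)) (Fin (n + 1)) ℝ} {h : ℝ → Fin (n + 1) → ℝ} {c T K : ℝ}
  {y : Fin (n + 1) → ℝ → ℝ} {F f : ℝ → ℝ}

theorem RegularSingular.isBigO_deriv_castSucc (H : RegularSingular C h c T K) (i : Fin n)
    (hy : ∀ j, y j =O[𝓟 (Ioc 0 T)] f) (hF : F =O[𝓟 (Ioc 0 T)] fun t => t * f t) :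
    (fun t => t⁻¹ * (-(∑ j, C t i.castSucc j * y j t) + F t)) =O[𝓟 (Ioc 0 T)] f := by
  have hC (j) : (fun t => C t i.castSucc j) =O[𝓟 (Ioc 0 T)] fun t => t :=
    Asymptotics.isBigO_principal.2 ⟨K, fun t ht => by
      simpa only [Real.norm_eq_abs, abs_of_pos ht.1] using H.C_castSucc i j t ht⟩
  refine ((Asymptotics.isBigO_refl (fun t : ℝ => t⁻¹) _).mul
    ((Asymptotics.IsBigO.fun_sum fun j _ => (hC j).mul (hy j)).neg_left.add hF)).congr' .rfl ?_
  filter_upwards [mem_principal_self _] with t ht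
  exact inv_mul_cancel_left₀ ht.1.ne' _

theorem RegularSingular.isBigO_lastForce (H : RegularSingular C h c T K)
    (hy : ∀ j : Fin n, y j.castSucc =O[𝓟 (Ioc 0 T)] f)
    (hlast : (fun t => t * y (Fin.last n) t) =O[𝓟 (Ioc 0 T)] f) (hF : F =O[𝓟 (Ioc 0 T)] f) :
    lastForce C c y F =O[𝓟 (Ioc 0 T)] f := by
  have hdiag : (fun t => c - C t (Fin.last n) (Fin.last n)) =O[𝓟 (Ioc 0 T)] fun t => t :=
    Asymptotics.isBigO_principal.2 ⟨K, fun t ht => by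
      simpa only [Real.norm_eq_abs, abs_of_pos ht.1] using H.C_diag t ht⟩
  have hC (j : Fin n) :
      (fun t => C t (Fin.last n) j.castSucc) =O[𝓟 (Ioc 0 T)] fun _ => (1 : ℝ) :=
    Asymptotics.isBigO_principal.2 ⟨K, fun t ht => by
      simpa only [norm_one, mul_one, Real.norm_eq_abs] using H.C_last j t ht⟩
  have hsum := Asymptotics.IsBigO.fun_sum fun j (_ : j ∈ Finset.univ) => (hC j).mul (hy j)
  simp only [one_mul] at hsum
  exact (((hdiag.mul (Asymptotics.isBigO_refl _ _)).trans hlast).sub hsum).add hF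

end RowAsymptotics

/-- `x` solves `t x' = -C(t) x + G h(t)` on `(0,T]`. -/
def Solves (C : ℝ → Matrix (Fin (n + 1)) (Fin (n + 1)) ℝ) (h : ℝ → Fin (n + 1) → ℝ) (T G : ℝ)
    (x : ℝ → EuclideanSpace ℝ (Fin (n + 1))) : Prop :=
  ∀ i, SolvesRow C T i (fun j t => x t j) fun t => G * h t i

namespace RegularSingular

variable {C : ℝ → Matrix (Fin (n + 1)) (Fin (n + 1)) ℝ} {h : ℝ → Fin (n + 1) → ℝ} {c T K : ℝ}

theorem mono (H : RegularSingular C h c T K) {δ : ℝ} (hδ : 0 < δ) (hδT : δ ≤ T) :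
    RegularSingular C h c δ K := by
  have hsub : Ioc 0 δ ⊆ Ioc 0 T := Ioc_subset_Ioc_right hδT
  exact {
    T_pos := hδ
    K_nonneg := H.K_nonneg
    one_lt := H.one_lt
    continuousOn_C i j := (H.continuousOn_C i j).mono hsub
    continuousOn_h i := (H.continuousOn_h i).mono hsub
    C_castSucc i j t ht := H.C_castSucc i j t (hsub ht)
    C_last j t ht := H.C_last j t (hsub ht)
    C_diag t ht := H.C_diag t (hsub ht)
    h_castSucc i t ht := H.h_castSucc i t (hsub ht)
    h_last t ht := H.h_last t (hsub ht)
    C_tendsto := H.C_tendsto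
    h_tendsto := H.h_tendsto }

theorem abs_h_le (H : RegularSingular C h c T K) (i : Fin (n + 1)) {t : ℝ} (ht : t ∈ Ioc 0 T) :
    |h t i| ≤ K * (1 + T) := by
  have hK := H.K_nonneg
  have hKt : K * t ≤ K * T := mul_le_mul_of_nonneg_left ht.2 hK
  induction i using Fin.lastCases with
  | last => linarith [H.h_last t ht, mul_nonneg hK H.T_pos.le]
  | cast i => linarith [H.h_castSucc i t ht]

theorem isBigO_h_castSucc (H : RegularSingular C h c T K) (G : ℝ) (i : Fin n) :
    (fun t => G * h t i.castSucc) =O[𝓟 (Ioc 0 T)] fun t => t :=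
  Asymptotics.IsBigO.const_mul_left (Asymptotics.isBigO_principal.2 ⟨K, fun t ht => by
    simpa only [Real.norm_eq_abs, abs_of_pos ht.1] using H.h_castSucc i t ht⟩) G

theorem isBigO_h_last (H : RegularSingular C h c T K) (G : ℝ) :
    (fun t => G * h t (Fin.last n)) =O[𝓟 (Ioc 0 T)] fun _ => (1 : ℝ) :=
  Asymptotics.IsBigO.const_mul_left (Asymptotics.isBigO_principal.2 ⟨K, fun t ht => by
    simpa only [norm_one, mul_one, Real.norm_eq_abs] using H.h_last t ht⟩) G

end RegularSingular

theorem tendsto_euclidean {f : ℝ → EuclideanSpace ℝ (Fin n)} {l : Filter ℝ}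
    {v : EuclideanSpace ℝ (Fin n)} (hf : ∀ i, Tendsto (fun t => f t i) l (𝓝 (v i))) :
    Tendsto f l (𝓝 v) :=
  ((PiLp.continuous_toLp 2 _).tendsto _).comp (tendsto_pi_nhds.2 hf)

section Solutions

variable {C : ℝ → Matrix (Fin (n + 1)) (Fin (n + 1)) ℝ} {h : ℝ → Fin (n + 1) → ℝ} {c T K G : ℝ}
  {x y : ℝ → EuclideanSpace ℝ (Fin (n + 1))}

theorem Solves.mono (hx : Solves C h T G x) {δ : ℝ} (hδT : δ ≤ T) : Solves C h δ G x :=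
  fun i t ht => (hx i t (Ioc_subset_Ioc_right hδT ht)).mono (Ioc_subset_Ioc_right hδT)

theorem Solves.add_smul {G' : ℝ} (hx : Solves C h T G x) (hy : Solves C h T G' y) (k : ℝ) :
    Solves C h T (G + k * G') fun t => x t + k • y t := by
  intro i t ht
  refine ((hx i t ht).add ((hy i t ht).const_mul k)).congr_deriv ?_
  simp only [PiLp.add_apply, PiLp.smul_apply, smul_eq_mul, mul_add, Finset.sum_add_distrib,
    mul_left_comm _ k, ← Finset.mul_sum]
  ring

/-- In the variable `log t` the singular point moves to `-∞` and the system becomes a regular one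
on `(-∞, log T]`, which is continued by constant coefficients. -/
theorem RegularSingular.exists_solves (H : RegularSingular C h c T K) (G : ℝ)
    (v : EuclideanSpace ℝ (Fin (n + 1))) (t₀ : ℝ) : ∃ x, Solves C h T G x ∧ x t₀ = v := by
  set θ : ℝ → ℝ := fun τ => min (Real.exp τ) T with hθ
  have hθ_cont : Continuous θ := Real.continuous_exp.min continuous_const
  have hθ_mem (τ : ℝ) : θ τ ∈ Ioc 0 T := ⟨lt_min (Real.exp_pos τ) H.T_pos, min_le_right _ _⟩
  set A : ℝ → EuclideanSpace ℝ (Fin (n + 1)) →L[ℝ] EuclideanSpace ℝ (Fin (n + 1)) :=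
    fun τ => LinearMap.toContinuousLinearMap (Matrix.toEuclideanLin (C (θ τ))) with hA
  have hC_cont : Continuous fun τ => C (θ τ) := continuous_matrix fun i j =>
    (H.continuousOn_C i j).comp_continuous hθ_cont hθ_mem
  have hA_cont : Continuous A := continuous_clm_apply.2 fun z =>
    (PiLp.continuous_toLp 2 _).comp (hC_cont.matrix_mulVec continuous_const)
  have hh_cont : Continuous fun τ => WithLp.toLp 2 (h (θ τ)) :=
    (PiLp.continuous_toLp 2 _).comp
      (continuous_pi fun i => (H.continuousOn_h i).comp_continuous hθ_cont hθ_mem)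
  obtain ⟨X, hX₀, hX⟩ := exists_forall_hasDerivAt_of_lipschitz
    (F := fun τ z => -(A τ z) + G • WithLp.toLp 2 (h (θ τ))) (L := fun τ => ‖A τ‖)
    (((hA_cont.comp continuous_fst).clm_apply continuous_snd).neg.add
      ((hh_cont.comp continuous_fst).const_smul G)) hA_cont.norm (fun τ z w => by
      rw [add_sub_add_right_eq_sub, ← neg_sub_neg, neg_neg, neg_neg, ← map_sub, norm_sub_rev z]
      exact (A τ).le_opNorm _) v (Real.log t₀)
  refine ⟨fun t => X (Real.log t), fun i t ht => ?_, hX₀⟩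
  have hθ_log : θ (Real.log t) = t := by
    simp only [hθ, Real.exp_log ht.1, min_eq_left ht.2]
  have hcoord := ((EuclideanSpace.proj (𝕜 := ℝ) i).hasFDerivAt.comp_hasDerivAt _
    (hX (Real.log t))).comp t (Real.hasDerivAt_log ht.1.ne')
  refine hcoord.hasDerivWithinAt.congr_deriv ?_
  simp only [hA, hθ_log, EuclideanSpace.coe_proj, PiLp.add_apply, PiLp.neg_apply,
    PiLp.smul_apply, smul_eq_mul, LinearMap.coe_toContinuousLinearMap', Matrix.toLpLin_apply,
    Matrix.mulVec, dotProduct]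
  ring

namespace Solves

theorem isMajorant (H : RegularSingular C h c T K) (hx : Solves C h T G x) :
    IsMajorant c T K (fun j t => |x t j|) fun _ => |G| * (K * (1 + T)) :=
  H.isMajorant_abs hx continuousOn_const fun i t ht => by
    rw [abs_mul]
    exact mul_le_mul_of_nonneg_left (H.abs_h_le i ht) (abs_nonneg G)

theorem weightedSize_le_of_homogeneous (H : RegularSingular C h c T K) (hx : Solves C h T 0 x)
    {t : ℝ} (ht : t ∈ Ioc 0 T) :
    weightedSize c (fun j s => |x s j|) t
      ≤ weightedSize c (fun j s => |x s j|) T * growthFactor n T K := by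
  simpa only [abs_zero, zero_mul, mul_zero, add_zero] using
    (hx.isMajorant H).weightedSize_le_of_const H.K_nonneg (by linarith [H.one_lt]) ht

theorem eq_zero_of_eq_zero (H : RegularSingular C h c T K) (hx : Solves C h T 0 x)
    (hxT : x T = 0) {t : ℝ} (ht : t ∈ Ioc 0 T) : x t = 0 := by
  have hsize := hx.weightedSize_le_of_homogeneous H ht
  have hsizeT : weightedSize c (fun j s => |x s j|) T = 0 := by simp [weightedSize, hxT]
  rw [hsizeT, zero_mul] at hsize
  ext i
  have hi := rpow_mul_le_weightedSize (U := fun j s => |x s j|) c ht (fun _ => abs_nonneg _) i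
  have hle : t ^ c * |x t i| ≤ 0 :=
    hi.trans (mul_nonpos_of_nonneg_of_nonpos (by positivity) hsize)
  exact abs_eq_zero.1 (le_antisymm
    (nonpos_of_mul_nonpos_right hle (Real.rpow_pos_of_pos ht.1 c)) (abs_nonneg _))

theorem eq_of_eq (H : RegularSingular C h c T K) (hx : Solves C h T 0 x) (hy : Solves C h T 0 y)
    (hxy : x T = y T) {t : ℝ} (ht : t ∈ Ioc 0 T) : x t = y t := by
  have hsub := hx.add_smul hy (-1)
  rw [mul_zero, add_zero] at hsub
  have hzero := hsub.eq_zero_of_eq_zero H (by simp [hxy]) ht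
  rwa [neg_one_smul, ← sub_eq_add_neg, sub_eq_zero] at hzero

theorem exists_weightedSize_le (H : RegularSingular C h c T K) (hx : Solves C h T G x) :
    ∃ B, ∀ t ∈ Ioc 0 T, weightedSize c (fun j s => |x s j|) t ≤ B :=
  ⟨_, fun _ ht => (hx.isMajorant H).weightedSize_le_of_const H.K_nonneg (by linarith [H.one_lt]) ht⟩

theorem isBigO_rpow_neg (H : RegularSingular C h c T K) (hx : Solves C h T G x)
    (i : Fin (n + 1)) : (fun t => x t i) =O[𝓟 (Ioc 0 T)] fun t => t ^ (-c) := by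
  obtain ⟨B, hB⟩ := hx.exists_weightedSize_le H
  refine Asymptotics.isBigO_principal.2 ⟨(1 + √T) * B, fun t ht => ?_⟩
  have hp := Real.rpow_pos_of_pos ht.1 c
  rw [Real.norm_eq_abs, Real.norm_of_nonneg (Real.rpow_nonneg ht.1.le _), Real.rpow_neg ht.1.le,
    ← div_eq_mul_inv, le_div_iff₀ hp, mul_comm]
  refine (rpow_mul_le_weightedSize (U := fun j s => |x s j|) c ht (fun _ => abs_nonneg _) i).trans
    (mul_le_mul_of_nonneg_left (hB t ht) (by positivity))

theorem isBigO_castSucc (H : RegularSingular C h c T K) (hx : Solves C h T G x) {α α' : ℝ}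
    (hα' : 0 ≤ α') (hαα' : α ≤ α' + 1 / 2)
    (hb : ∀ j, (fun t => x t j) =O[𝓟 (Ioc 0 T)] fun t => t ^ (-α)) (i : Fin n) :
    (fun t => x t i.castSucc) =O[𝓟 (Ioc 0 T)] fun t => t ^ (-α') := by
  have hF : (fun t => G * h t i.castSucc) =O[𝓟 (Ioc 0 T)] fun t => t * t ^ (-α' - 1 / 2) := by
    simpa only [mul_one] using (H.isBigO_h_castSucc G i).mul
      (isBigO_one_rpow T (r := -α' - 1 / 2) (by linarith))
  exact isBigO_of_isBigO_deriv hα' (hx i.castSucc) (H.isBigO_deriv_castSucc i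
    (fun j => (hb j).trans (isBigO_rpow_rpow T (by linarith))) hF)

theorem isBigO_last_sub (H : RegularSingular C h c T K) (hx : Solves C h T G x) {α α' : ℝ}
    (hα' : 0 ≤ α') (hα'c : α' < c) (hαα' : α ≤ α' + 1)
    (hcast : ∀ i : Fin n, (fun t => x t i.castSucc) =O[𝓟 (Ioc 0 T)] fun t => t ^ (-α'))
    (hlast : (fun t => x t (Fin.last n)) =O[𝓟 (Ioc 0 T)] fun t => t ^ (-α)) :
    ∃ β, Tendsto (fun t => t ^ c * x t (Fin.last n)) (𝓝[>] 0) (𝓝 β) ∧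
      (fun t => t ^ c * x t (Fin.last n) - β) =O[𝓟 (Ioc 0 T)] fun t => t ^ (c - α') := by
  have htlast : (fun t => t * x t (Fin.last n)) =O[𝓟 (Ioc 0 T)] fun t => t ^ (-α') := by
    simpa only [Real.rpow_one] using
      (isBigO_rpow_mul 1 hlast).trans (isBigO_rpow_rpow T (by linarith))
  have hforce := H.isBigO_lastForce (y := fun j t => x t j) hcast htlast
    ((H.isBigO_h_last G).trans (isBigO_one_rpow T (neg_nonpos.2 hα')))
  have hderiv := isBigO_rpow_mul (c - 1) hforce
  rw [show c - 1 + -α' = c - α' - 1 by ring] at hderiv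
  exact exists_tendsto_of_isBigO_deriv H.T_pos (sub_pos.2 hα'c)
    (fun t ht => (hx (Fin.last n)).hasDerivWithinAt_rpow_mul c ht) hderiv

theorem isBigO_castSucc_rpow_neg (H : RegularSingular C h c T K) (hx : Solves C h T G x)
    (i : Fin n) : (fun t => x t i.castSucc) =O[𝓟 (Ioc 0 T)] fun t => t ^ (-(c - 1 / 2)) :=
  hx.isBigO_castSucc H (by linarith [H.one_lt]) (by linarith) (hx.isBigO_rpow_neg H) i

theorem exists_tendsto_last (H : RegularSingular C h c T K) (hx : Solves C h T G x) :
    ∃ β, Tendsto (fun t => t ^ c * x t (Fin.last n)) (𝓝[>] 0) (𝓝 β) := by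
  obtain ⟨β, hβ, -⟩ := hx.isBigO_last_sub H (α := c) (α' := c - 1 / 2) (by linarith [H.one_lt])
    (by linarith) (by linarith) (hx.isBigO_castSucc_rpow_neg H) (hx.isBigO_rpow_neg H _)
  exact ⟨β, hβ⟩

theorem tendsto_castSucc (H : RegularSingular C h c T K) (hx : Solves C h T G x) (i : Fin n) :
    Tendsto (fun t => t ^ c * x t i.castSucc) (𝓝[>] 0) (𝓝 0) := by
  have hO := isBigO_rpow_mul c (hx.isBigO_castSucc_rpow_neg H i)
  rw [show c + -(c - 1 / 2) = 1 / 2 by ring] at hO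
  exact (hO.mono (le_principal_iff.2 (Ioc_mem_nhdsGT H.T_pos))).trans_tendsto
    (tendsto_rpow_nhdsGT_zero (by norm_num))

/-- Without a singular part, half a power of `t` is gained in the first components by integrating
from `T`, and then in the last one by integrating from `0`. -/
theorem isBigO_improve (H : RegularSingular C h c T K) (hx : Solves C h T G x)
    (hβ : Tendsto (fun t => t ^ c * x t (Fin.last n)) (𝓝[>] 0) (𝓝 0)) {α α' : ℝ} (hα' : 0 ≤ α')
    (hα'c : α' < c) (hαα' : α ≤ α' + 1 / 2)
    (hb : ∀ j, (fun t => x t j) =O[𝓟 (Ioc 0 T)] fun t => t ^ (-α)) (j : Fin (n + 1)) :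
    (fun t => x t j) =O[𝓟 (Ioc 0 T)] fun t => t ^ (-α') := by
  have hcast := hx.isBigO_castSucc H hα' hαα' hb
  induction j using Fin.lastCases with
  | cast i => exact hcast i
  | last =>
    obtain ⟨L, hL, hO⟩ := hx.isBigO_last_sub H hα' hα'c (by linarith) hcast (hb _)
    obtain rfl : L = 0 := tendsto_nhds_unique hL hβ
    have hlast := isBigO_rpow_mul (-c) (by simpa only [sub_zero] using hO)
    rw [show -c + (c - α') = -α' by ring] at hlast
    refine hlast.congr' ?_ .rfl
    filter_upwards [mem_principal_self _] with t ht
    rw [← mul_assoc, ← Real.rpow_add ht.1, neg_add_cancel, Real.rpow_zero, one_mul]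

theorem isBigO_one (H : RegularSingular C h c T K) (hx : Solves C h T G x)
    (hβ : Tendsto (fun t => t ^ c * x t (Fin.last n)) (𝓝[>] 0) (𝓝 0)) (j : Fin (n + 1)) :
    (fun t => x t j) =O[𝓟 (Ioc 0 T)] fun _ => (1 : ℝ) := by
  have hc := H.one_lt
  have hdecay (k : ℕ) : ∀ j, (fun t => x t j) =O[𝓟 (Ioc 0 T)]
      fun t => t ^ (-(max (c - k / 2) 0)) := by
    induction k with
    | zero => simpa [max_eq_left (zero_le_one.trans hc.le)] using hx.isBigO_rpow_neg H
    | succ k ih =>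
      have hstep : max (c - k / 2) 0 ≤ max (c - (k + 1 : ℕ) / 2) 0 + 1 / 2 := by
        push_cast
        refine max_le ?_ (by positivity)
        linarith [le_max_left (c - (k + 1) / 2) 0]
      refine hx.isBigO_improve H hβ (le_max_right _ _) (max_lt ?_ (by linarith)) hstep ih
      push_cast
      linarith [k.cast_nonneg (α := ℝ)]
  obtain ⟨k, hk⟩ := exists_nat_ge (2 * c)
  simpa only [max_eq_right (show c - k / 2 ≤ 0 by linarith), neg_zero, Real.rpow_zero] using
    hdecay k j

theorem exists_tendsto_castSucc (H : RegularSingular C h c T K) (hx : Solves C h T G x)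
    (hβ : Tendsto (fun t => t ^ c * x t (Fin.last n)) (𝓝[>] 0) (𝓝 0)) (i : Fin n) :
    ∃ L, Tendsto (fun t => x t i.castSucc) (𝓝[>] 0) (𝓝 L) := by
  have hderiv := H.isBigO_deriv_castSucc i (hx.isBigO_one H hβ)
    (by simpa only [mul_one] using H.isBigO_h_castSucc G i)
  obtain ⟨L, hL, -⟩ := exists_tendsto_of_isBigO_deriv (γ := 1) H.T_pos one_pos (hx i.castSucc)
    (by simpa only [sub_self, Real.rpow_zero] using hderiv)
  exact ⟨L, hL⟩

theorem exists_tendsto_lastForce (H : RegularSingular C h c T K) (hx : Solves C h T G x)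
    (hβ : Tendsto (fun t => t ^ c * x t (Fin.last n)) (𝓝[>] 0) (𝓝 0)) :
    ∃ Λ, Tendsto (lastForce C c (fun j t => x t j) fun t => G * h t (Fin.last n)) (𝓝[>] 0)
      (𝓝 Λ) := by
  choose L hL using hx.exists_tendsto_castSucc H hβ
  choose M hM using H.C_tendsto
  obtain ⟨η, hη⟩ := H.h_tendsto
  obtain ⟨B, hB⟩ := Asymptotics.isBigO_principal.1 (hx.isBigO_one H hβ (Fin.last n))
  have hdiag : Tendsto (fun t => (c - C t (Fin.last n) (Fin.last n)) * x t (Fin.last n)) (𝓝[>] 0)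
      (𝓝 0) := by
    have hlim : Tendsto (fun t : ℝ => K * t * B) (𝓝[>] 0) (𝓝 0) := by
      have hcont : Continuous fun t : ℝ => K * t * B := by fun_prop
      simpa using (hcont.tendsto 0).mono_left nhdsWithin_le_nhds
    refine squeeze_zero_norm' ?_ hlim
    filter_upwards [Ioc_mem_nhdsGT H.T_pos] with t ht
    rw [norm_mul]
    exact mul_le_mul (H.C_diag t ht) (by simpa using hB t ht) (norm_nonneg _)
      (mul_nonneg H.K_nonneg ht.1.le)
  exact ⟨_, (hdiag.sub (tendsto_finsetSum _ fun j _ => (hM j).mul (hL j))).add (hη.const_mul G)⟩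

/-- L'Hôpital's rule for `t ^ c * x t (Fin.last n)` over `t ^ c`. -/
theorem exists_tendsto_last_of_tendsto_zero (H : RegularSingular C h c T K)
    (hx : Solves C h T G x) (hβ : Tendsto (fun t => t ^ c * x t (Fin.last n)) (𝓝[>] 0) (𝓝 0)) :
    ∃ L, Tendsto (fun t => x t (Fin.last n)) (𝓝[>] 0) (𝓝 L) := by
  have hc : 0 < c := zero_lt_one.trans H.one_lt
  obtain ⟨Λ, hΛ⟩ := hx.exists_tendsto_lastForce H hβ
  have hlhopital := HasDerivAt.lhopital_zero_right_on_Ioo H.T_pos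
    (fun t ht => ((hx (Fin.last n)).hasDerivWithinAt_rpow_mul c
      (Ioo_subset_Ioc_self ht)).hasDerivAt (Ioc_mem_nhds ht.1 ht.2))
    (fun t ht => Real.hasDerivAt_rpow_const (p := c) (Or.inl ht.1.ne'))
    (fun t ht => (mul_pos hc (Real.rpow_pos_of_pos ht.1 _)).ne') hβ (tendsto_rpow_nhdsGT_zero hc)
    ((hΛ.div_const c).congr' (eventually_mem_nhdsWithin.mono fun t ht => by
      simp only [mul_comm c, mul_div_mul_left _ _ (Real.rpow_pos_of_pos ht _).ne']))
  refine ⟨Λ / c, hlhopital.congr' (eventually_mem_nhdsWithin.mono fun t ht => ?_)⟩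
  exact mul_div_cancel_left₀ _ (Real.rpow_pos_of_pos ht c).ne'

theorem exists_tendsto (H : RegularSingular C h c T K) (hx : Solves C h T G x)
    (hβ : Tendsto (fun t => t ^ c * x t (Fin.last n)) (𝓝[>] 0) (𝓝 0)) :
    ∃ v, Tendsto x (𝓝[>] 0) (𝓝 v) := by
  choose L hL using hx.exists_tendsto_castSucc H hβ
  obtain ⟨Λ, hΛ⟩ := hx.exists_tendsto_last_of_tendsto_zero H hβ
  refine ⟨WithLp.toLp 2 (Fin.snoc L Λ), tendsto_euclidean fun i => ?_⟩
  induction i using Fin.lastCases with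
  | last => simpa using hΛ
  | cast i => simpa using hL i

end Solves

end Solutions

theorem rpow_sub_one_mul_le_weightedSize {U : Fin (n + 1) → ℝ → ℝ} {T t : ℝ} (c : ℝ)
    (ht : t ∈ Ioc 0 T) (hU : ∀ j, 0 ≤ U j t) :
    t ^ (c - 1) * (∑ j : Fin n, U j.castSucc t + t * U (Fin.last n) t)
      ≤ (1 + √T) * weightedSize c U t * t ^ ((1 / 2 : ℝ) - 1) := by
  set w := √t
  have hw0 : 0 < w := Real.sqrt_pos.2 ht.1
  have hwT : 0 ≤ √T - w := sub_nonneg.2 (Real.sqrt_le_sqrt ht.2)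
  have hsw : t = w ^ 2 := (Real.sq_sqrt ht.1.le).symm
  have hhalf : t ^ (c - 1 / 2) = t ^ c / w := rpow_sub_half ht.1 c
  have hone : t ^ (c - 1) = t ^ c / w ^ 2 := by rw [Real.rpow_sub_one ht.1.ne', ← hsw]
  have hneg : t ^ ((1 / 2 : ℝ) - 1) = w / w ^ 2 := by
    rw [Real.rpow_sub_one ht.1.ne', ← Real.sqrt_eq_rpow, ← hsw]
  have hN : 0 ≤ ∑ j : Fin n, U j.castSucc t := Finset.sum_nonneg fun j _ => hU _
  have hM := hU (Fin.last n)
  have hp : 0 ≤ t ^ c := Real.rpow_nonneg ht.1.le _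
  rw [weightedSize, hhalf, hone, hneg]
  set N := ∑ j : Fin n, U j.castSucc t
  set M := U (Fin.last n) t
  set P := t ^ c
  have hid : (1 + √T) * (P * M + P / w * N) * (w / w ^ 2) - P / w ^ 2 * (N + t * M)
      = P * (√T - w) * (M / w) + P * (M / w) + P * √T * N / w ^ 2 := by
    rw [hsw]
    field_simp
    ring
  rw [← sub_nonneg, hid]
  positivity

section Fundamental

variable {C : ℝ → Matrix (Fin (n + 1)) (Fin (n + 1)) ℝ} {h : ℝ → Fin (n + 1) → ℝ} {c T K : ℝ}

theorem Solves.singular_part_ne_zero {x : ℝ → EuclideanSpace ℝ (Fin (n + 1))} {β : ℝ}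
    (H : RegularSingular C h c T K) (hx : Solves C h T 0 x)
    (hxT : x T = EuclideanSpace.single (Fin.last n) 1)
    (hsmall : 2 * (K * ((1 + √T) * growthFactor n T K)) * √T < 1)
    (hβ : Tendsto (fun t => t ^ c * x t (Fin.last n)) (𝓝[>] 0) (𝓝 β)) : β ≠ 0 := by
  have hpT := Real.rpow_pos_of_pos H.T_pos c
  have hcast (j : Fin n) : x T j.castSucc = 0 := by simp [hxT, (Fin.castSucc_lt_last j).ne]
  have hlast : x T (Fin.last n) = 1 := by simp [hxT]
  have hsizeT : weightedSize c (fun j s => |x s j|) T = T ^ c := by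
    simp [weightedSize, hcast, hlast]
  set Q := K * ((1 + √T) * (T ^ c * growthFactor n T K)) with hQ
  obtain ⟨L, hL, hrate⟩ := exists_tendsto_of_abs_deriv_le_rpow (B := Q) (γ := 1 / 2)
    H.T_pos (by norm_num) (fun t ht => (hx (Fin.last n)).hasDerivWithinAt_rpow_mul c ht)
    fun t ht => by
      have hK := H.K_nonneg
      have hp := Real.rpow_nonneg ht.1.le (1 / 2 - 1)
      have hsize := hx.weightedSize_le_of_homogeneous H ht
      rw [hsizeT] at hsize
      calc _ ≤ lastRate c K (fun j s => |x s j|) (fun _ => 0) t :=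
            H.abs_rpow_mul_lastForce_le ht (fun _ => le_rfl) (by simp)
        _ = K * (t ^ (c - 1) * (∑ j : Fin n, |x t j.castSucc| + t * |x t (Fin.last n)|)) := by
            rw [lastRate]
            ring
        _ ≤ K * ((1 + √T) * weightedSize c (fun j s => |x s j|) t * t ^ ((1 / 2 : ℝ) - 1)) :=
            mul_le_mul_of_nonneg_left (rpow_sub_one_mul_le_weightedSize
              (U := fun j s => |x s j|) c ht fun _ => abs_nonneg _) hK
        _ ≤ K * ((1 + √T) * (T ^ c * growthFactor n T K) * t ^ ((1 / 2 : ℝ) - 1)) := by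
            gcongr
        _ = _ := by ring
  obtain rfl : L = β := tendsto_nhds_unique hL hβ
  rintro rfl
  have hdrop := hrate T ⟨H.T_pos, le_rfl⟩
  rw [hlast, mul_one, sub_zero, abs_of_pos hpT, ← Real.sqrt_eq_rpow] at hdrop
  have hQT : Q / (1 / 2) * √T = T ^ c * (2 * (K * ((1 + √T) * growthFactor n T K)) * √T) := by
    rw [hQ]
    ring
  nlinarith [hQT]

namespace RegularSingular

theorem exists_singular_solution (H : RegularSingular C h c T K) :
    ∃ x β, Solves C h T 0 x ∧ β ≠ 0 ∧
      Tendsto (fun t => t ^ c * x t (Fin.last n)) (𝓝[>] 0) (𝓝 β) := by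
  have hlim : Tendsto (fun δ => 2 * (K * ((1 + √δ) * growthFactor n δ K)) * √δ) (𝓝[>] 0)
      (𝓝 0) := by
    have hcont : Continuous fun δ => 2 * (K * ((1 + √δ) * growthFactor n δ K)) * √δ := by
      unfold growthFactor rateFactor
      fun_prop
    simpa using (hcont.tendsto 0).mono_left nhdsWithin_le_nhds
  obtain ⟨δ, hsmall, hδ, hδT⟩ :=
    ((hlim.eventually (gt_mem_nhds one_pos)).and (Ioc_mem_nhdsGT H.T_pos)).exists
  obtain ⟨x, hx, hxδ⟩ := H.exists_solves 0 (EuclideanSpace.single (Fin.last n) 1) δ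
  obtain ⟨β, hβ⟩ := hx.exists_tendsto_last H
  exact ⟨x, β, hx, (hx.mono hδT).singular_part_ne_zero (H.mono hδ hδT) hxδ hsmall hβ, hβ⟩

theorem exists_singular_functional (H : RegularSingular C h c T K) :
    ∃ β : EuclideanSpace ℝ (Fin (n + 1)) →ₗ[ℝ] ℝ, β ≠ 0 ∧ ∀ x, Solves C h T 0 x →
      Tendsto (fun t => t ^ c * x t (Fin.last n)) (𝓝[>] 0) (𝓝 (β (x T))) := by
  choose X hX hXT using fun v => H.exists_solves 0 v T
  choose b hb using fun v => (hX v).exists_tendsto_last H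
  have hlim {x : ℝ → EuclideanSpace ℝ (Fin (n + 1))} (hx : Solves C h T 0 x) :
      Tendsto (fun t => t ^ c * x t (Fin.last n)) (𝓝[>] 0) (𝓝 (b (x T))) := by
    refine (hb (x T)).congr' ?_
    filter_upwards [Ioc_mem_nhdsGT H.T_pos] with t ht
    rw [(hX (x T)).eq_of_eq H hx (hXT _) ht]
  have hadd (v w : EuclideanSpace ℝ (Fin (n + 1))) (k : ℝ) : b (v + k • w) = b v + k * b w := by
    have hsolves := (hX v).add_smul (hX w) k
    rw [mul_zero, add_zero] at hsolves
    have hvw := hlim hsolves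
    rw [hXT, hXT] at hvw
    refine tendsto_nhds_unique hvw (((hb v).add ((hb w).const_mul k)).congr fun t => ?_)
    simp only [PiLp.add_apply, PiLp.smul_apply, smul_eq_mul]
    ring
  have hzero : b 0 = 0 := by simpa using hadd 0 0 1
  let β : EuclideanSpace ℝ (Fin (n + 1)) →ₗ[ℝ] ℝ :=
    { toFun := b
      map_add' := fun v w => by simpa using hadd v w 1
      map_smul' := fun k v => by simpa [hzero] using hadd 0 v k }
  refine ⟨β, fun hβ => ?_, fun x hx => hlim hx⟩
  obtain ⟨y, γ, hy, hγ, hyγ⟩ := H.exists_singular_solution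
  exact hγ ((tendsto_nhds_unique hyγ (hlim hy)).trans (LinearMap.congr_fun hβ (y T)))

end RegularSingular

theorem exists_linearIndependent_of_ne_zero {k E : Type*} [Field k] [AddCommGroup E] [Module k E]
    [Module.Finite k E] (hE : Module.finrank k E = n + 1) {β : E →ₗ[k] k} (hβ : β ≠ 0) :
    ∃ w : Fin (n + 1) → E, LinearIndependent k w ∧ (∀ i : Fin n, β (w i.castSucc) = 0) ∧
      β (w (Fin.last n)) = 1 := by
  have hsurj := LinearMap.surjective hβ
  obtain ⟨v, hv⟩ := hsurj 1
  have hker : Module.finrank k (LinearMap.ker β) = n := by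
    have hrank := LinearMap.finrank_range_add_finrank_ker β
    rw [LinearMap.range_eq_top.2 hsurj, finrank_top, Module.finrank_self, hE] at hrank
    omega
  have B := Module.finBasisOfFinrankEq k (LinearMap.ker β) hker
  have hB : LinearIndependent k (fun i => (B i : E)) :=
    B.linearIndependent.map' (LinearMap.ker β).subtype (Submodule.ker_subtype _)
  have hspan : Submodule.span k (range fun i => (B i : E)) ≤ LinearMap.ker β :=
    Submodule.span_le.2 (range_subset_iff.2 fun i => (B i).2)
  refine ⟨Fin.snoc (α := fun _ => E) (fun i => (B i : E)) v,
    linearIndependent_finSnoc.2 ⟨hB, fun hmem => ?_⟩, fun i => ?_, ?_⟩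
  · exact one_ne_zero (hv.symm.trans (hspan hmem))
  · rw [Fin.snoc_castSucc (α := fun _ => E)]
    exact (B i).2
  · rw [Fin.snoc_last (α := fun _ => E), hv]

theorem Solves.tendsto_rpow_smul {x : ℝ → EuclideanSpace ℝ (Fin (n + 1))} {β G : ℝ}
    (H : RegularSingular C h c T K) (hx : Solves C h T G x)
    (hβ : Tendsto (fun t => t ^ c * x t (Fin.last n)) (𝓝[>] 0) (𝓝 β)) :
    Tendsto (fun t : ℝ => t ^ c • x t) (𝓝[>] 0) (𝓝 (EuclideanSpace.single (Fin.last n) β)) := by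
  refine tendsto_euclidean fun i => ?_
  induction i using Fin.lastCases with
  | last => simpa using hβ
  | cast i => simpa [(Fin.castSucc_lt_last i).ne] using hx.tendsto_castSucc H i

theorem RegularSingular.exists_fundamental_system (H : RegularSingular C h c T K) (G : ℝ) :
    ∃ (φ : Fin (n + 1) → ℝ → EuclideanSpace ℝ (Fin (n + 1)))
      (χ : ℝ → EuclideanSpace ℝ (Fin (n + 1))),
      (∀ i, Solves C h T 0 (φ i)) ∧ Solves C h T G χ ∧
      LinearIndependent ℝ (fun i => φ i T) ∧
      (∀ i : Fin n, ∃ v, Tendsto (φ i.castSucc) (𝓝[>] 0) (𝓝 v)) ∧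
      (∃ v, Tendsto χ (𝓝[>] 0) (𝓝 v)) ∧
      Tendsto (fun t : ℝ => t ^ c • φ (Fin.last n) t) (𝓝[>] 0)
        (𝓝 (EuclideanSpace.single (Fin.last n) 1)) := by
  obtain ⟨β, hβ, hlim⟩ := H.exists_singular_functional
  obtain ⟨w, hw, hcast, hlast⟩ :=
    exists_linearIndependent_of_ne_zero finrank_euclideanSpace_fin hβ
  choose φ hφ hφT using fun i => H.exists_solves 0 (w i) T
  have hsing := hlim _ (hφ (Fin.last n))
  rw [hφT, hlast] at hsing
  obtain ⟨p, hp, -⟩ := H.exists_solves G 0 T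
  obtain ⟨b, hb⟩ := hp.exists_tendsto_last H
  have hχ := hp.add_smul (hφ (Fin.last n)) (-b)
  rw [mul_zero, add_zero] at hχ
  refine ⟨φ, _, hφ, hχ, by simpa only [hφT] using hw, fun i => ?_, ?_,
    (hφ _).tendsto_rpow_smul H hsing⟩
  · have hreg := hlim _ (hφ i.castSucc)
    rw [hφT, hcast] at hreg
    exact (hφ _).exists_tendsto H hreg
  · have hreg := hb.add (hsing.const_mul (-b))
    rw [mul_one, add_neg_cancel] at hreg
    refine hχ.exists_tendsto H (hreg.congr fun t => ?_)
    simp only [PiLp.add_apply, PiLp.smul_apply, smul_eq_mul]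
    ring

end Fundamental

/-! ### Pairings with smooth test functions -/

theorem integrable_mul_of_abs_le {f ψ : ℝ → ℝ} {M : ℝ} (hf : Integrable f) (hψ : Continuous ψ)
    (hM : ∀ p, |ψ p| ≤ M) : Integrable fun p => f p * ψ p :=
  hf.mul_bdd (c := M) hψ.aestronglyMeasurable (Eventually.of_forall hM)

theorem abs_integral_mul_le {f ψ : ℝ → ℝ} {M : ℝ} (hf : Integrable f)
    (hM : ∀ p, |ψ p| ≤ M) : |∫ p, f p * ψ p| ≤ M * ∫ p, |f p| := by
  rw [← integral_const_mul, ← Real.norm_eq_abs]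
  refine norm_integral_le_of_norm_le (hf.abs.const_mul M) (Eventually.of_forall fun p => ?_)
  rw [Real.norm_eq_abs, abs_mul, mul_comm]
  exact mul_le_mul_of_nonneg_right (hM p) (abs_nonneg _)

theorem abs_le_mul_div_sqrt_add (x : ℝ) {η : ℝ} (hη : 0 < η) :
    |x| ≤ x * (x / √(x ^ 2 + η ^ 2)) + η := by
  have hroot : 0 < √(x ^ 2 + η ^ 2) := Real.sqrt_pos.2 (by positivity)
  have hle : √(x ^ 2 + η ^ 2) ≤ |x| + η := by
    refine Real.sqrt_le_iff.2 ⟨by positivity, ?_⟩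
    nlinarith [sq_abs x, mul_nonneg (abs_nonneg x) hη.le]
  have hge : |x| ≤ √(x ^ 2 + η ^ 2) := Real.abs_le_sqrt (by nlinarith [sq_nonneg η])
  rw [← mul_div_assoc, ← sub_le_iff_le_add, le_div_iff₀ hroot, ← abs_mul_abs_self x]
  nlinarith [abs_nonneg x, hge]

theorem exists_contDiff_integral_abs_le_add {g : ℝ → ℝ} (hg : ContDiff ℝ ∞ g)
    (hs : HasCompactSupport g) {ε : ℝ} (hε : 0 < ε) :
    ∃ ψ : ℝ → ℝ, ContDiff ℝ ∞ ψ ∧ HasCompactSupport ψ ∧ (∀ p, |ψ p| ≤ 1) ∧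
      ∫ p, |g p| ≤ (∫ p, g p * ψ p) + ε := by
  set m := volume.real (tsupport g)
  have hm : 0 ≤ m := measureReal_nonneg
  set η := ε / (m + 1) with hη
  have hη0 : 0 < η := by positivity
  have hηm : η * m ≤ ε := by
    rw [hη, div_mul_eq_mul_div, div_le_iff₀ (by positivity)]
    nlinarith [hm]
  have hpos (p : ℝ) : 0 < g p ^ 2 + η ^ 2 := by positivity
  have hroot (p : ℝ) : |g p| ≤ √(g p ^ 2 + η ^ 2) :=
    Real.abs_le_sqrt (by nlinarith [sq_nonneg η])
  set ψ : ℝ → ℝ := fun p => g p / √(g p ^ 2 + η ^ 2) with hψ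
  have hψc : ContDiff ℝ ∞ ψ :=
    hg.div (((hg.pow 2).add contDiff_const).sqrt fun p => (hpos p).ne')
      fun p => (Real.sqrt_pos.2 (hpos p)).ne'
  have hψ1 (p : ℝ) : |ψ p| ≤ 1 := by
    rw [hψ, abs_div, abs_of_pos (Real.sqrt_pos.2 (hpos p))]
    exact div_le_one_of_le₀ (hroot p) (Real.sqrt_nonneg _)
  have hgi : Integrable g := hg.continuous.integrable_of_hasCompactSupport hs
  have hgψ : Integrable fun p => g p * ψ p := integrable_mul_of_abs_le hgi hψc.continuous hψ1
  have hind : Integrable ((tsupport g).indicator fun _ => η) :=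
    (integrable_indicator_iff (isClosed_tsupport g).measurableSet).2
      (integrableOn_const hs.measure_lt_top.ne)
  refine ⟨ψ, hψc, hs.mono fun p hp hg0 => hp (by simp [hψ, hg0]), hψ1, ?_⟩
  calc ∫ p, |g p| ≤ ∫ p, (g p * ψ p + (tsupport g).indicator (fun _ => η) p) := by
        refine integral_mono hgi.abs (hgψ.add hind) fun p => ?_
        by_cases hp : p ∈ tsupport g
        · simpa only [indicator_of_mem hp] using abs_le_mul_div_sqrt_add (g p) hη0
        · simp [image_eq_zero_of_notMem_tsupport hp, indicator_of_notMem hp]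
    _ = (∫ p, g p * ψ p) + m * η := by
        rw [integral_add hgψ hind, integral_indicator (isClosed_tsupport g).measurableSet,
          setIntegral_const, smul_eq_mul]
    _ ≤ (∫ p, g p * ψ p) + ε := by linarith

theorem exists_contDiff_integral_abs_sub_le {f : ℝ → ℝ} (hf : Integrable f) {ε : ℝ}
    (hε : 0 < ε) :
    ∃ g : ℝ → ℝ, ContDiff ℝ ∞ g ∧ HasCompactSupport g ∧ ∫ p, |f p - g p| ≤ ε := by
  obtain ⟨g, hs, hg, hle⟩ := (memLp_one_iff_integrable.2 hf).exist_eLpNorm_sub_le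
    ENNReal.one_ne_top le_rfl hε
  have hfg := hf.sub (hg.continuous.integrable_of_hasCompactSupport hs)
  rw [eLpNorm_one_eq_lintegral_enorm, ← ofReal_integral_norm_eq_lintegral_enorm hfg] at hle
  exact ⟨g, hg, hs, (ENNReal.ofReal_le_ofReal_iff hε.le).1 hle⟩

theorem integral_abs_le_of_forall_test {f : ℝ → ℝ} {B : ℝ} (hf : Integrable f)
    (h : ∀ ψ : ℝ → ℝ, ContDiff ℝ ∞ ψ → HasCompactSupport ψ → (∀ p, |ψ p| ≤ 1) →
      |∫ p, f p * ψ p| ≤ B) : ∫ p, |f p| ≤ B := by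
  refine le_of_forall_pos_le_add fun ε hε => ?_
  obtain ⟨g, hgc, hgs, hfg⟩ := exists_contDiff_integral_abs_sub_le hf (ε := ε / 3) (by positivity)
  obtain ⟨ψ, hψc, hψs, hψ1, hgψ⟩ :=
    exists_contDiff_integral_abs_le_add hgc hgs (ε := ε / 3) (by positivity)
  have hgi : Integrable g := hgc.continuous.integrable_of_hasCompactSupport hgs
  have hpair : (∫ p, g p * ψ p) ≤ (∫ p, f p * ψ p) + ∫ p, |f p - g p| := by
    have hle := (neg_le_abs _).trans (abs_integral_mul_le (hf.sub hgi) hψ1)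
    simp only [Pi.sub_apply, sub_mul, one_mul] at hle
    rw [integral_sub (integrable_mul_of_abs_le hf hψc.continuous hψ1)
      (integrable_mul_of_abs_le hgi hψc.continuous hψ1)] at hle
    linarith
  have htri : ∫ p, |f p| ≤ (∫ p, |f p - g p|) + ∫ p, |g p| := by
    have hfgi : Integrable fun p => |f p - g p| := (hf.sub hgi).abs
    rw [← integral_add hfgi hgi.abs]
    refine integral_mono hf.abs (hfgi.add hgi.abs) fun p => ?_
    simpa using abs_add_le (f p - g p) (g p)
  have hψB := (le_abs_self _).trans (h ψ hψc hψs hψ1)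
  linarith

theorem hasDerivAt_integral_mul_translate {f ψ : ℝ → ℝ} (hf : Integrable f)
    (hψ : ContDiff ℝ ∞ ψ) (hs : HasCompactSupport ψ) (b : ℝ) :
    HasDerivAt (fun b => ∫ p, f p * ψ (p - b)) (-∫ p, f p * deriv ψ (p - b)) b := by
  obtain ⟨M, hM⟩ := hs.exists_bound_of_continuous hψ.continuous
  have hd : Continuous (deriv ψ) := hψ.continuous_deriv (by simp)
  obtain ⟨M', hM'⟩ := hs.deriv.exists_bound_of_continuous hd
  have hc (b : ℝ) : Continuous fun p => ψ (p - b) := hψ.continuous.comp (by fun_prop)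
  have hderiv := hasDerivAt_integral_of_dominated_loc_of_deriv_le (μ := volume) (s := univ)
    (F := fun b p => f p * ψ (p - b)) (F' := fun b p => f p * -deriv ψ (p - b))
    (x₀ := b) (bound := fun p => |f p| * M') univ_mem
    (Eventually.of_forall fun b => hf.aestronglyMeasurable.mul (hc b).aestronglyMeasurable)
    (integrable_mul_of_abs_le hf (hc b) fun p => hM _)
    (hf.aestronglyMeasurable.mul
      (hd.comp (continuous_id.sub continuous_const)).neg.aestronglyMeasurable)
    (Eventually.of_forall fun p b _ => by
      rw [norm_mul, norm_neg]
      exact mul_le_mul_of_nonneg_left (hM' _) (norm_nonneg _))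
    (hf.abs.mul_const M')
    (Eventually.of_forall fun p b _ => by
      have htranslate := (hψ.differentiable (by simp) (p - b)).hasDerivAt.comp b
        ((hasDerivAt_id b).const_sub p)
      simpa using htranslate.const_mul (f p))
  simpa only [mul_neg, integral_neg] using hderiv.2

theorem abs_sub_le_of_abs_deriv_le {ψ : ℝ → ℝ} {M : ℝ} (hψ : Differentiable ℝ ψ)
    (hM : ∀ p, |deriv ψ p| ≤ M) (p q : ℝ) : |ψ p - ψ q| ≤ M * |p - q| :=
  convex_univ.norm_image_sub_le_of_norm_deriv_le (fun x _ => hψ x) (fun x _ => hM x)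
    (mem_univ q) (mem_univ p)

section VectorValued

variable {ι : Type*} [Fintype ι]

theorem integrable_coord (f : Lp (EuclideanSpace ℝ ι) 1 (volume : Measure ℝ)) (i : ι) :
    Integrable fun p => f p i :=
  (EuclideanSpace.proj i : EuclideanSpace ℝ ι →L[ℝ] ℝ).integrable_comp (L1.integrable_coeFn f)

theorem integral_abs_coord_sub_le (f g : Lp (EuclideanSpace ℝ ι) 1 (volume : Measure ℝ)) (i : ι) :
    ∫ p, |f p i - g p i| ≤ ‖f - g‖ := by
  rw [L1.norm_eq_integral_norm]
  refine integral_mono_ae ((integrable_coord f i).sub (integrable_coord g i)).abs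
    (L1.integrable_coeFn (f - g)).norm ?_
  filter_upwards [Lp.coeFn_sub f g] with p hp
  rw [hp]
  exact PiLp.norm_apply_le (f p - g p) i

variable {u : ℝ → Lp (EuclideanSpace ℝ ι) 1 (volume : Measure ℝ)} {s : Set ℝ}

theorem continuousOn_integral_abs_coord (hu : ContinuousOn u s) (i : ι) :
    ContinuousOn (fun t => ∫ p, |u t p i|) s := by
  intro t ht
  rw [ContinuousWithinAt, tendsto_iff_dist_tendsto_zero]
  refine squeeze_zero (fun _ => dist_nonneg) (fun r => ?_)
    (tendsto_iff_norm_sub_tendsto_zero.1 (hu t ht))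
  refine le_trans ?_ (integral_abs_coord_sub_le (u r) (u t) i)
  rw [Real.dist_eq, ← integral_sub (integrable_coord _ i).abs (integrable_coord _ i).abs,
    ← Real.norm_eq_abs]
  exact norm_integral_le_of_norm_le ((integrable_coord _ i).sub (integrable_coord _ i)).abs
    (Eventually.of_forall fun p => abs_abs_sub_abs_le_abs_sub _ _)

variable {i : ι} {a : ℝ → ℝ} {a' D t : ℝ} {ψ : ℝ → ℝ}

theorem hasDerivWithinAt_integral_sub_mul_translate_sub (hψ : ContDiff ℝ ∞ ψ)
    (hs : HasCompactSupport ψ) (hu : ContinuousWithinAt u s t) (ha : HasDerivWithinAt a a' s t) :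
    HasDerivWithinAt (fun r => ∫ p, (u r p i - u t p i) * (ψ (p - a r) - ψ (p - a t))) 0 s t := by
  obtain ⟨M, hM⟩ := hs.deriv.exists_bound_of_continuous (hψ.continuous_deriv (by simp))
  have hM0 : 0 ≤ M := (norm_nonneg _).trans (hM 0)
  rw [hasDerivWithinAt_iff_isLittleO]
  simp only [sub_self, smul_zero, sub_zero, zero_mul, integral_zero]
  have hsmall : (fun r => ‖u r - u t‖) =o[𝓝[s] t] (fun _ => (1 : ℝ)) :=
    (Asymptotics.isLittleO_one_iff ℝ).2 (tendsto_iff_norm_sub_tendsto_zero.1 hu)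
  have hlip : (fun r => M * |a r - a t|) =O[𝓝[s] t] fun r => r - t :=
    (ha.hasFDerivWithinAt.isBigO_sub.norm_left).const_mul_left M
  have hprod := hsmall.mul_isBigO hlip
  simp only [one_mul] at hprod
  refine (Asymptotics.isBigO_of_le _ fun r => ?_).trans_isLittleO hprod
  have hnonneg : 0 ≤ M * |a r - a t| := by positivity
  have hpair := abs_integral_mul_le ((integrable_coord (u r) i).sub (integrable_coord (u t) i))
    fun p => show |ψ (p - a r) - ψ (p - a t)| ≤ M * |a r - a t| by
      simpa [abs_sub_comm] using
        abs_sub_le_of_abs_deriv_le (hψ.differentiable (by simp)) hM (p - a r) (p - a t)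
  rw [norm_mul, norm_norm, Real.norm_of_nonneg hnonneg, mul_comm]
  exact hpair.trans (mul_le_mul_of_nonneg_left (integral_abs_coord_sub_le _ _ i) hnonneg)

theorem hasDerivWithinAt_integral_mul_translate (hψ : ContDiff ℝ ∞ ψ)
    (hs : HasCompactSupport ψ) (hu : ContinuousWithinAt u s t) (ha : HasDerivWithinAt a a' s t)
    (hD : HasDerivWithinAt (fun r => ∫ p, u r p i * ψ (p - a t)) D s t) :
    HasDerivWithinAt (fun r => ∫ p, u r p i * ψ (p - a r))
      (D - a' * ∫ p, u t p i * deriv ψ (p - a t)) s t := by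
  obtain ⟨M, hM⟩ := hs.exists_bound_of_continuous hψ.continuous
  have hint (r b : ℝ) : Integrable fun p => u r p i * ψ (p - b) :=
    integrable_mul_of_abs_le (integrable_coord _ i) (hψ.continuous.comp (by fun_prop))
      fun p => hM _
  have hsub (r b : ℝ) : Integrable fun p => u r p i * ψ (p - b) - u t p i * ψ (p - b) :=
    (hint r b).sub (hint t b)
  have htranslate : HasDerivWithinAt (fun r => ∫ p, u t p i * ψ (p - a r))
      (-(∫ p, u t p i * deriv ψ (p - a t)) * a') s t :=
    (hasDerivAt_integral_mul_translate (integrable_coord (u t) i) hψ hs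
      (a t)).comp_hasDerivWithinAt t ha
  have hcross := hasDerivWithinAt_integral_sub_mul_translate_sub (i := i) hψ hs hu ha
  have hsplit (r : ℝ) : ∫ p, u r p i * ψ (p - a r)
      = ((∫ p, u r p i * ψ (p - a t)) + (∫ p, u t p i * ψ (p - a r))
        + ∫ p, (u r p i - u t p i) * (ψ (p - a r) - ψ (p - a t)))
        - ∫ p, u t p i * ψ (p - a t) := by
    simp only [sub_mul, mul_sub]
    rw [integral_sub (hsub r _) (hsub r _), integral_sub (hint r _) (hint t _),
      integral_sub (hint r _) (hint t _)]
    ring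
  exact ((((hD.add htranslate).add hcross).congr_deriv (by ring)).sub_const _).congr
    (fun r _ => hsplit r) (hsplit t)

end VectorValued

/-! ### Growth of weak solutions -/

/-- Weak solutions of `t ∂u/∂t + α(t) ∂u/∂p + C(t) u = h(t) g(p)` on `(0,T]`, tested in `p`, for a
diagonal transport matrix with diagonal `α`. -/
structure IsWeakSolution (C : ℝ → Matrix (Fin (n + 1)) (Fin (n + 1)) ℝ)
    (h : ℝ → Fin (n + 1) → ℝ) (α : Fin (n + 1) → ℝ → ℝ) (T : ℝ) (g : ℝ → ℝ)
    (u : ℝ → Lp (EuclideanSpace ℝ (Fin (n + 1))) 1 (volume : Measure ℝ)) : Prop where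
  continuousOn : ContinuousOn u (Ioc 0 T)
  weak : ∀ (i : Fin (n + 1)) (ψ : ℝ → ℝ), ContDiff ℝ ∞ ψ → HasCompactSupport ψ → ∀ t ∈ Ioc 0 T,
    HasDerivWithinAt (fun s => ∫ p, u s p i * ψ p)
      (t⁻¹ * (α i t * (∫ p, u t p i * deriv ψ p) - (∑ j, C t i j * ∫ p, u t p j * ψ p)
        + h t i * ∫ p, g p * ψ p)) (Ioc 0 T) t

theorem exists_characteristic {α : ℝ → ℝ} {T r : ℝ} (hα : ContinuousOn α (Ioc 0 T))
    (hr : r ∈ Ioc 0 T) :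
    ∃ a : ℝ → ℝ, a r = 0 ∧ ∀ t ∈ Ioc 0 T, HasDerivWithinAt a (t⁻¹ * α t) (Ioc 0 T) t := by
  set θ : ℝ → ℝ := fun τ => min (Real.exp τ) T with hθ
  have hθlog {t : ℝ} (ht : t ∈ Ioc 0 T) : θ (Real.log t) = t := by
    simpa only [hθ, Real.exp_log ht.1] using min_eq_left ht.2
  have hcont : Continuous (α ∘ θ) :=
    hα.comp_continuous (Real.continuous_exp.min continuous_const)
      fun τ => ⟨lt_min (Real.exp_pos τ) (hr.1.trans_le hr.2), min_le_right _ _⟩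
  refine ⟨fun t => ∫ τ in Real.log r..Real.log t, (α ∘ θ) τ, intervalIntegral.integral_same,
    fun t ht => ?_⟩
  have hlog := ((hcont.integral_hasStrictDerivAt (Real.log r) (Real.log t)).hasDerivAt.comp t
    (Real.hasDerivAt_log ht.1.ne')).hasDerivWithinAt (s := Ioc 0 T)
  exact hlog.congr_deriv (by rw [Function.comp_apply, hθlog ht, mul_comm])

theorem integral_rpow_mul_rpow_neg_le {c κ t T : ℝ} (hκ : 0 ≤ κ) (ht : t ∈ Ioc 0 T) :
    ∫ r in t..T, r ^ (c - 3 / 2) * (κ * r ^ (-c)) ≤ κ * (2 / √t) := by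
  have hpow : ∫ r in t..T, r ^ (c - 3 / 2) * (κ * r ^ (-c))
      = ∫ r in t..T, κ * r ^ (-(3 / 2) : ℝ) := by
    refine intervalIntegral.integral_congr fun r hr => ?_
    rw [uIcc_of_le ht.2] at hr
    rw [mul_left_comm, ← Real.rpow_add (ht.1.trans_le hr.1)]
    congr 2
    ring
  have hzero : (0 : ℝ) ∉ uIcc t T := by
    rw [uIcc_of_le ht.2]
    exact fun h0 => absurd h0.1 (not_le.2 ht.1)
  have hsqrt {r : ℝ} (hr : 0 < r) : r ^ (-(3 / 2) + 1 : ℝ) = 1 / √r := by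
    rw [show (-(3 / 2) + 1 : ℝ) = -(1 / 2) by norm_num, Real.rpow_neg hr.le,
      ← Real.sqrt_eq_rpow, one_div]
  rw [hpow, intervalIntegral.integral_const_mul,
    integral_rpow (Or.inr ⟨by norm_num, hzero⟩), hsqrt ht.1, hsqrt (ht.1.trans_le ht.2)]
  refine mul_le_mul_of_nonneg_left ?_ hκ
  have hT : 0 ≤ 2 * (1 / √T) := by positivity
  linarith [show (1 / √T - 1 / √t) / (-(3 / 2) + 1 : ℝ) = 2 / √t - 2 * (1 / √T) by ring]

theorem integral_rpow_mul_rpow_neg_add_const_le {c κ e t T : ℝ} (hc : 1 / 2 < c) (hκ : 0 ≤ κ)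
    (he : 0 ≤ e) (ht : t ∈ Ioc 0 T) :
    ∫ r in t..T, r ^ (c - 3 / 2) * (κ * r ^ (-c) + e)
      ≤ κ * (2 / √t) + T ^ (c - 1 / 2) / (c - 1 / 2) * e := by
  have hpow := continuousOn_rpow_Ioc (c - 3 / 2) T
  have hneg : IntervalIntegrable (fun r => r ^ (c - 3 / 2) * (κ * r ^ (-c))) volume t T :=
    intervalIntegrable_of_continuousOn_Ioc
      (hpow.mul (continuousOn_const.mul (continuousOn_rpow_Ioc (-c) T))) ht.1 ht.2 le_rfl
  have hconst : IntervalIntegrable (fun r => r ^ (c - 3 / 2) * e) volume t T :=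
    intervalIntegrable_of_continuousOn_Ioc (hpow.mul continuousOn_const) ht.1 ht.2 le_rfl
  simp only [mul_add]
  rw [intervalIntegral.integral_add hneg hconst]
  exact add_le_add (integral_rpow_mul_rpow_neg_le hκ ht) (integral_rpow_mul_const_le hc he ht)

namespace IsWeakSolution

variable {C : ℝ → Matrix (Fin (n + 1)) (Fin (n + 1)) ℝ} {h : ℝ → Fin (n + 1) → ℝ} {c T K : ℝ}
  {α : Fin (n + 1) → ℝ → ℝ} {g : ℝ → ℝ}
  {u : ℝ → Lp (EuclideanSpace ℝ (Fin (n + 1))) 1 (volume : Measure ℝ)} {ψ : ℝ → ℝ}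

theorem solvesRow_translate (hu : IsWeakSolution C h α T g u) (i : Fin (n + 1)) {a : ℝ → ℝ}
    (ha : ∀ t ∈ Ioc 0 T, HasDerivWithinAt a (t⁻¹ * α i t) (Ioc 0 T) t) (hψ : ContDiff ℝ ∞ ψ)
    (hs : HasCompactSupport ψ) :
    SolvesRow C T i (fun j t => ∫ p, u t p j * ψ (p - a t))
      fun t => h t i * ∫ p, g p * ψ (p - a t) := by
  intro t ht
  have hderiv : deriv (fun p => ψ (p - a t)) = fun p => deriv ψ (p - a t) :=
    funext fun p => deriv_comp_sub_const ψ (a t) p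
  have hweak := hu.weak i (fun p => ψ (p - a t)) (hψ.comp (contDiff_id.sub contDiff_const))
    (hs.comp_homeomorph (Homeomorph.subRight (a t))) t ht
  rw [hderiv] at hweak
  exact (hasDerivWithinAt_integral_mul_translate hψ hs (hu.continuousOn t ht) (ha t ht)
    hweak).congr_deriv (by ring)

/-- Tested along its own characteristic, each component obeys an ordinary differential equation. -/
theorem isMajorant_integral_abs (hu : IsWeakSolution C h α T g u) (H : RegularSingular C h c T K)
    (hα : ∀ i, ContinuousOn (α i) (Ioc 0 T)) (hg : Integrable g) :
    IsMajorant c T K (fun j t => ∫ p, |u t p j|) fun _ => K * (1 + T) * ∫ p, |g p| := by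
  set E := K * (1 + T) * ∫ p, |g p|
  have hU := continuousOn_integral_abs_coord hu.continuousOn
  have hpair {ψ : ℝ → ℝ} (hψ : ∀ p, |ψ p| ≤ 1) {f : ℝ → ℝ} (hf : Integrable f) (b : ℝ) :
      |∫ p, f p * ψ (p - b)| ≤ ∫ p, |f p| := by
    simpa only [one_mul] using abs_integral_mul_le hf fun p => hψ (p - b)
  have hforce {ψ : ℝ → ℝ} (hψ : ∀ p, |ψ p| ≤ 1) (a : ℝ → ℝ) (i : Fin (n + 1)) :
      ∀ t ∈ Ioc 0 T, |h t i * ∫ p, g p * ψ (p - a t)| ≤ E := fun t ht => by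
    rw [abs_mul]
    exact mul_le_mul (H.abs_h_le i ht) (hpair hψ hg _) (abs_nonneg _)
      ((abs_nonneg _).trans (H.abs_h_le i ht))
  refine ⟨hU, continuousOn_const, fun j t _ => integral_nonneg fun p => abs_nonneg _,
    fun t ht => (abs_nonneg _).trans (hforce (ψ := 0) (by simp) 0 0 t ht),
    fun i t ht => ?_, fun t ht => ?_⟩
  · obtain ⟨a, hat, ha⟩ := exists_characteristic (hα i.castSucc) ht
    refine integral_abs_le_of_forall_test (integrable_coord _ _) fun ψ hψ hs hψ1 => ?_
    have hrow := (hu.solvesRow_translate _ ha hψ hs).abs_castSucc_le H hU continuousOn_const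
      (fun j s _ => hpair hψ1 (integrable_coord (u s) j) (a s)) (hforce hψ1 a _) ht
    simp only [hat, sub_zero] at hrow
    exact hrow.trans (add_le_add_left (hpair hψ1 (integrable_coord _ _) _) _)
  · obtain ⟨a, hat, ha⟩ := exists_characteristic (hα (Fin.last n)) ht
    have hp := Real.rpow_pos_of_pos ht.1 c
    rw [mul_comm, ← le_div_iff₀ hp]
    refine integral_abs_le_of_forall_test (integrable_coord _ _) fun ψ hψ hs hψ1 => ?_
    have hrow := (hu.solvesRow_translate _ ha hψ hs).rpow_mul_abs_last_le H hU continuousOn_const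
      (fun j s _ => hpair hψ1 (integrable_coord (u s) j) (a s)) (hforce hψ1 a _) ht
    simp only [hat, sub_zero] at hrow
    rw [le_div_iff₀ hp, mul_comm]
    exact hrow.trans (add_le_add_left (mul_le_mul_of_nonneg_left
      (hpair hψ1 (integrable_coord _ _) _) (Real.rpow_nonneg H.T_pos.le _)) _)

theorem exists_integral_abs_le (hu : IsWeakSolution C h α T g u) (H : RegularSingular C h c T K)
    (hα : ∀ i, ContinuousOn (α i) (Ioc 0 T)) (hg : Integrable g) :
    ∃ B, ∀ i, ∀ t ∈ Ioc 0 T, ∫ p, |u t p i| ≤ B * t ^ (-c) := by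
  have hmaj := hu.isMajorant_integral_abs H hα hg
  obtain ⟨B, hB⟩ : ∃ B, ∀ t ∈ Ioc 0 T, weightedSize c (fun j t => ∫ p, |u t p j|) t ≤ B :=
    ⟨_, fun _ ht => hmaj.weightedSize_le_of_const H.K_nonneg (by linarith [H.one_lt]) ht⟩
  refine ⟨(1 + √T) * B, fun i t ht => ?_⟩
  rw [Real.rpow_neg ht.1.le, ← div_eq_mul_inv, le_div_iff₀ (Real.rpow_pos_of_pos ht.1 c), mul_comm]
  exact (rpow_mul_le_weightedSize (U := fun j t => ∫ p, |u t p j|) c ht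
    (fun j => hmaj.nonneg j t ht) i).trans (mul_le_mul_of_nonneg_left (hB t ht) (by positivity))

variable {G : ℝ} {x : ℝ → EuclideanSpace ℝ (Fin (n + 1))}

theorem solvesRow_integral_mul_sub (hu : IsWeakSolution C h α T g u) (hx : Solves C h T G x)
    (hψ : ContDiff ℝ ∞ ψ) (hs : HasCompactSupport ψ) (i : Fin (n + 1)) :
    SolvesRow C T i (fun j t => (∫ p, u t p j * ψ p) - x t j)
      fun t => α i t * (∫ p, u t p i * deriv ψ p) + h t i * ((∫ p, g p * ψ p) - G) := by
  intro t ht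
  refine ((hu.weak i ψ hψ hs t ht).sub (hx i t ht)).congr_deriv ?_
  simp only [mul_sub, Finset.sum_sub_distrib]
  ring

/-- When `ψ` is a flat cutoff, both error terms are small: the transport term through `L`, the
source term because `∫ g ψ` is close to `∫ g`. -/
theorem rpow_mul_abs_integral_mul_sub_le (hu : IsWeakSolution C h α T g u)
    (H : RegularSingular C h c T K) {M B L : ℝ} (hα : ∀ i, ∀ t ∈ Ioc 0 T, |α i t| ≤ M)
    (hB : ∀ i, ∀ t ∈ Ioc 0 T, ∫ p, |u t p i| ≤ B * t ^ (-c)) (hx : Solves C h T G x)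
    (hψ : ContDiff ℝ ∞ ψ) (hs : HasCompactSupport ψ) (hL : ∀ p, |deriv ψ p| ≤ L) {t : ℝ}
    (ht : t ∈ Ioc 0 T) :
    t ^ c * |(∫ p, u t p (Fin.last n) * ψ p) - x t (Fin.last n)|
      ≤ (1 + √T) * ((weightedSize c (fun j r => |(∫ p, u r p j * ψ p) - x r j|) T
        + rateFactor n T * (M * (L * B) * (2 / √t)
          + T ^ (c - 1 / 2) / (c - 1 / 2) * (K * (1 + T) * |(∫ p, g p * ψ p) - G|)))
        * growthFactor n T K) := by
  have hTmem : T ∈ Ioc 0 T := ⟨H.T_pos, le_rfl⟩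
  have hM := (abs_nonneg _).trans (hα 0 T hTmem)
  have hL0 := (abs_nonneg _).trans (hL 0)
  have hB0 : 0 ≤ B := nonneg_of_mul_nonneg_left
    ((integral_nonneg fun p => abs_nonneg _).trans (hB 0 T hTmem))
    (Real.rpow_pos_of_pos H.T_pos _)
  have hc := H.one_lt
  set e := K * (1 + T) * |(∫ p, g p * ψ p) - G|
  have he0 : 0 ≤ e :=
    mul_nonneg ((abs_nonneg _).trans (H.abs_h_le 0 hTmem)) (abs_nonneg _)
  have hforce (i : Fin (n + 1)) : ∀ r ∈ Ioc 0 T,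
      |α i r * (∫ p, u r p i * deriv ψ p) + h r i * ((∫ p, g p * ψ p) - G)|
        ≤ M * (L * B) * r ^ (-c) + e := fun r hr => by
    refine (abs_add_le _ _).trans (add_le_add ?_ ?_)
    · rw [abs_mul, mul_assoc, mul_assoc]
      exact mul_le_mul (hα i r hr) ((abs_integral_mul_le (integrable_coord (u r) i) hL).trans
        (mul_le_mul_of_nonneg_left (hB i r hr) hL0)) (abs_nonneg _) hM
    · rw [abs_mul]
      exact mul_le_mul_of_nonneg_right (H.abs_h_le i hr) (abs_nonneg _)
  have hmaj := H.isMajorant_abs (E := fun r => M * (L * B) * r ^ (-c) + e)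
    (fun i => hu.solvesRow_integral_mul_sub hx hψ hs i)
    ((continuousOn_const.mul (continuousOn_rpow_Ioc _ T)).add continuousOn_const) hforce
  have hint := integral_rpow_mul_rpow_neg_add_const_le (c := c) (κ := M * (L * B)) (by linarith)
    (by positivity) he0 ht
  have hrate := rateFactor_pos n T
  have hgrow := growthFactor_pos n T K
  refine (rpow_mul_le_weightedSize (U := fun j r => |(∫ p, u r p j * ψ p) - x r j|) c ht
    (fun j => abs_nonneg _) (Fin.last n)).trans (mul_le_mul_of_nonneg_left
      ((hmaj.weightedSize_le H.K_nonneg (by linarith) ht).trans ?_) (by positivity))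
  gcongr

end IsWeakSolution

/-! ### Localised averages and blow-up -/

theorem ofReal_setIntegral_norm_le_eLpNorm_mul {X E : Type*} [MeasurableSpace X]
    {μ : Measure X} [NormedAddCommGroup E] {f : X → E} {s : Set X} (hf : IntegrableOn f s μ)
    (hs : 1 ≤ μ s) {r : ENNReal} (hr : 1 ≤ r) :
    ENNReal.ofReal (∫ p in s, ‖f p‖ ∂μ) ≤ eLpNorm f r μ * μ s := by
  rw [ofReal_integral_norm_eq_lintegral_enorm hf, ← eLpNorm_one_eq_lintegral_enorm]
  refine (eLpNorm_le_eLpNorm_mul_rpow_measure_univ hr hf.aestronglyMeasurable).trans ?_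
  refine mul_le_mul' (eLpNorm_restrict_le _ _ _ _) ?_
  rw [Measure.restrict_apply_univ]
  refine (ENNReal.rpow_le_rpow_of_exponent_le hs ?_).trans_eq (ENNReal.rpow_one _)
  simp only [ENNReal.toReal_one, div_one]
  linarith [show 0 ≤ 1 / r.toReal by positivity]

/-- A bump function equal to `1` on `[-1, 1]` and to `0` outside `(-2, 2)`. -/
def unitBump : ContDiffBump (0 : ℝ) := ⟨1, 2, one_pos, one_lt_two⟩

/-- The cutoff at length scale `1 / s`: it is `1` where `|p| ≤ 1 / s` and `0` where
`2 / s ≤ |p|`. -/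
def cutoff (s p : ℝ) : ℝ := unitBump (s * p)

theorem contDiff_cutoff (s : ℝ) : ContDiff ℝ ∞ (cutoff s) :=
  unitBump.contDiff.comp (contDiff_const.mul contDiff_id)

theorem hasCompactSupport_cutoff {s : ℝ} (hs : s ≠ 0) : HasCompactSupport (cutoff s) :=
  unitBump.hasCompactSupport.comp_homeomorph (Homeomorph.mulLeft₀ s hs)

theorem abs_cutoff_le_one (s p : ℝ) : |cutoff s p| ≤ 1 :=
  (abs_of_nonneg unitBump.nonneg).trans_le unitBump.le_one

theorem cutoff_eq_zero {s p : ℝ} (hsp : 2 ≤ |s * p|) : cutoff s p = 0 :=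
  unitBump.zero_of_le_dist (by simpa [unitBump] using hsp)

theorem exists_abs_deriv_cutoff_le : ∃ L, ∀ s, 0 < s → ∀ p, |deriv (cutoff s) p| ≤ s * L := by
  obtain ⟨L, hL⟩ := unitBump.hasCompactSupport.deriv.exists_bound_of_continuous
    (unitBump.contDiff.continuous_deriv (n := ∞) (by simp))
  refine ⟨L, fun s hs p => ?_⟩
  have hderiv : deriv (cutoff s) p = s * deriv unitBump (s * p) :=
    deriv_comp_mul_left s unitBump p
  rw [hderiv, abs_mul, abs_of_pos hs]
  exact mul_le_mul_of_nonneg_left (hL _) hs.le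

theorem tendsto_integral_mul_cutoff {f : ℝ → ℝ} (hf : Integrable f) :
    Tendsto (fun s => ∫ p, f p * cutoff s p) (𝓝[>] 0) (𝓝 (∫ p, f p)) := by
  refine tendsto_integral_filter_of_dominated_convergence (fun p => |f p|)
    (Eventually.of_forall fun s => hf.aestronglyMeasurable.mul
      (contDiff_cutoff s).continuous.aestronglyMeasurable)
    (Eventually.of_forall fun s => Eventually.of_forall fun p => ?_) hf.abs
    (Eventually.of_forall fun p => ?_)
  · rw [norm_mul]
    exact mul_le_of_le_one_right (norm_nonneg _) (abs_cutoff_le_one s p)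
  · have hcont : Continuous fun s => f p * cutoff s p :=
      continuous_const.mul (unitBump.continuous.comp (by fun_prop))
    have hone : cutoff 0 p = 1 := by
      rw [cutoff, zero_mul]
      exact unitBump.one_of_mem_closedBall (by simp [unitBump])
    have htendsto := hcont.tendsto 0
    rw [hone, mul_one] at htendsto
    exact htendsto.mono_left nhdsWithin_le_nhds

section VectorValued

variable {ι : Type*} [Fintype ι]

theorem abs_integral_mul_cutoff_le (f : Lp (EuclideanSpace ℝ ι) 1 (volume : Measure ℝ)) (i : ι)
    {s : ℝ} (hs : 0 < s) :
    |∫ p, f p i * cutoff s p| ≤ ∫ p in Icc (-(2 / s)) (2 / s), ‖f p‖ := by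
  rw [← integral_indicator measurableSet_Icc, ← Real.norm_eq_abs]
  refine norm_integral_le_of_norm_le ((L1.integrable_coeFn f).norm.indicator measurableSet_Icc)
    (Eventually.of_forall fun p => ?_)
  by_cases hp : p ∈ Icc (-(2 / s)) (2 / s)
  · rw [indicator_of_mem hp, norm_mul]
    exact (mul_le_of_le_one_right (norm_nonneg _) (abs_cutoff_le_one s p)).trans
      (PiLp.norm_apply_le (f p) i)
  · have hfar : 2 / s < |p| := not_le.1 fun hle => hp (abs_le.1 hle)
    rw [div_lt_iff₀' hs] at hfar
    rw [indicator_of_notMem hp, cutoff_eq_zero, mul_zero, norm_zero]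
    rw [abs_mul, abs_of_pos hs]
    exact hfar.le

theorem ofReal_abs_integral_mul_cutoff_le_eLpNorm
    (f : Lp (EuclideanSpace ℝ ι) 1 (volume : Measure ℝ)) (i : ι) {s : ℝ} (hs : s ∈ Ioc 0 4)
    {r : ENNReal} (hr : 1 ≤ r) :
    ENNReal.ofReal (s / 4 * |∫ p, f p i * cutoff s p|) ≤ eLpNorm f r volume := by
  have hs0 := hs.1
  have hvol : volume (Icc (-(2 / s)) (2 / s)) = ENNReal.ofReal (4 / s) := by
    rw [Real.volume_Icc]
    congr 1
    ring
  have hvol1 : 1 ≤ volume (Icc (-(2 / s)) (2 / s)) := by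
    rw [hvol]
    exact ENNReal.one_le_ofReal.2 ((one_le_div hs.1).2 hs.2)
  have hle := (ENNReal.ofReal_le_ofReal (abs_integral_mul_cutoff_le f i hs.1)).trans
    (ofReal_setIntegral_norm_le_eLpNorm_mul (L1.integrable_coeFn f).integrableOn hvol1 hr)
  have hpos : ENNReal.ofReal (4 / s) ≠ 0 := (ENNReal.ofReal_pos.2 (by positivity)).ne'
  rw [hvol, ← ENNReal.div_le_iff hpos ENNReal.ofReal_ne_top,
    ← ENNReal.ofReal_div_of_pos (by positivity)] at hle
  rwa [show s / 4 * |∫ p, f p i * cutoff s p| = |∫ p, f p i * cutoff s p| / (4 / s) by field_simp]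

end VectorValued

theorem tendsto_mul_abs_atTop_of_tendsto_rpow_mul {m : ℝ → ℝ} {c d : ℝ} (hc : 1 < c) (hd : d ≠ 0)
    (hm : Tendsto (fun t => t ^ c * m t) (𝓝[>] 0) (𝓝 d)) :
    Tendsto (fun t => t * |m t|) (𝓝[>] 0) atTop := by
  refine (hm.abs.pos_mul_atTop (abs_pos.2 hd)
    (tendsto_rpow_neg_nhdsGT_zero (y := -(c - 1)) (by linarith))).congr' ?_
  filter_upwards [self_mem_nhdsWithin] with t (ht : 0 < t)
  have hpow : t ^ c * t ^ (-(c - 1)) = t := by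
    rw [← Real.rpow_add ht, show c + -(c - 1) = 1 by ring, Real.rpow_one]
  rw [abs_mul, abs_of_pos (Real.rpow_pos_of_pos ht c), mul_right_comm, hpow]

namespace IsWeakSolution

variable {C : ℝ → Matrix (Fin (n + 1)) (Fin (n + 1)) ℝ} {h : ℝ → Fin (n + 1) → ℝ}
  {c T K M : ℝ} {α : Fin (n + 1) → ℝ → ℝ} {g : ℝ → ℝ}
  {u : ℝ → Lp (EuclideanSpace ℝ (Fin (n + 1))) 1 (volume : Measure ℝ)}
  {x : ℝ → EuclideanSpace ℝ (Fin (n + 1))}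

/-- At time `t` the average is taken over the length scale `1 / t`, large enough to catch the whole
of `u` in the limit and small enough to be visible to every `Lʳ` norm, since `1 < c`. -/
theorem tendsto_rpow_mul_integral_mul_cutoff_sub (hu : IsWeakSolution C h α T g u)
    (H : RegularSingular C h c T K) (hα : ∀ i, ContinuousOn (α i) (Ioc 0 T))
    (hαM : ∀ i, ∀ t ∈ Ioc 0 T, |α i t| ≤ M) (hg : Integrable g)
    (hx : Solves C h T (∫ p, g p) x) (hxT : ∀ i, x T i = ∫ p, u T p i) :
    Tendsto (fun t => t ^ c * ((∫ p, u t p (Fin.last n) * cutoff t p) - x t (Fin.last n)))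
      (𝓝[>] 0) (𝓝 0) := by
  obtain ⟨L, hL⟩ := exists_abs_deriv_cutoff_le
  obtain ⟨B, hB⟩ := hu.exists_integral_abs_le H hα hg
  have hinitial (j : Fin (n + 1)) :
      Tendsto (fun s => |(∫ p, u T p j * cutoff s p) - x T j|) (𝓝[>] 0) (𝓝 0) := by
    simpa [hxT] using ((tendsto_integral_mul_cutoff (integrable_coord (u T) j)).sub_const
      (x T j)).abs
  have hsize : Tendsto (fun s => weightedSize c
      (fun j r => |(∫ p, u r p j * cutoff s p) - x r j|) T) (𝓝[>] 0) (𝓝 0) := by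
    simpa [weightedSize] using ((hinitial (Fin.last n)).const_mul (T ^ c)).add
      ((tendsto_finsetSum Finset.univ fun (j : Fin n) _ => hinitial j.castSucc).const_mul
        (T ^ (c - 1 / 2)))
  have hsource : Tendsto (fun s => |(∫ p, g p * cutoff s p) - ∫ p, g p|) (𝓝[>] 0) (𝓝 0) := by
    simpa using ((tendsto_integral_mul_cutoff hg).sub_const (∫ p, g p)).abs
  have htransport : Tendsto (fun s => M * (s * L * B) * (2 / √s)) (𝓝[>] 0) (𝓝 0) := by
    have hcont : Continuous fun s => 2 * M * L * B * √s := by fun_prop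
    have hzero := (hcont.tendsto 0).mono_left (nhdsWithin_le_nhds (s := Ioi 0))
    rw [Real.sqrt_zero, mul_zero] at hzero
    refine hzero.congr' ?_
    filter_upwards [self_mem_nhdsWithin] with s (hs : 0 < s)
    have hroot := (Real.sqrt_pos.2 hs).ne'
    nth_rewrite 2 [← Real.sq_sqrt hs.le]
    field_simp [hroot]
  have hbound := ((hsize.add ((htransport.add ((hsource.const_mul (K * (1 + T))).const_mul
    (T ^ (c - 1 / 2) / (c - 1 / 2)))).const_mul (rateFactor n T))).mul_const
      (growthFactor n T K)).const_mul (1 + √T)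
  simp only [mul_zero, add_zero, zero_mul] at hbound
  refine squeeze_zero_norm' ?_ hbound
  filter_upwards [Ioc_mem_nhdsGT H.T_pos] with t ht
  rw [norm_mul, Real.norm_of_nonneg (Real.rpow_nonneg ht.1.le _), Real.norm_eq_abs]
  exact hu.rpow_mul_abs_integral_mul_sub_le H hαM hB hx (contDiff_cutoff t)
    (hasCompactSupport_cutoff ht.1.ne') (hL t ht.1) ht

theorem tendsto_eLpNorm_top (hu : IsWeakSolution C h α T g u) (H : RegularSingular C h c T K)
    (hα : ∀ i, ContinuousOn (α i) (Ioc 0 T)) (hαM : ∀ i, ∀ t ∈ Ioc 0 T, |α i t| ≤ M)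
    (hg : Integrable g) (hx : Solves C h T (∫ p, g p) x) (hxT : ∀ i, x T i = ∫ p, u T p i) {d : ℝ}
    (hd : d ≠ 0) (hxd : Tendsto (fun t => t ^ c * x t (Fin.last n)) (𝓝[>] 0) (𝓝 d))
    {r : ENNReal} (hr : 1 ≤ r) :
    Tendsto (fun t => eLpNorm (u t) r volume) (𝓝[>] 0) (𝓝 ⊤) := by
  have haverage : Tendsto (fun t => t ^ c * ∫ p, u t p (Fin.last n) * cutoff t p) (𝓝[>] 0)
      (𝓝 d) := by
    have hadd := (hu.tendsto_rpow_mul_integral_mul_cutoff_sub H hα hαM hg hx hxT).add hxd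
    rw [zero_add] at hadd
    exact hadd.congr fun t => by ring
  have hbig := (tendsto_mul_abs_atTop_of_tendsto_rpow_mul H.one_lt hd haverage).atTop_mul_const
    (show (0 : ℝ) < 1 / 4 by norm_num)
  refine tendsto_nhds_top_mono (ENNReal.tendsto_ofReal_atTop.comp hbig) ?_
  filter_upwards [Ioc_mem_nhdsGT (show (0 : ℝ) < 4 by norm_num)] with t ht
  refine le_of_eq_of_le ?_
    (ofReal_abs_integral_mul_cutoff_le_eLpNorm (u t) (Fin.last n) ht hr)
  rw [Function.comp_apply, mul_right_comm, mul_one_div]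

end IsWeakSolution

/-! ### The Cauchy horizon -/

section Profile

variable {a z : ℝ}

theorem hasDerivAt_const_mul_rpow (hz : 0 < 1 + a * z) (k p : ℝ) :
    HasDerivAt (fun z => k * (1 + a * z) ^ p) (k * (p * a) * (1 + a * z) ^ (p - 1)) z := by
  have hlin : HasDerivAt (fun z : ℝ => 1 + a * z) a z := by
    simpa using ((hasDerivAt_id z).const_mul a).const_add 1
  exact ((hlin.rpow_const (p := p) (Or.inl hz.ne')).const_mul k).congr_deriv (by ring)

theorem eventually_one_add_mul_pos (hz : 0 < 1 + a * z) : ∀ᶠ w in 𝓝 z, 0 < 1 + a * w :=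
  (show Continuous fun w : ℝ => 1 + a * w by fun_prop).continuousAt.eventually (lt_mem_nhds hz)

theorem hasDerivAt_S (hz : 0 < 1 + a * z) :
    HasDerivAt (S a) (2 * a / 3 * (1 + a * z) ^ (-(1 / 3) : ℝ)) z := by
  have hpow := hasDerivAt_const_mul_rpow hz 1 (2 / 3)
  simp only [one_mul] at hpow
  refine hpow.congr_deriv ?_
  rw [show (2 / 3 - 1 : ℝ) = -(1 / 3) by norm_num]
  ring

theorem S1_eq (hz : 0 < 1 + a * z) :
    S1 a z = 2 * a / 3 * (1 + a * z) ^ (-(1 / 3) : ℝ) := (hasDerivAt_S hz).deriv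

theorem hasDerivAt_S1 (hz : 0 < 1 + a * z) :
    HasDerivAt (S1 a) (-(2 * a ^ 2 / 9) * (1 + a * z) ^ (-(4 / 3) : ℝ)) z := by
  refine ((hasDerivAt_const_mul_rpow hz (2 * a / 3) (-(1 / 3))).congr_of_eventuallyEq
    ((eventually_one_add_mul_pos hz).mono fun w hw => S1_eq hw)).congr_deriv ?_
  rw [show (-(1 / 3) - 1 : ℝ) = -(4 / 3) by norm_num]
  ring

theorem S2_eq (hz : 0 < 1 + a * z) :
    S2 a z = -(2 * a ^ 2 / 9) * (1 + a * z) ^ (-(4 / 3) : ℝ) := by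
  rw [S2, iteratedDeriv_succ, iteratedDeriv_one]
  exact (hasDerivAt_S1 hz).deriv

theorem hasDerivAt_S2 (hz : 0 < 1 + a * z) :
    HasDerivAt (S2 a) (8 * a ^ 3 / 27 * (1 + a * z) ^ (-(7 / 3) : ℝ)) z := by
  refine ((hasDerivAt_const_mul_rpow hz (-(2 * a ^ 2 / 9)) (-(4 / 3))).congr_of_eventuallyEq
    ((eventually_one_add_mul_pos hz).mono fun w hw => S2_eq hw)).congr_deriv ?_
  rw [show (-(4 / 3) - 1 : ℝ) = -(7 / 3) by norm_num]
  ring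

theorem S3_eq (hz : 0 < 1 + a * z) :
    S3 a z = 8 * a ^ 3 / 27 * (1 + a * z) ^ (-(7 / 3) : ℝ) := by
  rw [S3, iteratedDeriv_succ]
  exact (hasDerivAt_S2 hz).deriv

theorem continuousAt_S3 (hz : 0 < 1 + a * z) : ContinuousAt (S3 a) z :=
  (hasDerivAt_const_mul_rpow hz (8 * a ^ 3 / 27) (-(7 / 3))).continuousAt.congr
    ((eventually_one_add_mul_pos hz).mono fun _ hw => (S3_eq hw).symm)

theorem S_pos (hz : 0 < 1 + a * z) : 0 < S a z := Real.rpow_pos_of_pos hz _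

theorem S1_pos (ha : 0 < a) (hz : 0 < 1 + a * z) : 0 < S1 a z := by
  rw [S1_eq hz]
  have := Real.rpow_pos_of_pos hz (-(1 / 3))
  positivity

theorem S2_neg (ha : 0 < a) (hz : 0 < 1 + a * z) : S2 a z < 0 := by
  rw [S2_eq hz, neg_mul, neg_lt_zero]
  have := Real.rpow_pos_of_pos hz (-(4 / 3))
  positivity

theorem q_denominator_pos (hz : 0 < 1 + a * z) : 0 < 3 + 4 * a * z + a ^ 2 * z ^ 2 := by
  nlinarith

theorem q_pos (ha : 0 < a) (hz : 0 < 1 + a * z) : 0 < q a z := by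
  have := q_denominator_pos hz
  unfold q
  positivity

theorem contDiffAt_q (hz : 0 < 1 + a * z) : ContDiffAt ℝ 2 (q a) z := by
  have := q_denominator_pos hz
  have := Real.pi_pos
  exact contDiffAt_const.div (by fun_prop) (by positivity)

theorem continuousAt_dq (hz : 0 < 1 + a * z) : ContinuousAt (dq a) z :=
  ((contDiffAt_q hz).derivWithin (m := 1) (by norm_num)).continuousAt

end Profile

/-- The function `z + S - z S'`, whose largest root is the Cauchy horizon. -/
def horizonFn (a z : ℝ) : ℝ := z + S a z - z * S1 a z

theorem hasDerivAt_horizonFn {a z : ℝ} (hz : 0 < 1 + a * z) :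
    HasDerivAt (horizonFn a) (1 - z * S2 a z) z := by
  refine (((hasDerivAt_id z).add (hasDerivAt_S hz)).sub
    ((hasDerivAt_id z).mul (hasDerivAt_S1 hz))).congr_deriv ?_
  rw [S2_eq hz, S1_eq hz, id]
  ring

theorem analyticAt_horizonFn {a z : ℝ} (hz : 0 < 1 + a * z) : AnalyticAt ℝ (horizonFn a) z := by
  have hlin : AnalyticAt ℝ (fun w : ℝ => 1 + a * w) z := by fun_prop
  have hpow : ∀ p : ℝ, AnalyticAt ℝ (fun w : ℝ => (1 + a * w) ^ p) z := fun p =>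
    (hlin.contDiffAt.rpow_const_of_ne (n := ω) hz.ne').analyticAt
  refine ((analyticAt_id.add (hpow (2 / 3))).sub (analyticAt_id.mul
    ((analyticAt_const (v := 2 * a / 3)).mul (hpow (-(1 / 3)))))).congr ?_
  filter_upwards [eventually_one_add_mul_pos hz] with w hw
  rw [horizonFn, S1_eq hw, S]
  rfl

section DoubleRoot

variable {a y z : ℝ}

theorem pow_three_rpow (hy : 0 < y) (p : ℝ) : (y ^ 3) ^ p = y ^ (3 * p) := by
  rw [← Real.rpow_natCast, ← Real.rpow_mul hy.le, Nat.cast_ofNat]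

theorem S_eq_sq (hy : 0 < y) (hyz : y ^ 3 = 1 + a * z) : S a z = y ^ 2 := by
  rw [S, ← hyz, pow_three_rpow hy, ← Real.rpow_natCast]
  norm_num

theorem S1_eq_div (hy : 0 < y) (hyz : y ^ 3 = 1 + a * z) : S1 a z = 2 * a / (3 * y) := by
  have hpow : (y ^ 3) ^ (-(1 / 3) : ℝ) = y⁻¹ := by
    rw [pow_three_rpow hy, ← Real.rpow_neg_one]
    norm_num
  rw [S1_eq (hyz ▸ by positivity), ← hyz, hpow]
  field_simp

theorem S2_eq_neg_div (hy : 0 < y) (hyz : y ^ 3 = 1 + a * z) :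
    S2 a z = -(2 * a ^ 2 / (9 * y ^ 4)) := by
  have hpow : (y ^ 3) ^ (-(4 / 3) : ℝ) = (y ^ 4)⁻¹ := by
    rw [pow_three_rpow hy, ← Real.rpow_natCast, ← Real.rpow_neg hy.le]
    norm_num
  rw [S2_eq (hyz ▸ by positivity), ← hyz, hpow]
  field_simp

theorem horizonFn_eq_zero_iff (hy : 0 < y) (ha : 0 < a) (hyz : y ^ 3 = 1 + a * z) :
    horizonFn a z = 0 ↔ 3 * y * (y ^ 3 - 1) + a * (y ^ 3 + 2) = 0 := by
  have hmul : 3 * y * (y ^ 3 - 1) + a * (y ^ 3 + 2) = 3 * a * y * horizonFn a z := by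
    rw [horizonFn, S_eq_sq hy hyz, S1_eq_div hy hyz]
    field_simp
    linear_combination (3 * y - 2 * a) * hyz
  rw [hmul, mul_eq_zero_iff_left (by positivity)]

theorem one_sub_mul_S2_eq_zero_iff (hy : 0 < y) (hyz : y ^ 3 = 1 + a * z) :
    1 - z * S2 a z = 0 ↔ 9 * y ^ 4 + 2 * a * (y ^ 3 - 1) = 0 := by
  have hmul : 9 * y ^ 4 + 2 * a * (y ^ 3 - 1) = 9 * y ^ 4 * (1 - z * S2 a z) := by
    rw [S2_eq_neg_div hy hyz]
    field_simp
    linear_combination (2 * a) * hyz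
  rw [hmul, mul_eq_zero_iff_left (by positivity)]

theorem pow_three_eq_of_double_root (hy : 0 < y)
    (hroot : 3 * y * (y ^ 3 - 1) + a * (y ^ 3 + 2) = 0)
    (hderiv : 9 * y ^ 4 + 2 * a * (y ^ 3 - 1) = 0) : y ^ 3 = 3 * √3 - 5 := by
  have hsq : √3 ^ 2 = 3 := Real.sq_sqrt (by norm_num)
  have hfactor : 3 * y * (y ^ 3 + 5 + 3 * √3) * (y ^ 3 - (3 * √3 - 5)) = 0 := by
    linear_combination (y ^ 3 + 2) * hderiv - 2 * (y ^ 3 - 1) * hroot - 27 * y * hsq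
  exact sub_eq_zero.1 ((mul_eq_zero_iff_left (by positivity)).1 hfactor)

theorem pow_three_mul_of_double_root (hy : 0 < y)
    (hroot : 3 * y * (y ^ 3 - 1) + a * (y ^ 3 + 2) = 0)
    (hderiv : 9 * y ^ 4 + 2 * a * (y ^ 3 - 1) = 0) : a ^ 3 * (2 * (26 + 15 * √3)) = 27 := by
  have hsq : √3 ^ 2 = 3 := Real.sq_sqrt (by norm_num)
  have hy3 := pow_three_eq_of_double_root hy hroot hderiv
  have hcube : a ^ 3 * (y ^ 3 + 2) ^ 3 = 27 * y ^ 3 * (1 - y ^ 3) ^ 3 := by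
    calc a ^ 3 * (y ^ 3 + 2) ^ 3 = (a * (y ^ 3 + 2)) ^ 3 := by ring
      _ = (3 * y * (1 - y ^ 3)) ^ 3 := by congr 1; linarith
      _ = 27 * y ^ 3 * (1 - y ^ 3) ^ 3 := by ring
  have hadd : (y ^ 3 + 2) ^ 3 = 54 * y ^ 3 := by
    rw [hy3]
    linear_combination (27 * √3 - 81) * hsq
  have hsub : (1 - y ^ 3) ^ 3 * (26 + 15 * √3) = 27 := by
    rw [hy3]
    linear_combination (-405 * √3 ^ 2 + 1728 * √3 - 1863) * hsq
  rw [hadd] at hcube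
  refine mul_left_cancel₀ (pow_pos hy 3).ne' ?_
  linear_combination ((26 + 15 * √3) / 27) * hcube + y ^ 3 * hsub

theorem aStar_pow_three_mul : aStar ^ 3 * (2 * (26 + 15 * √3)) = 27 := by
  have hpos : 0 < 2 * (26 + 15 * √3) := by positivity
  rw [aStar, div_pow, ← Real.rpow_natCast (_ ^ (1 / 3 : ℝ)), ← Real.rpow_mul hpos.le]
  norm_num
  field_simp

theorem one_sub_mul_S2_ne_zero (ha : 0 < a) (ha' : a < aStar) (hz : 0 < 1 + a * z)
    (hroot : horizonFn a z = 0) : 1 - z * S2 a z ≠ 0 := by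
  intro hderiv
  obtain ⟨y, hy, hyz⟩ : ∃ y : ℝ, 0 < y ∧ y ^ 3 = 1 + a * z := by
    refine ⟨(1 + a * z) ^ (1 / 3 : ℝ), by positivity, ?_⟩
    rw [← Real.rpow_natCast, ← Real.rpow_mul hz.le]
    norm_num
  have hcritical := pow_three_mul_of_double_root hy ((horizonFn_eq_zero_iff hy ha hyz).1 hroot)
    ((one_sub_mul_S2_eq_zero_iff hy hyz).1 hderiv)
  refine (pow_lt_pow_left₀ ha' ha.le three_ne_zero).ne (mul_right_cancel₀ ?_
    (hcritical.trans aStar_pow_three_mul.symm))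
  positivity

end DoubleRoot

/-- The function `(z + S - z S') / (z - zc)`, extended to the Cauchy horizon `z = zc`. -/
def horizonSlope (a zc z : ℝ) : ℝ := dslope (horizonFn a) zc z

namespace IsCauchyHorizon

variable {a zc z : ℝ}

theorem one_add_mul_pos (ha : 0 < a) (hzc : IsCauchyHorizon a zc) (hz : zc ≤ z) :
    0 < 1 + a * z := by
  have hmem := hzc.1.1
  rw [div_lt_iff₀ ha] at hmem
  nlinarith

theorem horizonFn_eq_zero (hzc : IsCauchyHorizon a zc) : horizonFn a zc = 0 := hzc.1.2

theorem horizonFn_pos (ha : 0 < a) (hzc : IsCauchyHorizon a zc) (hz : zc < z) (hz0 : z ≤ 0) :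
    0 < horizonFn a z := by
  by_contra! hneg
  have hpos : ∀ w ∈ Icc z 0, 0 < 1 + a * w := fun w hw =>
    hzc.one_add_mul_pos ha (hz.le.trans hw.1)
  have hcont : ContinuousOn (horizonFn a) (Icc z 0) := fun w hw =>
    (hasDerivAt_horizonFn (hpos w hw)).continuousAt.continuousWithinAt
  have hzero : 0 ≤ horizonFn a 0 := by simp [horizonFn, S]
  obtain ⟨w, hw, hw0⟩ := intermediate_value_Icc hz0 hcont ⟨hneg, hzero⟩
  have hmem : -1 / a < w := by
    rw [div_lt_iff₀ ha]
    linarith [hpos w hw]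
  exact (hz.trans_le hw.1).not_ge (hzc.2 ⟨hmem, hw0⟩)

theorem horizonFn_eq_mul (hzc : IsCauchyHorizon a zc) (t : ℝ) :
    horizonFn a (zc + t) = t * horizonSlope a zc (zc + t) := by
  simpa [horizonSlope] using (sub_smul_dslope_of_zero hzc.horizonFn_eq_zero (zc + t)).symm

theorem horizonSlope_self (ha : 0 < a) (hzc : IsCauchyHorizon a zc) :
    horizonSlope a zc zc = 1 - zc * S2 a zc := by
  rw [horizonSlope, dslope_same, (hasDerivAt_horizonFn (hzc.one_add_mul_pos ha le_rfl)).deriv]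

theorem differentiableAt_horizonSlope (ha : 0 < a) (hzc : IsCauchyHorizon a zc) :
    DifferentiableAt ℝ (horizonSlope a zc) zc := by
  obtain ⟨p, hp⟩ := analyticAt_horizonFn (hzc.one_add_mul_pos ha le_rfl)
  exact hp.has_fpower_series_dslope_fslope.analyticAt.differentiableAt

theorem continuousAt_horizonSlope (ha : 0 < a) (hzc : IsCauchyHorizon a zc) (hz : zc ≤ z) :
    ContinuousAt (horizonSlope a zc) z := by
  rcases eq_or_lt_of_le hz with rfl | hlt
  · exact (differentiableAt_horizonSlope ha hzc).continuousAt
  · exact (continuousAt_dslope_of_ne hlt.ne').2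
      (hasDerivAt_horizonFn (hzc.one_add_mul_pos ha hz)).continuousAt

theorem horizonSlope_pos_of_lt (ha : 0 < a) (hzc : IsCauchyHorizon a zc) (hz : zc < z)
    (hz0 : z ≤ 0) : 0 < horizonSlope a zc z := by
  have hmul := hzc.horizonFn_eq_mul (z - zc)
  rw [add_sub_cancel] at hmul
  exact pos_of_mul_pos_right (hmul ▸ hzc.horizonFn_pos ha hz hz0) (sub_pos.2 hz).le

theorem horizonSlope_pos (ha : 0 < a) (ha' : a < aStar) (hzc : IsCauchyHorizon a zc)
    (hz : zc ≤ z) (hz0 : z < 0) : 0 < horizonSlope a zc z := by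
  rcases eq_or_lt_of_le hz with rfl | hlt
  · refine lt_of_le_of_ne ?_ ?_
    · refine ge_of_tendsto ((continuousAt_horizonSlope ha hzc le_rfl).tendsto.mono_left
        (nhdsWithin_le_nhds (s := Ioi zc))) ?_
      filter_upwards [Ioc_mem_nhdsGT hz0] with w hw
      exact (horizonSlope_pos_of_lt ha hzc hw.1 hw.2).le
    · rw [horizonSlope_self ha hzc]
      exact (one_sub_mul_S2_ne_zero ha ha' (hzc.one_add_mul_pos ha le_rfl)
        hzc.horizonFn_eq_zero).symm
  · exact horizonSlope_pos_of_lt ha hzc hlt hz0.le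

theorem S1_lt_one (ha : 0 < a) (hzc : IsCauchyHorizon a zc) (hzc0 : zc < 0) (hz : zc ≤ z) :
    S1 a z < 1 := by
  have hpos := hzc.one_add_mul_pos ha le_rfl
  calc S1 a z ≤ S1 a zc := by
        rw [S1_eq hpos, S1_eq (hzc.one_add_mul_pos ha hz)]
        gcongr 2 * a / 3 * ?_
        exact Real.rpow_le_rpow_of_nonpos hpos (by gcongr) (by norm_num)
    _ < 1 := by
        have hroot := hzc.horizonFn_eq_zero
        rw [horizonFn] at hroot
        nlinarith [S_pos hpos]

end IsCauchyHorizon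

/-! ### The coefficients near the Cauchy horizon -/

theorem exists_abs_sub_le_mul {f : ℝ → ℝ} {T : ℝ} (hf : ContinuousOn f (Icc 0 T))
    (hd : DifferentiableAt ℝ f 0) : ∃ K, ∀ t ∈ Ioc 0 T, |f t - f 0| ≤ K * t := by
  have hslope : ContinuousOn (dslope f 0) (Icc 0 T) := by
    intro t ht
    rcases eq_or_ne t 0 with rfl | ht0
    · exact (continuousAt_dslope_same.2 hd).continuousWithinAt
    · exact (continuousWithinAt_dslope_of_ne ht0).2 (hf t ht)
  obtain ⟨K, hK⟩ := isCompact_Icc.exists_bound_of_continuousOn hslope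
  refine ⟨K, fun t ht => ?_⟩
  have hsub := sub_smul_dslope f 0 t
  rw [sub_zero, smul_eq_mul] at hsub
  rw [← hsub, abs_mul, abs_of_pos ht.1, mul_comm]
  exact mul_le_mul_of_nonneg_right (hK t (Ioc_subset_Icc_self ht)) ht.1.le

theorem exists_forall_abs_le {ι : Type*} [Finite ι] {T : ℝ} {f : ι → ℝ → ℝ}
    (hf : ∀ i, ContinuousOn (f i) (Icc 0 T)) : ∃ K, ∀ i, ∀ t ∈ Icc 0 T, |f i t| ≤ K := by
  choose M hM using fun i => isCompact_Icc.exists_bound_of_continuousOn (hf i)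
  obtain ⟨K, hK⟩ := Set.finite_range M |>.bddAbove
  exact ⟨K, fun i t ht => (hM i t ht).trans (hK (mem_range_self i))⟩

theorem tendsto_nhdsGT_of_continuousOn {f F : ℝ → ℝ} {T : ℝ} (hT : 0 < T)
    (hF : ContinuousOn F (Icc 0 T)) (hfF : EqOn f F (Ioc 0 T)) :
    Tendsto f (𝓝[>] 0) (𝓝 (F 0)) := by
  have hlim : Tendsto F (𝓝[>] 0) (𝓝 (F 0)) := (hF 0 ⟨le_rfl, hT.le⟩).tendsto.mono_left
    (nhdsWithin_le_of_mem (mem_of_superset (Ioc_mem_nhdsGT hT) Ioc_subset_Icc_self))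
  exact hlim.congr' (mem_of_superset (Ioc_mem_nhdsGT hT) fun t ht => (hfF ht).symm)

theorem abs_mul_le_mul_of_mem_Ioc {t T x K : ℝ} (ht : t ∈ Ioc 0 T) (hx : |x| ≤ K) :
    |t * x| ≤ K * t := by
  rw [abs_mul, abs_of_pos ht.1, mul_comm]
  exact mul_le_mul_of_nonneg_right hx ht.1.le

theorem RegularSingular.exists_of_continuousOn
    {C : ℝ → Matrix (Fin (n + 1)) (Fin (n + 1)) ℝ}
    {h : ℝ → Fin (n + 1) → ℝ} {T : ℝ} {R : Fin n → Fin (n + 1) → ℝ → ℝ}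
    {L : Fin (n + 1) → ℝ → ℝ} {f : Fin n → ℝ → ℝ} {f' : ℝ → ℝ} (hT : 0 < T)
    (hR : ∀ i j, ContinuousOn (R i j) (Icc 0 T)) (hL : ∀ j, ContinuousOn (L j) (Icc 0 T))
    (hf : ∀ i, ContinuousOn (f i) (Icc 0 T)) (hf' : ContinuousOn f' (Icc 0 T))
    (hCR : ∀ (i : Fin n) j, EqOn (fun t => C t i.castSucc j) (fun t => t * R i j t) (Ioc 0 T))
    (hCL : ∀ j, EqOn (fun t => C t (Fin.last n) j) (L j) (Ioc 0 T))
    (hhf : ∀ i : Fin n, EqOn (fun t => h t i.castSucc) (fun t => t * f i t) (Ioc 0 T))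
    (hhf' : EqOn (fun t => h t (Fin.last n)) f' (Ioc 0 T))
    (hd : DifferentiableAt ℝ (L (Fin.last n)) 0) (hc : 1 < L (Fin.last n) 0) :
    ∃ K, RegularSingular C h (L (Fin.last n) 0) T K := by
  obtain ⟨KR, hKR⟩ := exists_forall_abs_le fun p : Fin n × Fin (n + 1) => hR p.1 p.2
  obtain ⟨KL, hKL⟩ := exists_forall_abs_le hL
  obtain ⟨Kf, hKf⟩ := exists_forall_abs_le hf
  obtain ⟨Kf', hKf'⟩ := exists_forall_abs_le fun _ : Unit => hf'
  obtain ⟨Kd, hKd⟩ := exists_abs_sub_le_mul (hL (Fin.last n)) hd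
  obtain ⟨K, hK⟩ := (Set.toFinite {0, KR, KL, Kf, Kf', Kd}).bddAbove
  simp only [mem_upperBounds, mem_insert_iff, mem_singleton_iff, forall_eq_or_imp,
    forall_eq] at hK
  obtain ⟨hK0, hKRK, hKLK, hKfK, hKf'K, hKdK⟩ := hK
  exact ⟨K,
    { T_pos := hT
      K_nonneg := hK0
      one_lt := hc
      continuousOn_C := fun i j => by
        induction i using Fin.lastCases with
        | last => exact ((hL j).mono Ioc_subset_Icc_self).congr (hCL j)
        | cast i =>
          exact (continuousOn_id.mul ((hR i j).mono Ioc_subset_Icc_self)).congr (hCR i j)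
      continuousOn_h := fun i => by
        induction i using Fin.lastCases with
        | last => exact (hf'.mono Ioc_subset_Icc_self).congr hhf'
        | cast i => exact (continuousOn_id.mul ((hf i).mono Ioc_subset_Icc_self)).congr (hhf i)
      C_castSucc := fun i j t ht => (congrArg abs (hCR i j ht)).trans_le
        (abs_mul_le_mul_of_mem_Ioc ht ((hKR (i, j) t (Ioc_subset_Icc_self ht)).trans hKRK))
      C_last := fun j t ht => (congrArg abs (hCL _ ht)).trans_le
        ((hKL _ t (Ioc_subset_Icc_self ht)).trans hKLK)
      C_diag := fun t ht => by
        rw [show C t (Fin.last n) (Fin.last n) = _ from hCL _ ht, abs_sub_comm]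
        exact (hKd t ht).trans (mul_le_mul_of_nonneg_right hKdK ht.1.le)
      h_castSucc := fun i t ht => (congrArg abs (hhf i ht)).trans_le
        (abs_mul_le_mul_of_mem_Ioc ht ((hKf i t (Ioc_subset_Icc_self ht)).trans hKfK))
      h_last := fun t ht => (congrArg abs (hhf' ht)).trans_le
        ((hKf' () t (Ioc_subset_Icc_self ht)).trans hKf'K)
      C_tendsto := fun j => ⟨_, tendsto_nhdsGT_of_continuousOn hT (hL _) (hCL _)⟩
      h_tendsto := ⟨_, tendsto_nhdsGT_of_continuousOn hT hf' hhf'⟩ }⟩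

/-- The entries of the last row of `C̃`, multiplied by `z + S - z S'`. -/
def lastRow (a z : ℝ) : Fin 5 → ℝ :=
  ![-(4 * (-(z * S1 a z ^ 2) + S a z * (S1 a z + z * S2 a z)) / S a z), 0,
    -((-1 + S1 a z) * (S a z - z * S1 a z) / S a z),
    -((-1 + S1 a z) * (S a z - z * S1 a z) / S a z),
    -((3 + (-z + S a z) * S2 a z + S1 a z * (-3 + z * S2 a z)) / (-1 + S1 a z))]

/-- The last component of the source, multiplied by `z + S - z S'`. -/
def lastSource (a z : ℝ) : ℝ :=
  8 * Real.pi * q a z * (-1 + S1 a z) * (S a z - z * S1 a z) / S a z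

namespace IsCauchyHorizon

variable {a zc : ℝ}

section Continuity

variable (ha : 0 < a) (hzc : IsCauchyHorizon a zc)
include ha hzc

theorem denominators_ne_zero {z : ℝ} (hz : z ∈ Ico zc 0) :
    S a z ≠ 0 ∧ -1 + S1 a z ≠ 0 ∧ 1 + S1 a z ≠ 0 ∧ S a z - z * S1 a z ≠ 0 ∧ z ≠ 0 ∧
      z - S a z + z * S1 a z ≠ 0 ∧ q a z ≠ 0 := by
  obtain ⟨hz, hz0⟩ := hz
  have hpos := hzc.one_add_mul_pos ha hz
  have hS := S_pos hpos
  have hS1 := S1_pos ha hpos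
  have hS1' := hzc.S1_lt_one ha (hz.trans_lt hz0) hz
  have hzS1 := mul_neg_of_neg_of_pos hz0 hS1
  exact ⟨hS.ne', by linarith, by linarith, by linarith, hz0.ne, by linarith, (q_pos ha hpos).ne'⟩

theorem continuousOn_S : ContinuousOn (S a) (Ico zc 0) := fun _ hz =>
  (hasDerivAt_S (hzc.one_add_mul_pos ha hz.1)).continuousAt.continuousWithinAt

theorem continuousOn_S1 : ContinuousOn (S1 a) (Ico zc 0) := fun _ hz =>
  (hasDerivAt_S1 (hzc.one_add_mul_pos ha hz.1)).continuousAt.continuousWithinAt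

theorem continuousOn_S2 : ContinuousOn (S2 a) (Ico zc 0) := fun _ hz =>
  (hasDerivAt_S2 (hzc.one_add_mul_pos ha hz.1)).continuousAt.continuousWithinAt

theorem continuousOn_S3 : ContinuousOn (S3 a) (Ico zc 0) := fun _ hz =>
  (continuousAt_S3 (hzc.one_add_mul_pos ha hz.1)).continuousWithinAt

theorem continuousOn_q : ContinuousOn (q a) (Ico zc 0) := fun _ hz =>
  (contDiffAt_q (hzc.one_add_mul_pos ha hz.1)).continuousAt.continuousWithinAt

theorem continuousOn_dq : ContinuousOn (dq a) (Ico zc 0) := fun _ hz =>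
  (continuousAt_dq (hzc.one_add_mul_pos ha hz.1)).continuousWithinAt

theorem continuousOn_lastRow (j : Fin 5) : ContinuousOn (fun z => lastRow a z j) (Ico zc 0) := by
  have hS := hzc.continuousOn_S ha
  have hS1 := hzc.continuousOn_S1 ha
  have hS2 := hzc.continuousOn_S2 ha
  have hne : ∀ z ∈ Ico zc 0, S a z ≠ 0 := fun z hz =>
    (hzc.denominators_ne_zero ha hz).1
  have hne1 : ∀ z ∈ Ico zc 0, -1 + S1 a z ≠ 0 := fun z hz =>
    (hzc.denominators_ne_zero ha hz).2.1
  fin_cases j <;> dsimp [lastRow] <;> fun_prop (disch := assumption)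

theorem continuousOn_lastSource : ContinuousOn (lastSource a) (Ico zc 0) := by
  have hS := hzc.continuousOn_S ha
  have hS1 := hzc.continuousOn_S1 ha
  have hq := hzc.continuousOn_q ha
  exact ContinuousOn.div (by fun_prop) hS fun z hz => (hzc.denominators_ne_zero ha hz).1

theorem continuousOn_Ctilde (l : ℕ) (i : Fin 4) (j : Fin 5) :
    ContinuousOn (fun z => Ctilde a l z i.castSucc j) (Ico zc 0) := by
  have hS := hzc.continuousOn_S ha
  have hS1 := hzc.continuousOn_S1 ha
  have hS2 := hzc.continuousOn_S2 ha
  have hS3 := hzc.continuousOn_S3 ha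
  have hq := hzc.continuousOn_q ha
  have hdq := hzc.continuousOn_dq ha
  simp only [Ctilde, Matrix.of_apply]
  fin_cases i <;> fin_cases j <;>
    simp only [Fin.zero_eta, Fin.mk_one, Fin.reduceFinMk, Fin.castSucc_zero, Fin.castSucc_one,
      Fin.reduceCastSucc, Matrix.cons_val] <;>
    fun_prop (disch := intro z hz; simp [hzc.denominators_ne_zero ha hz])

theorem continuousOn_ftilde (i : Fin 4) :
    ContinuousOn (fun z => ftilde a z i.castSucc) (Ico zc 0) := by
  have hS := hzc.continuousOn_S ha
  have hS1 := hzc.continuousOn_S1 ha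
  have hq := hzc.continuousOn_q ha
  fin_cases i <;> dsimp [ftilde] <;>
    fun_prop (disch := intro z hz; simp [hzc.denominators_ne_zero ha hz])

theorem continuousOn_Atilde (i : Fin 4) :
    ContinuousOn (fun z => Atilde a z i.castSucc i.castSucc) (Ico zc 0) := by
  have hS := hzc.continuousOn_S ha
  have hS1 := hzc.continuousOn_S1 ha
  simp only [Atilde, Matrix.diagonal_apply_eq]
  have hz0 : ∀ z ∈ Ico zc 0, z ≠ 0 := fun z hz => hz.2.ne
  have hne : ∀ z ∈ Ico zc 0, z - S a z + z * S1 a z ≠ 0 := fun z hz =>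
    (hzc.denominators_ne_zero ha hz).2.2.2.2.2.1
  fin_cases i <;> dsimp <;> fun_prop (disch := assumption)

end Continuity

section Coefficients

variable (hzc : IsCauchyHorizon a zc) {t : ℝ} (ht : t ≠ 0)
include hzc ht

theorem C_last_eq (l : ℕ) (j : Fin 5) :
    C a l zc t 4 j = lastRow a (zc + t) j / horizonSlope a zc (zc + t) := by
  have hfactor : zc + t + S a (zc + t) - (zc + t) * S1 a (zc + t)
      = t * horizonSlope a zc (zc + t) := hzc.horizonFn_eq_mul t
  have hcancel (n m k : ℝ) : t * -(n / (m * (t * k))) = -(n / m) / k := by field_simp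
  fin_cases j <;> simp [C, Ctilde, lastRow, hfactor, hcancel]

theorem h_last_eq : h a zc t 4 = lastSource a (zc + t) / horizonSlope a zc (zc + t) := by
  have hfactor : zc + t + S a (zc + t) - (zc + t) * S1 a (zc + t)
      = t * horizonSlope a zc (zc + t) := hzc.horizonFn_eq_mul t
  have hcancel (n m k : ℝ) : t * (n / (m * (t * k))) = n / m / k := by field_simp
  simp [h, ftilde, lastSource, hfactor, hcancel]

theorem A_last_eq : A a zc t 4 4 = -1 / horizonSlope a zc (zc + t) := by
  have hfactor : zc + t + S a (zc + t) - (zc + t) * S1 a (zc + t)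
      = t * horizonSlope a zc (zc + t) := hzc.horizonFn_eq_mul t
  have hcancel (k : ℝ) : t * (k⁻¹ * t⁻¹) = k⁻¹ := by field_simp
  simp [A, Atilde, hfactor, hcancel, neg_div]

end Coefficients

theorem lastRow_four_self (ha : 0 < a) (hzc : IsCauchyHorizon a zc) (hzc0 : zc < 0) :
    lastRow a zc 4 = 3 - 2 * (zc * S2 a zc) := by
  have hroot : zc + S a zc - zc * S1 a zc = 0 := hzc.horizonFn_eq_zero
  have hS1 : -1 + S1 a zc ≠ 0 := (hzc.denominators_ne_zero ha ⟨le_rfl, hzc0⟩).2.1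
  have hS : S a zc = zc * S1 a zc - zc := by linarith
  change -((3 + (-zc + S a zc) * S2 a zc + S1 a zc * (-3 + zc * S2 a zc)) / (-1 + S1 a zc)) = _
  rw [hS]
  field_simp
  ring

theorem differentiableAt_lastRow (ha : 0 < a) (hzc : IsCauchyHorizon a zc) (hzc0 : zc < 0) :
    DifferentiableAt ℝ (fun z => lastRow a z 4) zc := by
  have hpos := hzc.one_add_mul_pos ha le_rfl
  have hS := (hasDerivAt_S hpos).differentiableAt
  have hS1 := (hasDerivAt_S1 hpos).differentiableAt
  have hS2 := (hasDerivAt_S2 hpos).differentiableAt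
  have hne : -1 + S1 a zc ≠ 0 := (hzc.denominators_ne_zero ha ⟨le_rfl, hzc0⟩).2.1
  change DifferentiableAt ℝ (fun z => -((3 + (-z + S a z) * S2 a z
    + S1 a z * (-3 + z * S2 a z)) / (-1 + S1 a z))) zc
  fun_prop (disch := assumption)

section Shifted

variable {T : ℝ}

theorem continuousOn_shift {F : ℝ → ℝ} (hzcT : zc + T < 0) (hF : ContinuousOn F (Ico zc 0)) :
    ContinuousOn (fun t => F (zc + t)) (Icc 0 T) :=
  hF.comp (by fun_prop) fun t ht => ⟨by linarith [ht.1], by linarith [ht.2]⟩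

variable (ha : 0 < a) (ha' : a < aStar) (hzc : IsCauchyHorizon a zc)
include ha ha' hzc

theorem continuousOn_div_horizonSlope {F : ℝ → ℝ} (hzcT : zc + T < 0)
    (hF : ContinuousOn F (Ico zc 0)) :
    ContinuousOn (fun t => F (zc + t) / horizonSlope a zc (zc + t)) (Icc 0 T) :=
  continuousOn_shift (F := fun z => F z / horizonSlope a zc z) hzcT (hF.div
    (fun _ hz => (hzc.continuousAt_horizonSlope ha hz.1).continuousWithinAt)
    fun _ hz => (hzc.horizonSlope_pos ha ha' hz.1 hz.2).ne')

theorem differentiableAt_lastRow_div_horizonSlope (hzc0 : zc < 0) :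
    DifferentiableAt ℝ (fun t => lastRow a (zc + t) 4 / horizonSlope a zc (zc + t)) 0 := by
  have hdiv : DifferentiableAt ℝ (fun z => lastRow a z 4 / horizonSlope a zc z) (zc + 0) := by
    rw [add_zero]
    exact (hzc.differentiableAt_lastRow ha hzc0).div (hzc.differentiableAt_horizonSlope ha)
      (hzc.horizonSlope_pos ha ha' le_rfl hzc0).ne'
  exact hdiv.comp (0 : ℝ) ((differentiableAt_const zc).add differentiableAt_id)

theorem cExp_eq (l : ℕ) (hzc0 : zc < 0) : cExp a l zc = lastRow a zc 4 / horizonSlope a zc zc := by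
  obtain ⟨T, hT, hzcT⟩ : ∃ T, 0 < T ∧ zc + T < 0 := ⟨-zc / 2, by linarith, by linarith⟩
  have hlim := tendsto_nhdsGT_of_continuousOn hT
    (hzc.continuousOn_div_horizonSlope ha ha' hzcT (hzc.continuousOn_lastRow ha 4))
    fun t ht => hzc.C_last_eq ht.1.ne' l 4
  simpa only [cExp, add_zero] using hlim.limUnder_eq

theorem one_lt_cExp (l : ℕ) (hzc0 : zc < 0) : 1 < cExp a l zc := by
  have hslope := hzc.horizonSlope_pos ha ha' le_rfl hzc0
  have hzcS2 := mul_pos_of_neg_of_neg hzc0 (S2_neg ha (hzc.one_add_mul_pos ha le_rfl))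
  rw [hzc.horizonSlope_self ha] at hslope
  rw [hzc.cExp_eq ha ha' l hzc0, hzc.lastRow_four_self ha hzc0, hzc.horizonSlope_self ha,
    one_lt_div hslope]
  linarith

theorem exists_regularSingular (l : ℕ) (hT : 0 < T) (hzcT : zc + T < 0) :
    ∃ K, RegularSingular (C a l zc) (h a zc) (cExp a l zc) T K := by
  have hzc0 : zc < 0 := by linarith
  have hcExp := hzc.cExp_eq ha ha' l hzc0
  have hdiv {F : ℝ → ℝ} (hF : ContinuousOn F (Ico zc 0)) :=
    hzc.continuousOn_div_horizonSlope ha ha' hzcT hF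
  have hexists := RegularSingular.exists_of_continuousOn (C := C a l zc) (h := h a zc) hT
    (fun i j => continuousOn_shift hzcT (hzc.continuousOn_Ctilde ha l i j))
    (fun j => hdiv (hzc.continuousOn_lastRow ha j))
    (fun i => continuousOn_shift hzcT (hzc.continuousOn_ftilde ha i))
    (hdiv (hzc.continuousOn_lastSource ha))
    (fun _ _ _ _ => rfl) (fun j t ht => hzc.C_last_eq ht.1.ne' l j) (fun _ _ _ => rfl)
    (fun t ht => hzc.h_last_eq ht.1.ne')
    (hzc.differentiableAt_lastRow_div_horizonSlope ha ha' hzc0)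
  simp only [Fin.reduceLast, add_zero, ← hcExp] at hexists
  exact hexists (hzc.one_lt_cExp ha ha' l hzc0)

theorem exists_continuousOn_eqOn_A (hzcT : zc + T < 0) (i : Fin 5) :
    ∃ F : ℝ → ℝ, ContinuousOn F (Icc 0 T) ∧ EqOn (fun t => A a zc t i i) F (Ioc 0 T) := by
  induction i using Fin.lastCases with
  | last => exact ⟨_, hzc.continuousOn_div_horizonSlope ha ha' (F := fun _ => -1) hzcT
      continuousOn_const, fun t ht => hzc.A_last_eq ht.1.ne'⟩
  | cast i => exact ⟨_, continuousOn_id.mul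
      (continuousOn_shift hzcT (hzc.continuousOn_Atilde ha i)), fun _ _ => rfl⟩

theorem continuousOn_A_diag (hzcT : zc + T < 0) (i : Fin 5) :
    ContinuousOn (fun t => A a zc t i i) (Ioc 0 T) := by
  obtain ⟨F, hF, hAF⟩ := hzc.exists_continuousOn_eqOn_A ha ha' hzcT i
  exact (hF.mono Ioc_subset_Icc_self).congr hAF

theorem exists_abs_A_diag_le (hzcT : zc + T < 0) :
    ∃ M, ∀ i, ∀ t ∈ Ioc 0 T, |A a zc t i i| ≤ M := by
  choose F hF hAF using hzc.exists_continuousOn_eqOn_A ha ha' hzcT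
  obtain ⟨M, hM⟩ := exists_forall_abs_le hF
  exact ⟨M, fun i t ht => (congrArg abs (hAF i ht)).trans_le (hM i t (Ioc_subset_Icc_self ht))⟩

end Shifted

end IsCauchyHorizon

theorem IsSolution.isWeakSolution {a zc T : ℝ} {l : ℕ} {g : ℝ → ℝ}
    {u₀ : Lp V 1 (volume : Measure ℝ)} {u : ℝ → Lp V 1 (volume : Measure ℝ)}
    (hu : IsSolution a l zc g T u₀ u) :
    IsWeakSolution (C a l zc) (h a zc) (fun i t => A a zc t i i) T g u := by
  refine ⟨hu.continuousOn, fun i ψ hψ hψ' t ht => (hu.weak i ψ hψ hψ' t ht).congr_deriv ?_⟩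
  have hdiag : ∑ j, A a zc t i j * ∫ p, u t p j * deriv ψ p
      = A a zc t i i * ∫ p, u t p i * deriv ψ p :=
    Finset.sum_eq_single i (fun j _ hj => by
      simp [A, Atilde, Matrix.diagonal_apply_ne _ hj.symm]) (by simp)
  rw [hdiag]

theorem Solves.add_sum_smul {C : ℝ → Matrix (Fin (n + 1)) (Fin (n + 1)) ℝ}
    {h : ℝ → Fin (n + 1) → ℝ} {T G : ℝ} {χ : ℝ → EuclideanSpace ℝ (Fin (n + 1))} {ι : Type*}
    {φ : ι → ℝ → EuclideanSpace ℝ (Fin (n + 1))} (hχ : Solves C h T G χ)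
    (hφ : ∀ i, Solves C h T 0 (φ i)) (d : ι → ℝ) (s : Finset ι) :
    Solves C h T G (fun t => χ t + ∑ i ∈ s, d i • φ i t) := by
  classical
  induction s using Finset.induction_on with
  | empty => simpa using hχ
  | insert i s hi ih =>
    have hadd := ih.add_smul (hφ i) (d i)
    rw [mul_zero, add_zero] at hadd
    convert hadd using 2 with t
    rw [Finset.sum_insert hi, add_comm (d i • φ i t), add_assoc]

theorem tendsto_rpow_mul_add_sum_smul {χ : ℝ → EuclideanSpace ℝ (Fin (n + 1))}
    {φ : Fin (n + 1) → ℝ → EuclideanSpace ℝ (Fin (n + 1))} {c : ℝ} (hc : 0 < c)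
    (hχ : ∃ v, Tendsto χ (𝓝[>] 0) (𝓝 v))
    (hφ : ∀ i : Fin n, ∃ v, Tendsto (φ i.castSucc) (𝓝[>] 0) (𝓝 v))
    (hφ' : Tendsto (fun t => t ^ c • φ (Fin.last n) t) (𝓝[>] 0)
      (𝓝 (EuclideanSpace.single (Fin.last n) 1))) (d : Fin (n + 1) → ℝ) :
    Tendsto (fun t => t ^ c * (χ t + ∑ i, d i • φ i t) (Fin.last n)) (𝓝[>] 0)
      (𝓝 (d (Fin.last n))) := by
  have hpow : Tendsto (fun t : ℝ => t ^ c) (𝓝[>] 0) (𝓝 0) := by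
    have hcont := (Real.continuousAt_rpow_const 0 c (Or.inr hc.le)).tendsto
    rw [Real.zero_rpow hc.ne'] at hcont
    exact hcont.mono_left nhdsWithin_le_nhds
  have hvanish {f : ℝ → EuclideanSpace ℝ (Fin (n + 1))} :
      (∃ v, Tendsto f (𝓝[>] 0) (𝓝 v)) → Tendsto (fun t => t ^ c • f t) (𝓝[>] 0) (𝓝 0) := by
    rintro ⟨v, hv⟩
    simpa only [zero_smul] using hpow.smul hv
  have hsum : Tendsto (fun t => t ^ c • (χ t + ∑ i, d i • φ i t)) (𝓝[>] 0)
      (𝓝 (d (Fin.last n) • EuclideanSpace.single (Fin.last n) 1)) := by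
    simpa only [Fin.sum_univ_castSucc, smul_add, Finset.smul_sum, smul_comm _ (d _), smul_zero,
      Finset.sum_const_zero, zero_add] using (hvanish hχ).add
        ((tendsto_finsetSum _ fun i _ => (hvanish (hφ i)).const_smul (d i.castSucc)).add
          (hφ'.const_smul (d (Fin.last n))))
  have hproj := ((EuclideanSpace.proj (𝕜 := ℝ) (Fin.last n)).continuous.tendsto _).comp hsum
  simpa [Function.comp_def, mul_add] using hproj

theorem integral_coord (f : Lp V 1 (volume : Measure ℝ)) (i : Fin 5) :
    (∫ p, f p) i = ∫ p, f p i :=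
  ((EuclideanSpace.proj i : V →L[ℝ] ℝ).integral_comp_comm (L1.integrable_coeFn f)).symm

theorem exists_isFundamentalSystem {a zc T K : ℝ} {l : ℕ}
    (H : RegularSingular (C a l zc) (h a zc) (cExp a l zc) T K) (G : ℝ) :
    ∃ φ χ, IsFundamentalSystem a l zc T G φ χ := by
  obtain ⟨φ, χ, hφ, hχ, hli, hfin, hfinχ, hdiv⟩ := H.exists_fundamental_system G
  refine ⟨φ, χ, hφ, hχ, hli, fun i hi => ?_, hfinχ, hdiv⟩
  induction i using Fin.lastCases with
  | last => exact absurd rfl hi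
  | cast i => exact hfin i

namespace IsFundamentalSystem

variable {a zc T G : ℝ} {l : ℕ} {φ : Fin 5 → ℝ → V} {χ : ℝ → V}
  (hsys : IsFundamentalSystem a l zc T G φ χ)
include hsys

theorem exists_coeffs (v : V) : ∃ d : Fin 5 → ℝ, v = χ T + ∑ i, d i • φ i T := by
  have hspan := hsys.linearIndependent.span_eq_top_of_card_eq_finrank (by simp)
  obtain ⟨d, hd⟩ := (Submodule.mem_span_range_iff_exists_fun ℝ).1
    (hspan ▸ Submodule.mem_top : v - χ T ∈ Submodule.span ℝ (range fun i => φ i T))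
  exact ⟨d, by rw [hd, add_sub_cancel]⟩

theorem tendsto_rpow_mul (hc : 0 < cExp a l zc) (d : Fin 5 → ℝ) :
    Tendsto (fun t => t ^ cExp a l zc * (χ t + ∑ i, d i • φ i t) 4) (𝓝[>] 0) (𝓝 (d 4)) :=
  tendsto_rpow_mul_add_sum_smul hc hsys.finite_particular
    (fun i => hsys.finite _ i.castSucc_lt_last.ne) hsys.divergent d

end IsFundamentalSystem

end LTB

end

theorem mainTheorem3_general (a : ℝ) (ha : 0 < a) (ha' : a < LTB.aStar) (l : ℕ)
    (zc : ℝ) (hzc : LTB.IsCauchyHorizon a zc)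
    (t₁ : ℝ) (ht₁ : 0 < t₁) (ht₁' : zc + t₁ < 0)
    (g : ℝ → ℝ) (hg : Integrable g)
    (u₀ : Lp LTB.V 1 (volume : Measure ℝ)) (hu₀ : u₀ ∈ LTB.SDoublePrime a l zc g t₁)
    (u : ℝ → Lp LTB.V 1 (volume : Measure ℝ)) (hu : LTB.IsSolution a l zc g t₁ u₀ u)
    (r : ENNReal) (hr : 1 ≤ r) :
    Tendsto (fun t => eLpNorm (u t) r volume) (𝓝[>] 0) (𝓝 ⊤) := by
  obtain ⟨K, H⟩ := hzc.exists_regularSingular ha ha' l ht₁ ht₁'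
  obtain ⟨M, hA⟩ := hzc.exists_abs_A_diag_le ha ha' ht₁'
  obtain ⟨φ, χ, hsys⟩ := LTB.exists_isFundamentalSystem H (∫ p, g p)
  obtain ⟨d, hd⟩ := hsys.exists_coeffs (∫ p, u₀ p)
  have hd4 : d 4 ≠ 0 := fun hd4 => hu₀ ⟨φ, χ, d, hsys, hd, hd4⟩
  have hmean := LTB.Solves.add_sum_smul hsys.solves_particular hsys.solves d Finset.univ
  refine hu.isWeakSolution.tendsto_eLpNorm_top H (hzc.continuousOn_A_diag ha ha' ht₁') hA hg
    hmean (fun i => ?_) hd4 (hsys.tendsto_rpow_mul (zero_lt_one.trans H.one_lt) d) hr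
  rw [hu.initial, ← LTB.integral_coord, ← hd]

theorem mainTheorem3 (a : ℝ) (ha : 0 < a) (ha' : a < LTB.aStar) (l : ℕ)
    (zc : ℝ) (hzc : LTB.IsCauchyHorizon a zc)
    (t₁ : ℝ) (ht₁ : 0 < t₁) (ht₁' : zc + t₁ < 0)
    (g : ℝ → ℝ) (hg : ContDiff ℝ ∞ g) (hg' : HasCompactSupport g)
    (u₀ : Lp LTB.V 1 (volume : Measure ℝ)) (hu₀ : u₀ ∈ LTB.SDoublePrime a l zc g t₁)
    (u : ℝ → Lp LTB.V 1 (volume : Measure ℝ)) (hu : LTB.IsSolution a l zc g t₁ u₀ u)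
    (r : ENNReal) (hr : 1 ≤ r) :
    Tendsto (fun t => eLpNorm (u t) r volume) (𝓝[>] 0) (𝓝 ⊤) :=
  mainTheorem3_general a ha ha' l zc hzc t₁ ht₁ ht₁' g
    (hg.continuous.integrable_of_hasCompactSupport hg') u₀ hu₀ u hu r hr
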